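/- **Setting.** Let $X=\begin{bmatrix}0&1\\1&0\end{bmatrix}$, $Z=\begin{bmatrix}1&0\\0&-1\end{bmatrix}$, $H=\tfrac1{\sqrt2}\begin{bmatrix}1&1\\1&-1\end{bmatrix}$, $CZ=\mathrm{diag}(1,1,1,-1)$. For $n\ge 0$ the real Pauli group $\mathcal P_n$ consists of all $\pm P_1\otimes\cdots\otimes P_n$ with $P_i\in\{I,X,Z,XZ\}$, and the real stabilizer (or real Clifford) group $\mathcal C_n$ is the normalizer of $\mathcal P_n$ in the orthogonal group $O(2^n)$. A real Clifford circuit on $n$ wires, numbered $0,\dots,n-1$ from top to bottom, is a word, read from left to right (the leftmost gate is applied first), in the gates $-1$ (a scalar), $H_i$ and $Z_i$ ($0\le i<n$, acting on wire $i$) and $K_i$ ($0\le i<n-1$, the gate $CZ$ acting on wires $i$ and $i+1$). Every circuit denotes an operator, namely the product of its gates. As usual for circuit diagrams, gates with no wire in common may be slid past each other, and the scalar $-1$ past every gate. **Reduced relations** ($\varepsilon$ denotes the empty circuit). - R1: $(-1)(-1)=\varepsilon$. - On one wire: R2: $Z_0Z_0=\varepsilon$. R3: $H_0H_0=\varepsilon$.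 R4: $Z_0H_0Z_0H_0Z_0H_0Z_0H_0=(-1)$. - On two wires: R5: $K_0K_0=\varepsilon$. R6: $Z_0K_0=K_0Z_0$. R7: $Z_1K_0=K_0Z_1$. R8: $H_0Z_0H_0K_0=K_0H_0Z_0Z_1H_0$. R9: $H_1Z_1H_1K_0=K_0H_1Z_0Z_1H_1$. R10: $H_0K_0H_0K_0=K_0H_0K_0H_0Z_1$. R11: $H_1K_0H_1K_0=K_0H_1K_0Z_0H_1$. R12: $H_1K_0H_0H_1K_0H_0H_1K_0=K_0H_0H_1K_0H_0H_1K_0H_0$. - On three wires: R13: $K_0K_1=K_1K_0$. R14: $H_2K_1H_1H_2K_1H_1K_0H_1K_1H_1H_2K_1H_2=H_0K_0H_0H_1K_0H_1K_1H_1K_0H_0H_1K_0H_0$. R15: $K_0H_0H_1K_0H_0H_1K_1K_0H_0H_1K_0H_0H_1K_1=K_1H_0H_1K_0H_0H_1K_0$. R16: $K_1H_1H_2K_1H_1H_2K_0K_1H_1H_2K_1H_1H_2K_0=K_0H_1H_2K_1H_1H_2K_1$. Each relation may be applied, in either direction, to any subcircuit and on any block of adjacent wires. **Normal circuits.** The following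 derived gates are used; wires carry a type, single or double, and all wires are single except where stated. - Kind $A$ (one wire): $A_1=\varepsilon$, $A_2=H_0$ (both with single output), $A_3=\varepsilon$ (with double output). - Kind $B$ (two wires): $B_1=B_5=H_1K_0H_0H_1K_0H_0H_1K_0$, $B_2=B_6=K_0H_0H_1K_0$, $B_3=B_7=H_0K_0H_0H_1K_0$, $B_4=B_8=H_1K_0H_1K_0H_0H_1K_0$. From the type of the bottom input to the type of the top output, $B_1,B_2,B_3$ go from single to single, $B_4$ from single to double, $B_5,B_6,B_7$ from double to double, $B_8$ from double to single. - Kind $C$ (one wire): $C_1=\varepsilon$, $C_2=H_0Z_0H_0$. - Kind $D$ (two wires): $D_1=K_0H_0H_1K_0H_0H_1K_0H_1$, $D_2=H_0K_0H_0H_1K_0H_1$, $D_3=H_0H_1K_0H_0H_1K_0H_1$, $D_4=H_0K_0H_0H_1K_0H_1K_0$. - Kind $E$ (one wire): $E_1=\varepsilon$, $E_2=Z_0$. A $Z$-circuit on $n\ge1$ wires consists of a gate of kind $A$ on some wire $k$, then gates of kind $B$ on wires $(k-1,k),(k-2,k-1),\dots,(0,1)$, then a gate of kind $C$ on wire $0$,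 such that the types of connected wires agree (so the wire entering the gate of kind $C$ is single). An $X$-circuit on $n\ge1$ wires consists of gates of kind $D$ on wires $(0,1),(1,2),\dots,(n-2,n-1)$, then a gate of kind $E$ on wire $n-1$. A normal circuit on $n$ wires is a circuit $L_nM_nL_{n-1}M_{n-1}\cdots L_1M_1\cdot(\pm1)$, where $L_i$ is a $Z$-circuit and $M_i$ an $X$-circuit on the top $i$ wires. **Proposition.** For every $n\ge0$: 1. For every real Clifford circuit $C$ on $n$ wires there is a unique normal circuit $N$ (as a typed circuit) that denotes the same operator as $C$, the normal form of $C$; and $C$ can be rewritten into $N$ by finitely many applications of the reduced relations R1–R16. 2. Consequently, the finitely many gates $-1$, $H_i$, $Z_i$, $K_i$ on $n$ wires together with the (finitely many) instances on $n$ wires of R1–R16 and of the sliding rule are a presentation of $\mathcal C_n$: sending a circuit to its operator induces an isomorphism from the monoid with these generators and relations onto $\mathcal C_n$ (with the order of multiplication reversed, since circuits are read from left to right). -/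

import Mathlib

namespace RealStabilizer

/-! ### Circuits over `-1`, `H`, `Z`, `CZ` -/

/-- The elementary gates on `n` wires; wire `0` is the top wire. `neg` is the scalar `-1`,
`H i` and `Z i` act on wire `i`, and `CZ i` acts on the adjacent wires `i` and `i + 1`. -/
inductive Gate (n : ℕ) : Type
  | neg : Gate n
  | H (i : Fin n) : Gate n
  | Z (i : Fin n) : Gate n
  | CZ (i : ℕ) (hi : i + 1 < n := by decide) : Gate n

/-- The wires on which a gate acts. -/
def Gate.wires {n : ℕ} : Gate n → Set ℕ
  | .neg => ∅
  | .H i => {(i : ℕ)}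
  | .Z i => {(i : ℕ)}
  | .CZ i _ => {i, i + 1}

/-- A circuit on `n` wires: a word in the gates, read from left to right as in a circuit diagram,
so that the leftmost gate is applied first. -/
abbrev Circuit (n : ℕ) : Type := FreeMonoid (Gate n)

/-- Write a circuit as a list of gates, the first one leftmost in the diagram. -/
abbrev circ {n : ℕ} (l : List (Gate n)) : Circuit n := FreeMonoid.ofList l

/-- Place a gate on `m` wires on the wires `k, …, k + m - 1` out of `n`. -/
def Gate.place {m n : ℕ} (k : ℕ) (h : k + m ≤ n) : Gate m → Gate n
  | .neg => .neg
  | .H i => .H ⟨k + i, by omega⟩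
  | .Z i => .Z ⟨k + i, by omega⟩
  | .CZ i _ => .CZ (k + i) (by omega)

/-- Place a circuit on `m` wires on the wires `k, …, k + m - 1` out of `n`, that is, tensor it with
`k` identity wires above and `n - k - m` identity wires below. -/
def Circuit.place {m n : ℕ} (k : ℕ) (h : k + m ≤ n) : Circuit m →* Circuit n :=
  FreeMonoid.map (Gate.place k h)

/-! ### The reduced relations -/

open Gate in
/-- The sixteen reduced relations; `ReducedRel m u v` is a relation `u = v` on `m` wires. -/
inductive ReducedRel : (m : ℕ) → Circuit m → Circuit m → Prop
  | R1 : ReducedRel 0 (circ [neg, neg]) (circ [])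
  | R2 : ReducedRel 1 (circ [Z 0, Z 0]) (circ [])
  | R3 : ReducedRel 1 (circ [H 0, H 0]) (circ [])
  | R4 : ReducedRel 1 (circ [Z 0, H 0, Z 0, H 0, Z 0, H 0, Z 0, H 0]) (circ [neg])
  | R5 : ReducedRel 2 (circ [CZ 0, CZ 0]) (circ [])
  | R6 : ReducedRel 2 (circ [Z 0, CZ 0]) (circ [CZ 0, Z 0])
  | R7 : ReducedRel 2 (circ [Z 1, CZ 0]) (circ [CZ 0, Z 1])
  | R8 : ReducedRel 2 (circ [H 0, Z 0, H 0, CZ 0]) (circ [CZ 0, H 0, Z 0, Z 1, H 0])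
  | R9 : ReducedRel 2 (circ [H 1, Z 1, H 1, CZ 0]) (circ [CZ 0, H 1, Z 0, Z 1, H 1])
  | R10 : ReducedRel 2 (circ [H 0, CZ 0, H 0, CZ 0]) (circ [CZ 0, H 0, CZ 0, H 0, Z 1])
  | R11 : ReducedRel 2 (circ [H 1, CZ 0, H 1, CZ 0]) (circ [CZ 0, H 1, CZ 0, Z 0, H 1])
  | R12 : ReducedRel 2
      (circ [H 1, CZ 0, H 0, H 1, CZ 0, H 0, H 1, CZ 0])
      (circ [CZ 0, H 0, H 1, CZ 0, H 0, H 1, CZ 0, H 0])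
  | R13 : ReducedRel 3 (circ [CZ 0, CZ 1]) (circ [CZ 1, CZ 0])
  | R14 : ReducedRel 3
      (circ [H 2, CZ 1, H 1, H 2, CZ 1, H 1, CZ 0, H 1, CZ 1, H 1, H 2, CZ 1, H 2])
      (circ [H 0, CZ 0, H 0, H 1, CZ 0, H 1, CZ 1, H 1, CZ 0, H 0, H 1, CZ 0, H 0])
  | R15 : ReducedRel 3
      (circ [CZ 0, H 0, H 1, CZ 0, H 0, H 1, CZ 1, CZ 0, H 0, H 1, CZ 0, H 0, H 1, CZ 1])
      (circ [CZ 1, H 0, H 1, CZ 0, H 0, H 1, CZ 0])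
  | R16 : ReducedRel 3
      (circ [CZ 1, H 1, H 2, CZ 1, H 1, H 2, CZ 0, CZ 1, H 1, H 2, CZ 1, H 1, H 2, CZ 0])
      (circ [CZ 0, H 1, H 2, CZ 1, H 1, H 2, CZ 1])

/-- The relations on `n`-wire circuits: each reduced relation placed on adjacent wires, and the
structural rule of circuit diagrams by which gates without a common wire slide past each other
(in particular, scalars move freely). -/
inductive CircuitRel (n : ℕ) : Circuit n → Circuit n → Prop
  | reduced {m : ℕ} {u v : Circuit m} (huv : ReducedRel m u v) (k : ℕ) (h : k + m ≤ n) :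
      CircuitRel n (Circuit.place k h u) (Circuit.place k h v)
  | slide (g g' : Gate n) (hd : Disjoint g.wires g'.wires) :
      CircuitRel n (circ [g, g']) (circ [g', g])

/-- `Rewrites C C'`: the circuit `C` can be turned into `C'` by finitely many applications of the
relations (in either direction) to subcircuits. -/
def Rewrites {n : ℕ} (C C' : Circuit n) : Prop := conGen (CircuitRel n) C C'

/-! ### Derived generators and normal circuits -/

/-- The type of a wire in a typed circuit. -/
inductive WireType : Type
  | single
  | double

/-- Derived generators of kind `A`, indexed by the type of the output wire. -/
inductive AGate : WireType → Type
  | A1 : AGate .single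
  | A2 : AGate .single
  | A3 : AGate .double

/-- Derived generators of kind `B`, indexed by the type of the bottom input wire and the type of
the top output wire (the other two wires are of single type). -/
inductive BGate : WireType → WireType → Type
  | B1 : BGate .single .single
  | B2 : BGate .single .single
  | B3 : BGate .single .single
  | B4 : BGate .single .double
  | B5 : BGate .double .double
  | B6 : BGate .double .double
  | B7 : BGate .double .double
  | B8 : BGate .double .single

/-- Derived generators of kind `C`; all wires are of single type. -/
inductive CGate : Type
  | C1
  | C2

/-- Derived generators of kind `D`; all wires are of single type. -/
inductive DGate : Type
  | D1
  | D2
  | D3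
  | D4

/-- Derived generators of kind `E`; all wires are of single type. -/
inductive EGate : Type
  | E1
  | E2

open Gate in
/-- The circuit of a derived generator of kind `A`. -/
def AGate.circuit {t : WireType} : AGate t → Circuit 1
  | .A1 => circ []
  | .A2 => circ [H 0]
  | .A3 => circ []

open Gate in
/-- The circuit of a derived generator of kind `B`. -/
def BGate.circuit {s t : WireType} : BGate s t → Circuit 2
  | .B1 | .B5 => circ [H 1, CZ 0, H 0, H 1, CZ 0, H 0, H 1, CZ 0]
  | .B2 | .B6 => circ [CZ 0, H 0, H 1, CZ 0]
  | .B3 | .B7 => circ [H 0, CZ 0, H 0, H 1, CZ 0]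
  | .B4 | .B8 => circ [H 1, CZ 0, H 1, CZ 0, H 0, H 1, CZ 0]

open Gate in
/-- The circuit of a derived generator of kind `C`; the second one is the gate `X = HZH`. -/
def CGate.circuit : CGate → Circuit 1
  | .C1 => circ []
  | .C2 => circ [H 0, Z 0, H 0]

open Gate in
/-- The circuit of a derived generator of kind `D`. -/
def DGate.circuit : DGate → Circuit 2
  | .D1 => circ [CZ 0, H 0, H 1, CZ 0, H 0, H 1, CZ 0, H 1]
  | .D2 => circ [H 0, CZ 0, H 0, H 1, CZ 0, H 1]
  | .D3 => circ [H 0, H 1, CZ 0, H 0, H 1, CZ 0, H 1]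
  | .D4 => circ [H 0, CZ 0, H 0, H 1, CZ 0, H 1, CZ 0]

open Gate in
/-- The circuit of a derived generator of kind `E`. -/
def EGate.circuit : EGate → Circuit 1
  | .E1 => circ []
  | .E2 => circ [Z 0]

/-- A well-typed ladder of `k` gates of kind `B`, on the wires `(k-1, k)`, then `(k-2, k-1)`, …,
finally `(0, 1)`. It starts on wire `k` with type `t` and ends on wire `0` with single type. -/
inductive BLadder : ℕ → WireType → Type
  | nil : BLadder 0 .single
  | cons {k : ℕ} {s t : WireType} (b : BGate s t) (r : BLadder k t) : BLadder (k + 1) s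

/-- The circuit of a ladder of gates of kind `B`. -/
def BLadder.circuit {n : ℕ} : {k : ℕ} → {t : WireType} → BLadder k t → k < n → Circuit n
  | _, _, .nil, _ => 1
  | k + 1, _, .cons b r, h =>
      Circuit.place k (show k + 2 ≤ n from h) b.circuit * r.circuit (by omega)

/-- A `Z`-circuit on `n` wires: a gate of kind `A` on some wire `k`, a ladder of gates of kind `B`
up to the top wire, and a gate of kind `C` on the top wire, such that the types match. -/
structure ZCircuit (n : ℕ) : Type where
  k : Fin n
  t : WireType
  a : AGate t
  b : BLadder k t
  c : CGate

/-- The underlying circuit of a `Z`-circuit. -/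
def ZCircuit.circuit {n : ℕ} (L : ZCircuit n) : Circuit n :=
  Circuit.place (L.k : ℕ) (show (L.k : ℕ) + 1 ≤ n from L.k.isLt) L.a.circuit *
    L.b.circuit L.k.isLt *
    Circuit.place 0 (show 0 + 1 ≤ n by have := L.k.isLt; omega) L.c.circuit

/-- An `X`-circuit on `n + 1` wires: gates of kind `D` on the wires `(0, 1)`, `(1, 2)`, …,
`(n-1, n)`, followed by a gate of kind `E` on the bottom wire `n`. -/
structure XCircuit (n : ℕ) : Type where
  d : Fin n → DGate
  e : EGate

/-- The underlying circuit of an `X`-circuit. -/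
def XCircuit.circuit {n : ℕ} (M : XCircuit n) : Circuit (n + 1) :=
  (List.ofFn fun i : Fin n =>
      Circuit.place (i : ℕ) (show (i : ℕ) + 2 ≤ n + 1 by omega) (M.d i).circuit).prod *
    Circuit.place n (le_refl (n + 1)) M.e.circuit

/-- Normal circuits: `L_n M_n L_{n-1} M_{n-1} ⋯ L_1 M_1 · (±1)`, where `L_i` is a `Z`-circuit and
`M_i` an `X`-circuit on the top `i` wires. The sign is `-1` if the Boolean is `true`. -/
inductive NormalCircuit : ℕ → Type
  | scalar (neg : Bool) : NormalCircuit 0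
  | cons {n : ℕ} (L : ZCircuit (n + 1)) (M : XCircuit n) (N : NormalCircuit n) :
      NormalCircuit (n + 1)

/-- The underlying circuit of a normal circuit. -/
def NormalCircuit.circuit : {n : ℕ} → NormalCircuit n → Circuit n
  | _, .scalar false => circ []
  | _, .scalar true => circ [Gate.neg]
  | n + 1, .cons L M N =>
      L.circuit * M.circuit * Circuit.place 0 (show 0 + n ≤ n + 1 by omega) N.circuit

/-! ### Operators -/

/-- Operators on `n` qubits: real `2 ^ n × 2 ^ n` matrices, with rows and columns indexed by the
computational basis states. -/
abbrev Operator (n : ℕ) : Type := Matrix (Fin n → Fin 2) (Fin n → Fin 2) ℝ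

/-- The Pauli matrix `X`. -/
def pauliX : Matrix (Fin 2) (Fin 2) ℝ := !![0, 1; 1, 0]

/-- The Pauli matrix `Z`. -/
def pauliZ : Matrix (Fin 2) (Fin 2) ℝ := !![1, 0; 0, -1]

/-- The Hadamard matrix. -/
noncomputable def hadamard : Matrix (Fin 2) (Fin 2) ℝ := (1 / √2) • !![1, 1; 1, -1]

/-- The tensor product `P 0 ⊗ ⋯ ⊗ P (n - 1)`. -/
def tensor {n : ℕ} (P : Fin n → Matrix (Fin 2) (Fin 2) ℝ) : Operator n :=
  Matrix.of fun x y => ∏ i, P i (x i) (y i)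

/-- The one-qubit operator `M` acting on qubit `i`. -/
def onQubit {n : ℕ} (i : Fin n) (M : Matrix (Fin 2) (Fin 2) ℝ) : Operator n :=
  tensor (Function.update (fun _ => 1) i M)

/-- The operator of a gate. -/
noncomputable def Gate.operator {n : ℕ} : Gate n → Operator n
  | .neg => -1
  | .H i => onQubit i hadamard
  | .Z i => onQubit i pauliZ
  | .CZ i hi => Matrix.diagonal fun x =>
      if x ⟨i, by omega⟩ = 1 ∧ x ⟨i + 1, hi⟩ = 1 then -1 else 1

/-- The operator of a circuit. Circuits are read from left to right, so the operator of
`g₁ g₂ ⋯ g_r` is the matrix product of the operators of `g_r, …, g₂, g₁` in this order. -/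
noncomputable def Circuit.operator {n : ℕ} (C : Circuit n) : Operator n :=
  (FreeMonoid.lift (fun g : Gate n => MulOpposite.op g.operator) C).unop

/-- The real Pauli group on `n` qubits, as a set of orthogonal matrices: all
`± P_1 ⊗ ⋯ ⊗ P_n` with each `P_i` one of `I`, `X`, `Z`, `XZ`. -/
def pauliGroup (n : ℕ) : Set (Matrix.orthogonalGroup (Fin n → Fin 2) ℝ) :=
  {U | ∃ P : Fin n → Matrix (Fin 2) (Fin 2) ℝ,
    (∀ i, P i ∈ ({1, pauliX, pauliZ, pauliX * pauliZ} : Set (Matrix (Fin 2) (Fin 2) ℝ))) ∧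
    ((U : Operator n) = tensor P ∨ (U : Operator n) = -tensor P)}

/-- The real Clifford group (real stabilizer group) on `n` qubits: the normalizer of the real Pauli
group in the orthogonal group. -/
def cliffordGroup (n : ℕ) : Subgroup (Matrix.orthogonalGroup (Fin n → Fin 2) ℝ) :=
  Subgroup.normalizer (pauliGroup n)

end RealStabilizer

namespace RealStabilizer

set_option linter.unusedSimpArgs false

/-! ### Words in a group -/

/-! Normal forms are obtained from operators alone, and completeness of the relations from a
Bruhat-type decomposition of the presented group; no circuit is ever rewritten step by step into its
normal form. Both halves rest on the conjugation action of circuits on signed Pauli strings, which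
depends only on the operator.

Existence (`IsClifford.exists_normalCircuit`). For a Clifford operator `U` take the preimages `p`
and `r` of `Z` and `X` on the bottom wire. A Z-circuit carries `p` to `Z` on the top wire: it starts
at the lowest nontrivial letter, each gate of kind `B` absorbs the letter above, and the gate of
kind `C` corrects the sign. The wire type records whether the travelling letter is `Z` or `XZ`; the
latter cannot come out at the end, because it squares to `-1`. The image of `r` anticommutes with
`Z` on the top wire, so an X-circuit can carry it to `X` on the bottom wire, and every X-circuit
carries `Z` from the top wire to the bottom wire. Dividing `U` by these two circuits leaves an
operator commuting with `Z` and `X` on the bottom wire. It lives on the other wires, and induction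
applies. Uniqueness (`normalCircuit_unique`): each gate of the two circuits can be read off from `p`
and `r`.

Completeness (`cls_eq_of_operator_eq`). The presented monoid is a group. Let `topStab` be generated
by `Z` on the top wire, `CZ` on the top two wires and all circuits below the top wire. The group is
the union of the double cosets of `topStab` through `1`, `X`, `H` and the swap (`inCells`): only
multiplication by `H` on the top wire has to be checked. Since `X`, `H` and the swap move `Z` on the
top wire, an element fixing it lies in `topStab` (`mem_topStab_of_actG`). Such an element is a
circuit below the top wire times a Pauli string controlled by the top wire
(`exists_below_mul_ctlG`), because circuits below conjugate controlled strings exactly as they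
conjugate strings (`ctlG_mul_place`). If `X` on the top wire is fixed too, the controlled string is
trivial. By induction on the number of wires, an element with trivial action is `1` or `-1`
(`cls_eq_one_or_neg`), and the operator distinguishes these two.

The computations with controlled strings need `CZ` gates between distant wires. These are conjugates
of `CZ` by swaps, and their rules spread by conjugation from two and three adjacent wires. -/

theorem mul_self_cancel_left {G : Type*} [Group G] {a : G} (h : a * a = 1) (x : G) :
    a * (a * x) = x := by
  rw [← mul_assoc, h, one_mul]

theorem mul_left_extend {G : Type*} [Group G] {a b c d : G} (h : a * b = c * d) (x : G) :
    a * (b * x) = c * (d * x) := by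
  rw [← mul_assoc, h, mul_assoc]

/-! ### Two wires -/

/-- The relations on two adjacent wires, in a group. -/
structure TwoWire {G : Type*} [Group G] (h₀ h₁ z₀ z₁ k : G) : Prop where
  h₀_sq : h₀ * h₀ = 1
  h₁_sq : h₁ * h₁ = 1
  z₀_sq : z₀ * z₀ = 1
  z₁_sq : z₁ * z₁ = 1
  k_sq : k * k = 1
  hh : h₁ * h₀ = h₀ * h₁
  hz : z₁ * h₀ = h₀ * z₁
  zh : z₀ * h₁ = h₁ * z₀
  zz : z₁ * z₀ = z₀ * z₁
  z₀k : z₀ * k = k * z₀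
  z₁k : z₁ * k = k * z₁
  x₀k : h₀ * z₀ * h₀ * k = k * h₀ * z₀ * z₁ * h₀
  x₁k : h₁ * z₁ * h₁ * k = k * h₁ * z₀ * z₁ * h₁
  hk₀ : h₀ * k * h₀ * k = k * h₀ * k * h₀ * z₁
  hk₁ : h₁ * k * h₁ * k = k * h₁ * k * z₀ * h₁
  braid : h₁ * k * h₀ * h₁ * k * h₀ * h₁ * k = k * h₀ * h₁ * k * h₀ * h₁ * k * h₀

/-- The swap of two adjacent wires. -/
def swapWord {G : Type*} [Group G] (h₀ h₁ k : G) : G :=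
  k * h₀ * h₁ * k * h₀ * h₁ * k * h₀ * h₁

namespace TwoWire

variable {G : Type*} [Group G] {h₀ h₁ z₀ z₁ k : G}

/-- The palindrome `k h₀ h₁ k h₀ h₁ k` is an involution that exchanges `h₀` and `h₁`. -/
theorem palindrome_sq (T : TwoWire h₀ h₁ z₀ z₁ k) :
    (k * h₀ * h₁ * k * h₀ * h₁ * k) * (k * h₀ * h₁ * k * h₀ * h₁ * k) = 1 := by
  simp only [mul_assoc, mul_left_extend T.hh, mul_self_cancel_left T.h₀_sq,
    mul_self_cancel_left T.h₁_sq, mul_self_cancel_left T.k_sq, T.k_sq]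

theorem h₁_palindrome (T : TwoWire h₀ h₁ z₀ z₁ k) :
    h₁ * (k * h₀ * h₁ * k * h₀ * h₁ * k) = k * h₀ * h₁ * k * h₀ * h₁ * k * h₀ := by
  simpa only [mul_assoc] using T.braid

theorem h₀_palindrome (T : TwoWire h₀ h₁ z₀ z₁ k) :
    h₀ * (k * h₀ * h₁ * k * h₀ * h₁ * k) = k * h₀ * h₁ * k * h₀ * h₁ * k * h₁ := by
  have h := T.h₁_palindrome
  have w := T.palindrome_sq
  generalize k * h₀ * h₁ * k * h₀ * h₁ * k = W at *
  have := congrArg (fun x => W * x * W) h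
  simpa only [mul_assoc, w, mul_self_cancel_left w, mul_one] using this.symm

theorem swapWord_eq (_ : TwoWire h₀ h₁ z₀ z₁ k) :
    swapWord h₀ h₁ k = k * h₀ * h₁ * k * h₀ * h₁ * k * (h₀ * h₁) := by
  simp only [swapWord, mul_assoc]

theorem swap_mul_h₀ (T : TwoWire h₀ h₁ z₀ z₁ k) :
    swapWord h₀ h₁ k * h₀ = h₁ * swapWord h₀ h₁ k := by
  rw [T.swapWord_eq, ← mul_assoc h₁, T.h₁_palindrome]
  simp only [mul_assoc, T.hh]

theorem swap_mul_h₁ (T : TwoWire h₀ h₁ z₀ z₁ k) :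
    swapWord h₀ h₁ k * h₁ = h₀ * swapWord h₀ h₁ k := by
  rw [T.swapWord_eq, ← mul_assoc h₀, T.h₀_palindrome]
  simp only [mul_assoc, mul_left_extend T.hh, T.h₁_sq]

theorem swap_sq (T : TwoWire h₀ h₁ z₀ z₁ k) :
    swapWord h₀ h₁ k * swapWord h₀ h₁ k = 1 := by
  have h := T.h₁_palindrome
  have h' := T.h₀_palindrome
  have w := T.palindrome_sq
  rw [T.swapWord_eq]
  generalize k * h₀ * h₁ * k * h₀ * h₁ * k = W at *
  simp only [mul_assoc, mul_left_extend h, mul_left_extend h', mul_self_cancel_left w, T.hh,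
    mul_left_extend T.hh, mul_self_cancel_left T.h₀_sq, T.h₁_sq]

/-- The swap is `(k h₀ h₁)³` and its inverse is `(h₀ h₁ k)³`. Being an involution it equals both, so
moving `k` across is a cyclic shift of the word. -/
theorem swap_mul_k (T : TwoWire h₀ h₁ z₀ z₁ k) :
    swapWord h₀ h₁ k * k = k * swapWord h₀ h₁ k := by
  have e : h₀ * h₁ * k * h₀ * h₁ * k * h₀ * h₁ * k = (swapWord h₀ h₁ k)⁻¹ := by
    rw [eq_inv_iff_mul_eq_one, swapWord]
    simp only [mul_assoc, mul_left_extend T.hh, T.hh, mul_self_cancel_left T.h₀_sq,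
      mul_self_cancel_left T.h₁_sq, mul_self_cancel_left T.k_sq, T.h₁_sq]
  rw [inv_eq_of_mul_eq_one_left T.swap_sq] at e
  rw [← e]
  nth_rewrite 1 [e]
  simp only [swapWord, mul_assoc]

/-- A swap is three controlled `X` gates: their inner Hadamards regroup into the palindrome between
two copies of `h₁`, and the braid relation moves the first copy to the other side. -/
theorem swap_eq₁ (T : TwoWire h₀ h₁ z₀ z₁ k) :
    swapWord h₀ h₁ k = h₁ * k * h₁ * (h₀ * k * h₀) * (h₁ * k * h₁) := by
  have e : h₁ * k * h₁ * (h₀ * k * h₀) * (h₁ * k * h₁)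
      = h₁ * (k * h₀ * h₁ * k * h₀ * h₁ * k) * h₁ := by
    simp only [mul_assoc, mul_left_extend T.hh]
  rw [e, T.h₁_palindrome, T.swapWord_eq]
  simp only [mul_assoc]

theorem swap_eq₀ (T : TwoWire h₀ h₁ z₀ z₁ k) :
    swapWord h₀ h₁ k = h₀ * k * h₀ * (h₁ * k * h₁) * (h₀ * k * h₀) := by
  have e : h₀ * k * h₀ * (h₁ * k * h₁) * (h₀ * k * h₀)
      = h₀ * (k * h₀ * h₁ * k * h₀ * h₁ * k) * h₀ := by
    simp only [mul_assoc, mul_left_extend T.hh]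
  rw [e, T.h₀_palindrome, T.swapWord_eq]
  simp only [mul_assoc, T.hh]

theorem z₁_cx (T : TwoWire h₀ h₁ z₀ z₁ k) :
    z₁ * (h₁ * k * h₁) = h₁ * k * h₁ * (z₀ * z₁) := by
  have := congrArg (fun x => h₁ * x * h₁) T.x₁k
  simpa only [mul_assoc, mul_self_cancel_left T.h₁_sq, T.h₁_sq, mul_one,
    mul_left_extend T.zh, ← T.zz] using this

theorem z₀_cx (T : TwoWire h₀ h₁ z₀ z₁ k) :
    z₀ * (h₁ * k * h₁) = h₁ * k * h₁ * z₀ := by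
  simp only [mul_assoc, mul_left_extend T.zh, mul_left_extend T.z₀k, T.zh]

theorem z₀_xc (T : TwoWire h₀ h₁ z₀ z₁ k) :
    z₀ * (h₀ * k * h₀) = h₀ * k * h₀ * (z₀ * z₁) := by
  have := congrArg (fun x => h₀ * x * h₀) T.x₀k
  simpa only [mul_assoc, mul_self_cancel_left T.h₀_sq, T.h₀_sq, mul_one] using this

theorem z₁_xc (T : TwoWire h₀ h₁ z₀ z₁ k) :
    z₁ * (h₀ * k * h₀) = h₀ * k * h₀ * z₁ := by
  simp only [mul_assoc, mul_left_extend T.hz, mul_left_extend T.z₁k, T.hz]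

theorem swap_mul_z₁ (T : TwoWire h₀ h₁ z₀ z₁ k) :
    swapWord h₀ h₁ k * z₁ = z₀ * swapWord h₀ h₁ k := by
  have e0 := T.z₀_cx
  have e1 := T.z₁_cx
  have f0 := T.z₀_xc
  have f1 := T.z₁_xc
  rw [T.swap_eq₁]
  generalize h₁ * k * h₁ = a at *
  generalize h₀ * k * h₀ = b at *
  simp only [mul_assoc, mul_left_extend e0, mul_left_extend e1, mul_left_extend f0,
    mul_left_extend f1, e0, e1, mul_self_cancel_left T.z₀_sq]

theorem swap_mul_z₀ (T : TwoWire h₀ h₁ z₀ z₁ k) :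
    swapWord h₀ h₁ k * z₀ = z₁ * swapWord h₀ h₁ k := by
  have := congrArg (fun x => swapWord h₀ h₁ k * x * swapWord h₀ h₁ k) T.swap_mul_z₁
  simpa only [mul_assoc, T.swap_sq, mul_self_cancel_left T.swap_sq, mul_one] using this.symm

theorem cx_mul_k (T : TwoWire h₀ h₁ z₀ z₁ k) :
    h₁ * k * h₁ * k = k * (h₁ * k * h₁) * z₀ := by
  rw [T.hk₁]
  simp only [mul_assoc, T.zh]

/-- Conjugating a controlled `Y` gate by a Hadamard gate on the control. -/
theorem h_cy_h (T : TwoWire h₀ h₁ z₀ z₁ k) :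
    h₀ * (k * (h₁ * k * h₁)) * h₀ =
      k * (h₁ * k * h₁) * z₀ * h₀ * (h₁ * k * (h₁ * z₁ * h₁) * (h₁ * k * h₁)) := by
  -- `h₀` is the conjugate of `h₁` by the swap, with `h₁ * swap * h₁` rewritten through controlled
  -- gates. Substituting this for the `h₀` on the right-hand side cancels the remaining Hadamards
  -- against the neighbouring `h₁` and leaves an identity between controlled gates and Paulis.
  have hh : h₀ = swapWord h₀ h₁ k * (k * (h₀ * (h₁ * k * h₁) * h₀) * k) * h₁ := by
    have e : k * (h₀ * (h₁ * k * h₁) * h₀) * k = h₁ * swapWord h₀ h₁ k * h₁ := by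
      rw [T.swap_eq₁]
      simp only [mul_assoc, mul_self_cancel_left T.h₁_sq, T.h₁_sq, mul_one,
        mul_left_extend T.hh]
    rw [e, mul_assoc, mul_assoc, T.h₁_sq, mul_one, ← mul_assoc, T.swap_mul_h₁, mul_assoc,
      T.swap_sq, mul_one]
  have sz := T.swap_mul_z₁
  have hl : h₀ * (k * (h₁ * k * h₁)) * h₀ = h₀ * k * h₀ * (h₀ * (h₁ * k * h₁) * h₀) := by
    simp only [mul_assoc, mul_self_cancel_left T.h₀_sq]
  have bb : k * (h₀ * k * h₀) = h₀ * k * h₀ * k * z₁ := by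
    rw [T.hk₀]
    simp only [mul_assoc, T.z₁_sq, mul_one]
  have za := T.z₁_cx
  have ak := T.cx_mul_k
  have da : h₀ * (h₁ * k * h₁) * h₀ * (h₁ * k * h₁) =
      h₁ * k * h₁ * (h₀ * (h₁ * k * h₁) * h₀) * (h₁ * z₁ * h₁) := by
    have := congrArg (fun x => h₁ * x * h₁) T.hk₀
    simpa only [mul_assoc, mul_self_cancel_left T.h₁_sq, T.hh, mul_left_extend T.hh] using this
  have aa : h₁ * k * h₁ * (h₁ * k * h₁) = 1 := by
    simp only [mul_assoc, mul_self_cancel_left T.h₁_sq, T.h₁_sq, mul_self_cancel_left T.k_sq]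
  have sw := T.swap_eq₁
  rw [hl]
  nth_rewrite 5 [hh]
  generalize swapWord h₀ h₁ k = s at *
  generalize h₀ * (h₁ * k * h₁) * h₀ = d at *
  generalize h₁ * z₁ * h₁ = x at *
  generalize hb : h₀ * k * h₀ = b at *
  rw [mul_assoc h₁ k h₁] at *
  generalize ha : h₁ * (k * h₁) = a at *
  have kak : ∀ y, k * (a * (k * y)) = a * (z₀ * y) := fun y => by
    rw [mul_left_extend ak, mul_assoc, mul_self_cancel_left T.k_sq]
  have adx : ∀ y, a * (d * (x * y)) = d * (a * y) := fun y => by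
    rw [← mul_assoc, ← mul_assoc, ← da, mul_assoc]
  simp only [mul_assoc, mul_self_cancel_left T.h₁_sq, mul_self_cancel_left T.k_sq,
    mul_left_extend sz.symm]
  simp only [sw, mul_assoc, mul_self_cancel_left aa, mul_left_extend bb, mul_left_extend za,
    mul_self_cancel_left T.z₁_sq, mul_left_extend T.z₀k, kak, mul_self_cancel_left T.z₀_sq, adx,
    aa, mul_one]

/-- An `X` on the control leaves a `Z` on the target whenever it passes a controlled gate. After
passing both it meets the last `h₀` and turns into a `Z`, so that a single `h₀` survives. -/
theorem x_cy_h (T : TwoWire h₀ h₁ z₀ z₁ k) :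
    h₀ * z₀ * h₀ * (k * (h₁ * k * h₁)) * h₀ = k * z₁ * h₁ * k * h₀ * (z₀ * z₁ * h₁) := by
  calc _ = (h₀ * z₀ * h₀ * k) * (h₁ * k * h₁) * h₀ := by simp only [mul_assoc]
    _ = k * z₁ * h₁ * (h₀ * z₀ * h₀ * k) * h₁ * h₀ := by
      nth_rewrite 1 [T.x₀k]
      simp only [mul_assoc, mul_left_extend T.hh.symm, T.hh, mul_left_extend T.zh,
        mul_left_extend T.hz.symm, mul_left_extend T.zz.symm]
    _ = _ := by
      rw [T.x₀k]
      simp only [mul_assoc, T.hh, mul_self_cancel_left T.h₀_sq]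

end TwoWire

/-! ### Three wires -/

/-- The relations on three adjacent wires, in a group. -/
structure ThreeWire {G : Type*} [Group G] (h₀ h₁ h₂ z₀ z₁ z₂ k₀ k₁ : G) : Prop where
  top : TwoWire h₀ h₁ z₀ z₁ k₀
  bot : TwoWire h₁ h₂ z₁ z₂ k₁
  h₂k₀ : h₂ * k₀ = k₀ * h₂
  h₀k₁ : h₀ * k₁ = k₁ * h₀
  kk : k₁ * k₀ = k₀ * k₁
  far : h₂ * k₁ * h₁ * h₂ * k₁ * h₁ * k₀ * h₁ * k₁ * h₁ * h₂ * k₁ * h₂ =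
    h₀ * k₀ * h₀ * h₁ * k₀ * h₁ * k₁ * h₁ * k₀ * h₀ * h₁ * k₀ * h₀
  cxk : k₀ * h₀ * h₁ * k₀ * h₀ * h₁ * k₁ * k₀ * h₀ * h₁ * k₀ * h₀ * h₁ * k₁ =
    k₁ * h₀ * h₁ * k₀ * h₀ * h₁ * k₀

namespace ThreeWire

variable {G : Type*} [Group G] {h₀ h₁ h₂ z₀ z₁ z₂ k₀ k₁ : G}

/-- Both ways of defining the controlled `Z` gate on the outer wires agree. -/
theorem swap_k (T : ThreeWire h₀ h₁ h₂ z₀ z₁ z₂ k₀ k₁) :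
    swapWord h₁ h₂ k₁ * k₀ * swapWord h₁ h₂ k₁ = swapWord h₀ h₁ k₀ * k₁ * swapWord h₀ h₁ k₀ := by
  -- The controlled `X` with control on the middle wire commutes with `k₀`. Inserting it around `k₀`
  -- cancels one of the three factors of each swap; the same is done at the other end with `f`, and
  -- what remains is the relation `far`.
  have e : (h₂ * k₁ * h₂) * k₀ * (h₂ * k₁ * h₂) = k₀ := by
    simp only [mul_assoc, mul_left_extend T.h₂k₀, mul_left_extend T.kk,
      mul_self_cancel_left T.bot.h₁_sq, mul_self_cancel_left T.bot.k_sq, T.bot.h₁_sq, mul_one]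
  have f : (h₀ * k₀ * h₀) * k₁ * (h₀ * k₀ * h₀) = k₁ := by
    simp only [mul_assoc, mul_left_extend T.h₀k₁, mul_left_extend T.kk.symm,
      mul_self_cancel_left T.top.h₀_sq, mul_self_cancel_left T.top.k_sq, T.top.h₀_sq, mul_one]
  have l : swapWord h₁ h₂ k₁ * k₀ * swapWord h₁ h₂ k₁ =
      (h₂ * k₁ * h₂) * (h₁ * k₁ * h₁) * k₀ * ((h₁ * k₁ * h₁) * (h₂ * k₁ * h₂)) := by
    nth_rewrite 2 [← e]
    rw [T.bot.swap_eq₁]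
    simp only [mul_assoc, mul_self_cancel_left T.bot.h₁_sq, mul_self_cancel_left T.bot.k_sq]
  have r : swapWord h₀ h₁ k₀ * k₁ * swapWord h₀ h₁ k₀ =
      (h₀ * k₀ * h₀) * (h₁ * k₀ * h₁) * k₁ * ((h₁ * k₀ * h₁) * (h₀ * k₀ * h₀)) := by
    nth_rewrite 2 [← f]
    rw [T.top.swap_eq₀]
    simp only [mul_assoc, mul_self_cancel_left T.top.h₀_sq, mul_self_cancel_left T.top.k_sq]
  rw [l, r]
  have := T.far
  simp only [mul_assoc, mul_left_extend T.top.hh, mul_left_extend T.bot.hh] at this ⊢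
  exact this

theorem far_mul_h₁ (T : ThreeWire h₀ h₁ h₂ z₀ z₁ z₂ k₀ k₁) :
    h₁ * (swapWord h₀ h₁ k₀ * k₁ * swapWord h₀ h₁ k₀) =
      swapWord h₀ h₁ k₀ * k₁ * swapWord h₀ h₁ k₀ * h₁ := by
  simp only [mul_assoc, T.top.swap_mul_h₁, mul_left_extend T.h₀k₁.symm,
    mul_left_extend T.top.swap_mul_h₀]

/-- A controlled `X` whose target is a wire of a `CZ` gate creates a second `CZ` gate from its
control, here on the outer wires. In the relation `cxk` the two copies of `k₀ h₀ h₁ k₀ h₀ h₁` are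
written with a swap on opposite sides, so that the swaps enclose `k₁`. -/
theorem k₁_mul_cx (T : ThreeWire h₀ h₁ h₂ z₀ z₁ z₂ k₀ k₁) :
    k₁ * (h₁ * k₀ * h₁) =
      (h₁ * k₀ * h₁) * (swapWord h₀ h₁ k₀ * k₁ * swapWord h₀ h₁ k₀) * k₁ := by
  have c : h₀ * h₁ * k₀ * swapWord h₀ h₁ k₀ = swapWord h₀ h₁ k₀ * h₀ * h₁ * k₀ := by
    rw [mul_assoc, ← T.top.swap_mul_k, ← mul_assoc, mul_assoc h₀, ← T.top.swap_mul_h₀,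
      ← mul_assoc, ← T.top.swap_mul_h₁]
    simp only [mul_assoc, mul_left_extend T.top.hh]
  have hs' : k₀ * h₀ * h₁ * k₀ * h₀ * h₁ = swapWord h₀ h₁ k₀ * h₀ * h₁ * k₀ := by
    simp only [swapWord, mul_assoc, mul_left_extend T.top.hh, mul_self_cancel_left T.top.h₁_sq,
      mul_self_cancel_left T.top.h₀_sq, T.top.k_sq, mul_one]
  have hs := hs'.trans c.symm
  have hf := T.far_mul_h₁
  have e := T.cxk
  have l : k₀ * h₀ * h₁ * k₀ * h₀ * h₁ * k₁ * k₀ * h₀ * h₁ * k₀ * h₀ * h₁ * k₁ =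
      h₀ * h₁ * k₀ * (swapWord h₀ h₁ k₀ * k₁ * swapWord h₀ h₁ k₀) * h₀ * h₁ * k₀ * k₁ := by
    calc _ = (k₀ * h₀ * h₁ * k₀ * h₀ * h₁) * k₁ * (k₀ * h₀ * h₁ * k₀ * h₀ * h₁) * k₁ := by
          simp only [mul_assoc]
      _ = (h₀ * h₁ * k₀ * swapWord h₀ h₁ k₀) * k₁ * (swapWord h₀ h₁ k₀ * h₀ * h₁ * k₀) * k₁ := by
          nth_rewrite 1 [hs]
          rw [hs']
      _ = _ := by simp only [mul_assoc]
  rw [l] at e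
  generalize swapWord h₀ h₁ k₀ * k₁ * swapWord h₀ h₁ k₀ = f at *
  have := congrArg (fun x => h₁ * (h₁ * (h₀ * x)) * (k₀ * (h₀ * (h₁ * h₁)))) e
  simp only [mul_assoc, T.top.hh, mul_left_extend T.top.hh, mul_self_cancel_left T.top.h₁_sq,
      mul_self_cancel_left T.top.h₀_sq, mul_self_cancel_left T.top.k_sq, T.h₀k₁.symm,
      mul_left_extend T.kk.symm, T.top.h₁_sq, mul_one, mul_left_extend T.h₀k₁.symm,
      mul_left_extend hf.symm] at this ⊢
  exact this.symm

end ThreeWire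
/-! ### The group presented by the circuit relations -/

/-- The monoid of circuits modulo the circuit relations. -/
abbrev CircuitGroup (n : ℕ) : Type := PresentedMonoid (CircuitRel n)

/-- The class of a circuit. -/
abbrev cls {n : ℕ} (C : Circuit n) : CircuitGroup n := PresentedMonoid.mk (CircuitRel n) C

theorem cls_eq_iff {n : ℕ} {C D : Circuit n} : cls C = cls D ↔ Rewrites C D :=
  Con.eq _

theorem cls_eq_of_rel {n : ℕ} {C D : Circuit n} (h : CircuitRel n C D) : cls C = cls D :=
  cls_eq_iff.2 (ConGen.Rel.of _ _ h)

theorem cls_mul {n : ℕ} (C D : Circuit n) : cls (C * D) = cls C * cls D := map_mul _ C D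

theorem cls_one {n : ℕ} : cls (1 : Circuit n) = 1 := map_one _

theorem cls_circ {n : ℕ} (l : List (Gate n)) :
    cls (circ l) = (l.map fun g => cls (FreeMonoid.of g)).prod := by
  induction l with
  | nil => exact map_one _
  | cons g l ih =>
    rw [List.map_cons, List.prod_cons, ← ih, ← map_mul]
    rfl

theorem place_circ {m n : ℕ} (k : ℕ) (h : k + m ≤ n) (l : List (Gate m)) :
    Circuit.place k h (circ l) = circ (l.map (Gate.place k h)) := rfl

theorem cls_place_circ {m n : ℕ} (k : ℕ) (h : k + m ≤ n) (l : List (Gate m)) :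
    cls (Circuit.place k h (circ l)) =
      (l.map fun g => cls (FreeMonoid.of (g.place k h))).prod := by
  rw [place_circ, cls_circ, List.map_map]
  rfl

/-- The class of `H i`; it is `1` if there is no wire `i`. -/
def hG (n i : ℕ) : CircuitGroup n := if h : i < n then cls (FreeMonoid.of (.H ⟨i, h⟩)) else 1

/-- The class of `Z i`; it is `1` if there is no wire `i`. -/
def zG (n i : ℕ) : CircuitGroup n := if h : i < n then cls (FreeMonoid.of (.Z ⟨i, h⟩)) else 1

/-- The class of `CZ i`; it is `1` if there is no wire `i + 1`. -/
def kG (n i : ℕ) : CircuitGroup n := if h : i + 1 < n then cls (FreeMonoid.of (.CZ i h)) else 1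

/-- The class of the scalar `-1`. -/
def nG (n : ℕ) : CircuitGroup n := cls (FreeMonoid.of .neg)

theorem cls_of_H {n : ℕ} (i : Fin n) : cls (FreeMonoid.of (.H i)) = hG n i := by simp [hG]

theorem cls_of_Z {n : ℕ} (i : Fin n) : cls (FreeMonoid.of (.Z i)) = zG n i := by simp [zG]

theorem cls_of_CZ {n i : ℕ} (h : i + 1 < n) : cls (FreeMonoid.of (.CZ i h)) = kG n i := by
  simp [kG, h]

theorem cls_of_neg {n : ℕ} : cls (FreeMonoid.of (.neg : Gate n)) = nG n := rfl

/-! ### The generators are involutions. -/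

section Relations

variable {n : ℕ}

theorem cls_reduced {m : ℕ} {l l' : List (Gate m)} (h : ReducedRel m (circ l) (circ l')) (k : ℕ)
    (hk : k + m ≤ n) :
    (l.map fun g => cls (FreeMonoid.of (g.place k hk))).prod =
      (l'.map fun g => cls (FreeMonoid.of (g.place k hk))).prod := by
  rw [← cls_place_circ, ← cls_place_circ]
  exact cls_eq_of_rel (.reduced h k hk)

theorem nG_sq : nG n * nG n = 1 := by
  simpa [Gate.place, cls_of_neg] using cls_reduced .R1 0 (show 0 + 0 ≤ n by omega)

theorem zG_sq (i : ℕ) : zG n i * zG n i = 1 := by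
  by_cases hi : i < n
  · simpa [Gate.place, cls_of_Z] using cls_reduced .R2 i (show i + 1 ≤ n from hi)
  · simp [zG, hi]

theorem hG_sq (i : ℕ) : hG n i * hG n i = 1 := by
  by_cases hi : i < n
  · simpa [Gate.place, cls_of_H] using cls_reduced .R3 i (show i + 1 ≤ n from hi)
  · simp [hG, hi]

theorem kG_sq (i : ℕ) : kG n i * kG n i = 1 := by
  by_cases hi : i + 1 < n
  · simpa [Gate.place, cls_of_CZ] using cls_reduced .R5 i (show i + 2 ≤ n from hi)
  · simp [kG, hi]

theorem cls_of_sq (g : Gate n) : cls (FreeMonoid.of g) * cls (FreeMonoid.of g) = 1 := by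
  cases g with
  | neg => exact nG_sq
  | H i => rw [cls_of_H]; exact hG_sq _
  | Z i => rw [cls_of_Z]; exact zG_sq _
  | CZ i h => rw [cls_of_CZ]; exact kG_sq _

end Relations

/-- The presentation is one of monoids, but every generator is its own inverse. -/
theorem CircuitGroup.isUnit {n : ℕ} (x : CircuitGroup n) : IsUnit x := by
  induction x using PresentedMonoid.inductionOn with
  | h C =>
    induction C using FreeMonoid.inductionOn' with
    | one => exact isUnit_one
    | of_mul g C ih =>
      rw [map_mul]
      exact IsUnit.mul ⟨⟨_, _, cls_of_sq g, cls_of_sq g⟩, rfl⟩ ih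

noncomputable instance (n : ℕ) : Group (CircuitGroup n) := groupOfIsUnit CircuitGroup.isUnit

/-! ### Commutation rules and the relations on two and three adjacent wires. -/

section Relations

variable {n : ℕ}

theorem commute_of_disjoint {g g' : Gate n} (h : Disjoint g.wires g'.wires) :
    Commute (cls (FreeMonoid.of g)) (cls (FreeMonoid.of g')) :=
  cls_eq_of_rel (.slide g g' h)

theorem nG_commute (x : CircuitGroup n) : Commute (nG n) x := by
  induction x using PresentedMonoid.inductionOn with
  | h C =>
    induction C using FreeMonoid.inductionOn' with
    | one => exact Commute.one_right _
    | of_mul g C ih =>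
      rw [map_mul]
      refine Commute.mul_right (commute_of_disjoint ?_) ih
      simp [Gate.wires]

theorem hG_hG {i j : ℕ} (h : i ≠ j) : Commute (hG n i) (hG n j) := by
  unfold hG
  split_ifs
  · exact commute_of_disjoint (by simpa [Gate.wires] using h)
  all_goals simp only [Commute.one_left, Commute.one_right]

theorem zG_hG {i j : ℕ} (h : i ≠ j) : Commute (zG n i) (hG n j) := by
  unfold hG zG
  split_ifs
  · exact commute_of_disjoint (by simpa [Gate.wires] using h)
  all_goals simp only [Commute.one_left, Commute.one_right]

theorem zG_zG (i j : ℕ) : Commute (zG n i) (zG n j) := by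
  rcases eq_or_ne i j with rfl | h
  · exact Commute.refl _
  unfold zG
  split_ifs
  · exact commute_of_disjoint (by simpa [Gate.wires] using h)
  all_goals simp only [Commute.one_left, Commute.one_right]

theorem kG_hG {i j : ℕ} (h : i ≠ j) (h' : i + 1 ≠ j) : Commute (kG n i) (hG n j) := by
  unfold kG hG
  split_ifs
  · refine commute_of_disjoint ?_
    simp [Gate.wires]; omega
  all_goals simp only [Commute.one_left, Commute.one_right]

theorem kG_zG (i j : ℕ) : Commute (kG n i) (zG n j) := by
  by_cases hi : i + 1 < n
  · by_cases h : i = j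
    · subst h
      have := cls_reduced .R6 i (show i + 2 ≤ n from hi)
      simp [Gate.place, cls_of_Z, cls_of_CZ] at this
      exact this.symm
    by_cases h' : i + 1 = j
    · subst h'
      have := cls_reduced .R7 i (show i + 2 ≤ n from hi)
      simp [Gate.place, cls_of_Z, cls_of_CZ] at this
      exact this.symm
    unfold kG zG
    split_ifs
    · refine commute_of_disjoint ?_
      simp [Gate.wires]; omega
    all_goals simp only [Commute.one_left, Commute.one_right]
  · simp [kG, hi]

theorem kG_kG (i j : ℕ) : Commute (kG n i) (kG n j) := by
  wlog hij : i ≤ j generalizing i j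
  · exact (this j i (by omega)).symm
  by_cases hj : j + 1 < n
  · rcases hij.eq_or_lt with rfl | h
    · exact Commute.refl _
    by_cases h' : i + 1 = j
    · subst h'
      have := cls_reduced .R13 i (show i + 3 ≤ n by omega)
      simp [Gate.place, cls_of_CZ] at this
      exact this
    unfold kG
    split_ifs
    · refine commute_of_disjoint ?_
      simp [Gate.wires]; omega
    all_goals simp only [Commute.one_left, Commute.one_right]
  · simp [kG, hj]

/-- With `X = HZH` this is `ZX = -XZ`; it is the relation for the fourth power of `ZH` with the
involutions moved to the other side. -/
theorem hz_pow_four {i : ℕ} (h : i < n) :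
    zG n i * (hG n i * zG n i * hG n i) = nG n * ((hG n i * zG n i * hG n i) * zG n i) := by
  have := cls_reduced .R4 i (show i + 1 ≤ n by omega)
  simp [Gate.place, cls_of_Z, cls_of_H, cls_of_neg] at this
  rw [← this]
  simp only [mul_assoc, mul_self_cancel_left (hG_sq i), mul_self_cancel_left (zG_sq i), zG_sq,
    mul_one]

theorem twoWire {i : ℕ} (h : i + 1 < n) :
    TwoWire (hG n i) (hG n (i + 1)) (zG n i) (zG n (i + 1)) (kG n i) where
  h₀_sq := hG_sq _
  h₁_sq := hG_sq _
  z₀_sq := zG_sq _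
  z₁_sq := zG_sq _
  k_sq := kG_sq _
  hh := hG_hG (by omega)
  hz := zG_hG (by omega)
  zh := zG_hG (by omega)
  zz := zG_zG _ _
  z₀k := (kG_zG _ _).symm
  z₁k := (kG_zG _ _).symm
  x₀k := by
    have := cls_reduced .R8 i (show i + 2 ≤ n by omega)
    simpa [Gate.place, cls_of_Z, cls_of_H, cls_of_CZ, mul_assoc] using this
  x₁k := by
    have := cls_reduced .R9 i (show i + 2 ≤ n by omega)
    simpa [Gate.place, cls_of_Z, cls_of_H, cls_of_CZ, mul_assoc] using this
  hk₀ := by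
    have := cls_reduced .R10 i (show i + 2 ≤ n by omega)
    simpa [Gate.place, cls_of_Z, cls_of_H, cls_of_CZ, mul_assoc] using this
  hk₁ := by
    have := cls_reduced .R11 i (show i + 2 ≤ n by omega)
    simpa [Gate.place, cls_of_Z, cls_of_H, cls_of_CZ, mul_assoc] using this
  braid := by
    have := cls_reduced .R12 i (show i + 2 ≤ n by omega)
    simpa [Gate.place, cls_of_Z, cls_of_H, cls_of_CZ, mul_assoc] using this

theorem threeWire {i : ℕ} (h : i + 2 < n) :
    ThreeWire (hG n i) (hG n (i + 1)) (hG n (i + 2)) (zG n i) (zG n (i + 1)) (zG n (i + 2))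
      (kG n i) (kG n (i + 1)) where
  top := twoWire (by omega)
  bot := twoWire h
  h₂k₀ := (kG_hG (by omega) (by omega)).symm
  h₀k₁ := (kG_hG (by omega) (by omega)).symm
  kk := kG_kG _ _
  far := by
    have := cls_reduced .R14 i (show i + 3 ≤ n by omega)
    simpa [Gate.place, cls_of_Z, cls_of_H, cls_of_CZ, mul_assoc] using this
  cxk := by
    have := cls_reduced .R15 i (show i + 3 ≤ n by omega)
    simpa [Gate.place, cls_of_Z, cls_of_H, cls_of_CZ, mul_assoc] using this

end Relations
/-! ### Controlled `Z` gates on distant wires -/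

/-- The swap of the wires `i` and `i + 1`. -/
noncomputable def swG (n i : ℕ) : CircuitGroup n := swapWord (hG n i) (hG n (i + 1)) (kG n i)

/-- The controlled `Z` gate on the wires `i` and `i + j + 1`. -/
noncomputable def farG (n : ℕ) : ℕ → ℕ → CircuitGroup n
  | i, 0 => kG n i
  | i, j + 1 => swG n i * farG n (i + 1) j * swG n i

section Distant

variable {n : ℕ}

theorem conj_eq_of_semiconj {G : Type*} [Group G] {s x y : G} (h : s * x = y * s) :
    MulAut.conj s x = y := by
  rw [MulAut.conj_apply, h, mul_inv_cancel_right]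

/-- The tool for induction on the distance of two wires: a swap conjugates a relation at one
distance to the same relation at the next distance. -/
theorem commute_of_conj {G : Type*} [Group G] {s x y x' y' : G} (hx : MulAut.conj s x = x')
    (hy : MulAut.conj s y = y') (h : Commute x y) : Commute x' y' := by
  rw [← hx, ← hy]
  exact h.map _

theorem commute_swapWord {G : Type*} [Group G] {x h₀ h₁ k : G} (a : Commute x h₀)
    (b : Commute x h₁) (c : Commute x k) : Commute x (swapWord h₀ h₁ k) := by
  unfold swapWord
  exact ((((((((c.mul_right a).mul_right b).mul_right c).mul_right a).mul_right b).mul_right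
    c).mul_right a).mul_right b)

theorem swG_sq {i : ℕ} (h : i + 1 < n) : swG n i * swG n i = 1 := (twoWire h).swap_sq

theorem swG_inv {i : ℕ} (h : i + 1 < n) : (swG n i)⁻¹ = swG n i :=
  inv_eq_of_mul_eq_one_left (swG_sq h)

theorem conj_swG_hG {i : ℕ} (h : i + 1 < n) : MulAut.conj (swG n i) (hG n i) = hG n (i + 1) :=
  conj_eq_of_semiconj (twoWire h).swap_mul_h₀

theorem conj_swG_zG {i : ℕ} (h : i + 1 < n) : MulAut.conj (swG n i) (zG n i) = zG n (i + 1) :=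
  conj_eq_of_semiconj (twoWire h).swap_mul_z₀

theorem conj_swG_zG' {i : ℕ} (h : i + 1 < n) : MulAut.conj (swG n i) (zG n (i + 1)) = zG n i :=
  conj_eq_of_semiconj (twoWire h).swap_mul_z₁

theorem conj_swG_kG {i : ℕ} (h : i + 1 < n) : MulAut.conj (swG n i) (kG n i) = kG n i :=
  conj_eq_of_semiconj (twoWire h).swap_mul_k

theorem conj_swG_hG_of_ne {i l : ℕ} (h : l ≠ i) (h' : l ≠ i + 1) :
    MulAut.conj (swG n i) (hG n l) = hG n l :=
  conj_eq_of_semiconj (commute_swapWord (hG_hG h) (hG_hG h')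
    (kG_hG h.symm h'.symm).symm).symm

theorem conj_swG_zG_of_ne {i l : ℕ} (h : l ≠ i) (h' : l ≠ i + 1) :
    MulAut.conj (swG n i) (zG n l) = zG n l :=
  conj_eq_of_semiconj (commute_swapWord (zG_hG h) (zG_hG h') (kG_zG _ _).symm).symm

theorem kG_swG {i l : ℕ} (h : l + 1 < i ∨ i + 1 < l) : Commute (kG n l) (swG n i) :=
  commute_swapWord (kG_hG (by omega) (by omega)) (kG_hG (by omega) (by omega)) (kG_kG _ _)

theorem conj_swG_kG_of_lt {i l : ℕ} (h : l + 1 < i ∨ i + 1 < l) :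
    MulAut.conj (swG n i) (kG n l) = kG n l :=
  conj_eq_of_semiconj (kG_swG h).symm

theorem swG_swG {i l : ℕ} (h : l + 1 < i ∨ i + 1 < l) : Commute (swG n l) (swG n i) :=
  commute_swapWord
    (commute_swapWord (hG_hG (by omega)) (hG_hG (by omega)) (kG_hG (by omega) (by omega)).symm).symm
    (commute_swapWord (hG_hG (by omega)) (hG_hG (by omega)) (kG_hG (by omega) (by omega)).symm).symm
    (kG_swG (by omega)).symm

theorem conj_swG_farG {i : ℕ} (h : i + 1 < n) (j : ℕ) :
    MulAut.conj (swG n i) (farG n (i + 1) j) = farG n i (j + 1) := by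
  rw [MulAut.conj_apply, swG_inv h, farG]

theorem farG_sq {i j : ℕ} (h : i + j + 1 < n) : farG n i j * farG n i j = 1 := by
  induction j generalizing i with
  | zero => exact kG_sq _
  | succ j ih =>
    have := congrArg (MulAut.conj (swG n i)) (ih (i := i + 1) (by omega))
    simpa only [map_mul, map_one, conj_swG_farG (show i + 1 < n by omega)] using this

theorem farG_hG {i j l : ℕ} (h : i + j + 1 < n) (hl : l ≠ i) (hl' : l ≠ i + j + 1) :
    Commute (farG n i j) (hG n l) := by
  induction j generalizing i l with
  | zero => exact kG_hG (by omega) (by omega)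
  | succ j ih =>
    have hi : i + 1 < n := by omega
    by_cases e : l = i + 1
    · subst e
      exact commute_of_conj (conj_swG_farG hi j) (conj_swG_hG hi)
        (ih (by omega) (by omega) (by omega))
    · exact commute_of_conj (conj_swG_farG hi j) (conj_swG_hG_of_ne hl e)
        (ih (by omega) e (by omega))

theorem farG_zG {i j : ℕ} (h : i + j + 1 < n) (l : ℕ) : Commute (farG n i j) (zG n l) := by
  induction j generalizing i l with
  | zero => exact kG_zG _ _
  | succ j ih =>
    have hi : i + 1 < n := by omega
    by_cases e : l = i + 1
    · subst e
      exact commute_of_conj (conj_swG_farG hi j) (conj_swG_zG hi) (ih (by omega) _)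
    by_cases e' : l = i
    · subst e'
      exact commute_of_conj (conj_swG_farG hi j) (conj_swG_zG' hi) (ih (by omega) _)
    · exact commute_of_conj (conj_swG_farG hi j) (conj_swG_zG_of_ne e' e) (ih (by omega) _)

theorem conj_swG_succ_kG {i : ℕ} (h : i + 2 < n) :
    MulAut.conj (swG n (i + 1)) (kG n i) = farG n i 1 := by
  rw [MulAut.conj_apply, swG_inv (by omega)]
  exact (threeWire h).swap_k

/-- Conjugation by `swG n i` shortens the distant gate unless it also moves `kG n l`, that is for `l
= i + 1`. In that case two swaps carry the pair `farG n (i + 2) j`, `kG n i` to the required one;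
this is why the `CZ` gates above wire `i` are part of the induction. -/
theorem farG_kG {i j l : ℕ} (h : i + j + 1 < n) (hl : i < l ∨ l + 1 < i) :
    Commute (farG n i j) (kG n l) := by
  induction j using Nat.strong_induction_on generalizing i l with
  | h j ih =>
  match j with
  | 0 => exact kG_kG _ _
  | j + 1 =>
    have hi : i + 1 < n := by omega
    by_cases e : l = i + 1
    · subst e
      match j with
      | 0 =>
        exact commute_of_conj (conj_swG_succ_kG (by omega)) (conj_swG_kG (by omega)) (kG_kG _ _)
      | j + 1 =>
        have e1 : MulAut.conj (swG n i * swG n (i + 1)) (kG n i) = kG n (i + 1) := by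
          rw [map_mul, MulAut.mul_apply, conj_swG_succ_kG (by omega), ← conj_swG_farG hi, farG,
            ← MulAut.mul_apply, ← map_mul, swG_sq hi, map_one, MulAut.one_apply]
        have e2 : MulAut.conj (swG n i * swG n (i + 1)) (farG n (i + 2) j) = farG n i (j + 2) := by
          rw [map_mul, MulAut.mul_apply, conj_swG_farG (i := i + 1) (by omega), conj_swG_farG hi]
        exact commute_of_conj e2 e1 (ih j (by omega) (by omega) (by omega))
    · exact commute_of_conj (conj_swG_farG hi j) (conj_swG_kG_of_lt (by omega))
        (ih j (by omega) (by omega) (by omega))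

/-- `farG` is defined by moving the upper end; here the lower end is moved. At distance one this is
`ThreeWire.swap_k`, and beyond that the swaps at the two ends commute. -/
theorem conj_swG_bot_farG {i j : ℕ} (h : i + j + 2 < n) :
    MulAut.conj (swG n (i + j + 1)) (farG n i j) = farG n i (j + 1) := by
  induction j generalizing i with
  | zero => exact conj_swG_succ_kG (by omega)
  | succ j ih =>
    have hi : i + 1 < n := by omega
    rw [← conj_swG_farG hi, ← MulAut.mul_apply, ← map_mul, (swG_swG (by omega)).eq, map_mul,
      MulAut.mul_apply, show i + (j + 1) + 1 = i + 1 + j + 1 by ring, ih (by omega),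
      conj_swG_farG hi]

theorem conj_swG_bot_farG' {i j : ℕ} (h : i + j + 2 < n) :
    MulAut.conj (swG n (i + j + 1)) (farG n i (j + 1)) = farG n i j := by
  rw [← conj_swG_bot_farG h, ← MulAut.mul_apply, ← map_mul, swG_sq (by omega), map_one,
    MulAut.one_apply]

theorem farG_swG {i j l : ℕ} (h : i + j + 1 < n) (hl : i + j + 1 < l) :
    Commute (farG n i j) (swG n l) :=
  commute_swapWord (farG_hG h (by omega) (by omega)) (farG_hG h (by omega) (by omega))
    (farG_kG h (by omega))

theorem farG_farG_succ {i j : ℕ} (h : i + j + 2 < n) :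
    Commute (farG n i j) (farG n i (j + 1)) := by
  induction j generalizing i with
  | zero =>
    exact commute_of_conj (conj_swG_kG (by omega)) (conj_swG_farG (by omega) 0) (kG_kG _ _)
  | succ j ih =>
    exact commute_of_conj (conj_swG_farG (by omega) _) (conj_swG_farG (by omega) _)
      (ih (by omega))

theorem farG_farG {i j l : ℕ} (h : i + j + 1 < n) (hl : i + l + 1 < n) :
    Commute (farG n i j) (farG n i l) := by
  wlog hjl : j ≤ l generalizing j l
  · exact (this hl h (by omega)).symm
  induction l, hjl using Nat.le_induction with
  | base => exact Commute.refl _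
  | succ l hjl ih =>
    rcases hjl.eq_or_lt with rfl | hlt
    · exact farG_farG_succ (by omega)
    · exact commute_of_conj (conj_eq_of_semiconj (farG_swG h (by omega)).symm)
        (conj_swG_bot_farG (by omega)) (ih (by omega))

/-- The controlled `X` gate with control `i` and target `i + j + 1`. -/
noncomputable def farX (n i j : ℕ) : CircuitGroup n :=
  hG n (i + j + 1) * farG n i j * hG n (i + j + 1)

theorem conj_swG_farX {i j : ℕ} (h : i + j + 2 < n) :
    MulAut.conj (swG n i) (farX n (i + 1) j) = farX n i (j + 1) := by
  rw [farX, map_mul, map_mul, conj_swG_farG (by omega), conj_swG_hG_of_ne (by omega) (by omega),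
    show i + 1 + j + 1 = i + (j + 1) + 1 by ring, farX]

theorem zG_mul_farX {i j : ℕ} (h : i + j + 1 < n) :
    zG n (i + j + 1) * farX n i j = farX n i j * (zG n i * zG n (i + j + 1)) := by
  induction j generalizing i with
  | zero => exact (twoWire h).z₁_cx
  | succ j ih =>
    have := congrArg (MulAut.conj (swG n i)) (ih (i := i + 1) (by omega))
    simp only [map_mul, conj_swG_farX (show i + j + 2 < n by omega),
      conj_swG_zG' (show i + 1 < n by omega),
      conj_swG_zG_of_ne (n := n) (show i + 1 + j + 1 ≠ i by omega)
        (show i + 1 + j + 1 ≠ i + 1 by omega)] at this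
    rw [show i + 1 + j + 1 = i + (j + 1) + 1 by ring] at this
    exact this

theorem farX_mul_farG {i j : ℕ} (h : i + j + 1 < n) :
    farX n i j * farG n i j = farG n i j * farX n i j * zG n i := by
  induction j generalizing i with
  | zero => exact (twoWire h).cx_mul_k
  | succ j ih =>
    have := congrArg (MulAut.conj (swG n i)) (ih (i := i + 1) (by omega))
    simpa only [map_mul, conj_swG_farX (show i + j + 2 < n by omega),
      conj_swG_farG (show i + 1 < n by omega), conj_swG_zG' (show i + 1 < n by omega)] using this

theorem kG_mul_farX {i j : ℕ} (h : i + j + 2 < n) :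
    kG n (i + j + 1) * farX n i j = farX n i j * farG n i (j + 1) * kG n (i + j + 1) := by
  induction j generalizing i with
  | zero => exact (threeWire h).k₁_mul_cx
  | succ j ih =>
    have := congrArg (MulAut.conj (swG n i)) (ih (i := i + 1) (by omega))
    simp only [map_mul, conj_swG_farX (show i + j + 2 < n by omega),
      conj_swG_farG (show i + 1 < n by omega),
      conj_swG_kG_of_lt (n := n)
        (show i + 1 + j + 1 + 1 < i ∨ i + 1 < i + 1 + j + 1 by omega)] at this
    rw [show i + 1 + j + 1 = i + (j + 1) + 1 by ring] at this
    exact this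

/-- Conjugation by the swap of the lower two wires exchanges the two possible targets in
`kG_mul_farX` and fixes the `CZ` gate between them. -/
theorem kG_mul_farX_succ {i j : ℕ} (h : i + j + 2 < n) :
    kG n (i + j + 1) * farX n i (j + 1) = farX n i (j + 1) * farG n i j * kG n (i + j + 1) := by
  have := congrArg (MulAut.conj (swG n (i + j + 1))) (kG_mul_farX h)
  simp only [farX, map_mul, conj_swG_bot_farG h, conj_swG_bot_farG' h,
    conj_swG_kG (show i + j + 1 + 1 < n by omega),
    conj_swG_hG (show i + j + 1 + 1 < n by omega)] at this
  exact this

theorem farX_sq {i j : ℕ} (h : i + j + 1 < n) : farX n i j * farX n i j = 1 := by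
  simp only [farX, mul_assoc, mul_self_cancel_left (hG_sq _), mul_self_cancel_left (farG_sq h),
    hG_sq]

end Distant
/-! ### Signed Pauli strings -/

/-- A signed Pauli string: a sign (`true` is `-1`), and for each wire the exponents `(x, z)` of the
matrix `X ^ x * Z ^ z`. Only the wires that are present matter. -/
abbrev PauliString : Type := Bool × (ℕ → Bool × Bool)

/-- The action of a gate on signed Pauli strings by conjugation. -/
def Gate.act {n : ℕ} : Gate n → PauliString → PauliString
  | .neg, p => p
  | .H i, p =>
      (xor p.1 ((p.2 i).1 && (p.2 i).2), Function.update p.2 i ((p.2 i).2, (p.2 i).1))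
  | .Z i, p => (xor p.1 (p.2 i).1, p.2)
  | .CZ i _, p =>
      (xor p.1 ((p.2 i).1 && (p.2 (i + 1)).1),
        Function.update (Function.update p.2 i ((p.2 i).1, xor (p.2 i).2 (p.2 (i + 1)).1))
          (i + 1) ((p.2 (i + 1)).1, xor (p.2 (i + 1)).2 (p.2 i).1))

/-- The action of a circuit on signed Pauli strings by conjugation. -/
def Circuit.act {n : ℕ} (C : Circuit n) (p : PauliString) : PauliString :=
  C.toList.foldl (fun p g => g.act p) p

theorem act_one {n : ℕ} (p : PauliString) : (1 : Circuit n).act p = p := rfl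

theorem act_of {n : ℕ} (g : Gate n) (p : PauliString) :
    Circuit.act (FreeMonoid.of g) p = g.act p := rfl

theorem act_mul {n : ℕ} (C D : Circuit n) (p : PauliString) :
    (C * D).act p = D.act (C.act p) := by
  simp [Circuit.act]

/-! ### Controlled Pauli operators -/

section Sites

variable {G : Type*} [Group G]

/-- The power of a group element with a Boolean exponent. -/
def bpow (x : G) (b : Bool) : G := bif b then x else 1

@[simp] theorem bpow_true (x : G) : bpow x true = x := rfl

@[simp] theorem bpow_false (x : G) : bpow x false = 1 := rfl

theorem bpow_commute {x y : G} (h : Commute x y) (b : Bool) : Commute (bpow x b) y := by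
  cases b
  · exact Commute.one_left _
  · exact h

theorem bpow_mul_bpow {x : G} (h : x * x = 1) (a b : Bool) :
    bpow x a * bpow x b = bpow x (xor a b) := by
  cases a <;> cases b <;> simp [h]

/-- The product of the factors that belong to the first `m` letters of a string. -/
def siteProd (blk : ℕ → Bool × Bool → G) : ℕ → (ℕ → Bool × Bool) → G
  | 0, _ => 1
  | m + 1, f => siteProd blk m f * blk m (f m)

theorem siteProd_congr {blk : ℕ → Bool × Bool → G} {m : ℕ} {f f' : ℕ → Bool × Bool}
    (h : ∀ j < m, f j = f' j) : siteProd blk m f = siteProd blk m f' := by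
  induction m with
  | zero => rfl
  | succ m ih => rw [siteProd, siteProd, ih fun j hj => h j (by omega), h m (by omega)]

theorem siteProd_commute {blk : ℕ → Bool × Bool → G} {m : ℕ} {f : ℕ → Bool × Bool} {g : G}
    (h : ∀ j < m, Commute (blk j (f j)) g) : Commute (siteProd blk m f) g := by
  induction m with
  | zero => exact Commute.one_left _
  | succ m ih => exact (ih fun j hj => h j (by omega)).mul_left (h m (by omega))

/-- `g` meets only the factor at `i`; the phase `z` it creates there commutes with every factor and
can be collected in front. -/
theorem siteProd_mul_of_one {blk : ℕ → Bool × Bool → G} {m i : ℕ} (hi : i < m)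
    {f : ℕ → Bool × Bool} {g z : G} {a' : Bool × Bool}
    (hz : ∀ j < m, ∀ a, Commute (blk j a) z)
    (h : ∀ j < m, j ≠ i → ∀ a, Commute (blk j a) g)
    (hg : blk i (f i) * g = g * (z * blk i a')) :
    siteProd blk m f * g = g * (z * siteProd blk m (Function.update f i a')) := by
  induction m with
  | zero => omega
  | succ m ih =>
    rw [siteProd, siteProd]
    by_cases e : i = m
    · subst e
      rw [Function.update_self, mul_assoc, hg,
        siteProd_congr (f := Function.update f i a') (f' := f)
          fun j hj => Function.update_of_ne (ne_of_lt hj) _ _]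
      have c1 : Commute (siteProd blk i f) g :=
        siteProd_commute fun j hj => h j (by omega) (by omega) _
      have c2 : Commute (siteProd blk i f) z := siteProd_commute fun j hj => hz j (by omega) _
      rw [← mul_assoc, c1.eq, mul_assoc, ← mul_assoc _ z, c2.eq, mul_assoc]
    · rw [Function.update_of_ne (by omega), mul_assoc, (h m (by omega) (by omega) _).eq,
        ← mul_assoc, ih (by omega) (fun j hj => hz j (by omega)) (fun j hj => h j (by omega))]
      simp only [mul_assoc]

theorem siteProd_mul_of_two {blk : ℕ → Bool × Bool → G} {m i : ℕ} (hi : i + 1 < m)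
    {f : ℕ → Bool × Bool} {g z : G} {a' b' : Bool × Bool}
    (hz : ∀ j < m, ∀ a, Commute (blk j a) z)
    (h : ∀ j < m, j ≠ i → j ≠ i + 1 → ∀ a, Commute (blk j a) g)
    (hg : blk i (f i) * blk (i + 1) (f (i + 1)) * g = g * (z * (blk i a' * blk (i + 1) b'))) :
    siteProd blk m f * g =
      g * (z * siteProd blk m (Function.update (Function.update f i a') (i + 1) b')) := by
  induction m with
  | zero => omega
  | succ m ih =>
    by_cases e : i + 1 = m
    · subst e
      rw [siteProd, siteProd, siteProd, siteProd, Function.update_self,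
        Function.update_of_ne (by omega), Function.update_self,
        mul_assoc, mul_assoc, ← mul_assoc (blk i (f i)), hg,
        siteProd_congr (f := Function.update (Function.update f i a') (i + 1) b') (f' := f)
          fun j hj => by
            rw [Function.update_of_ne (by omega), Function.update_of_ne (by omega)]]
      have c1 : Commute (siteProd blk i f) g :=
        siteProd_commute fun j hj => h j (by omega) (by omega) (by omega) _
      have c2 : Commute (siteProd blk i f) z := siteProd_commute fun j hj => hz j (by omega) _
      rw [← mul_assoc, c1.eq, mul_assoc, ← mul_assoc _ z, c2.eq]
      simp only [mul_assoc]
    · rw [siteProd, siteProd, Function.update_of_ne (by omega), Function.update_of_ne (by omega),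
        mul_assoc, (h m (by omega) (by omega) (by omega) _).eq,
        ← mul_assoc, ih (by omega) (fun j hj => hz j (by omega)) (fun j hj => h j (by omega))]
      simp only [mul_assoc]

end Sites

/-! ### Conjugation of controlled Pauli strings. -/

section Controlled

variable {n : ℕ}

/-- The Pauli matrix with exponents `a` on wire `i + j + 1`, controlled by wire `i`. -/
noncomputable def ctlSite (n i j : ℕ) (a : Bool × Bool) : CircuitGroup n :=
  bpow (farG n i j) a.2 * bpow (farX n i j) a.1

/-- The Pauli string `p` on the wires `1, …, m`, controlled by wire `0`. -/
noncomputable def ctlG (n m : ℕ) (p : PauliString) : CircuitGroup n :=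
  bpow (zG n 0) p.1 * siteProd (ctlSite n 0) m p.2

theorem ctlSite_commute {i j : ℕ} {g : CircuitGroup n} (h : Commute (farG n i j) g)
    (h' : Commute (hG n (i + j + 1)) g) (a : Bool × Bool) : Commute (ctlSite n i j a) g :=
  (bpow_commute h _).mul_left (bpow_commute ((h'.mul_left h).mul_left h') _)

theorem ctlSite_zG {i j l : ℕ} (h : i + j + 1 < n) (hl : l ≠ i + j + 1) (a : Bool × Bool) :
    Commute (ctlSite n i j a) (zG n l) :=
  ctlSite_commute (farG_zG h l) (zG_hG hl).symm a

theorem ctlSite_hG {i j l : ℕ} (h : i + j + 1 < n) (hl : l ≠ i) (hl' : l ≠ i + j + 1)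
    (a : Bool × Bool) : Commute (ctlSite n i j a) (hG n l) :=
  ctlSite_commute (farG_hG h hl hl') (hG_hG hl'.symm) a

theorem ctlSite_kG {i j l : ℕ} (h : i + j + 1 < n) (hl : i < l) (h1 : l ≠ i + j + 1)
    (h2 : l ≠ i + j) (a : Bool × Bool) : Commute (ctlSite n i j a) (kG n l) :=
  ctlSite_commute (farG_kG h (.inl hl)) (kG_hG h1 (by omega)).symm a

/-- A controlled sign is a `Z` on the control wire. This rule and the two after it are therefore the
conjugation rules of `Gate.act` on letters, with each sign replaced by `zG n i`. -/
theorem ctlSite_mul_hG {i j : ℕ} (h : i + j + 1 < n) (a : Bool × Bool) :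
    ctlSite n i j a * hG n (i + j + 1) =
      hG n (i + j + 1) * (bpow (zG n i) (a.1 && a.2) * ctlSite n i j (a.2, a.1)) := by
  have hx : farX n i j * hG n (i + j + 1) = hG n (i + j + 1) * farG n i j := by
    simp only [farX, mul_assoc, hG_sq, mul_one]
  have hx' : farG n i j * hG n (i + j + 1) = hG n (i + j + 1) * farX n i j := by
    simp only [farX, mul_assoc, mul_self_cancel_left (hG_sq _)]
  have hz : zG n i * hG n (i + j + 1) = hG n (i + j + 1) * zG n i := zG_hG (by omega)
  obtain ⟨a, b⟩ := a
  cases a <;> cases b <;> simp only [ctlSite, bpow_true, bpow_false, mul_one, one_mul,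
    Bool.and_false, Bool.false_and, Bool.and_true, hx, hx']
  have e := farX_mul_farG h
  rw [mul_assoc, hx, mul_left_extend hx', e]
  have c1 : Commute (zG n i) (farG n i j * farX n i j) :=
    (farG_zG h i).symm.mul_right (((zG_hG (by omega)).mul_right (farG_zG h i).symm).mul_right
      (zG_hG (by omega)))
  rw [c1.eq]

theorem ctlSite_mul_zG {i j : ℕ} (h : i + j + 1 < n) (a : Bool × Bool) :
    ctlSite n i j a * zG n (i + j + 1) =
      zG n (i + j + 1) * (bpow (zG n i) a.1 * ctlSite n i j a) := by
  have c0 : zG n i * farG n i j = farG n i j * zG n i := (farG_zG h i).eq.symm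
  have c1 : zG n (i + j + 1) * farG n i j = farG n i j * zG n (i + j + 1) := (farG_zG h _).eq.symm
  have c3 : zG n i * farX n i j = farX n i j * zG n i :=
    (((zG_hG (by omega)).mul_right (farG_zG h i).symm).mul_right (zG_hG (by omega))).eq
  have c2 := zG_mul_farX h
  obtain ⟨a, b⟩ := a
  cases a <;> cases b <;> simp only [ctlSite, bpow_true, bpow_false, mul_one, one_mul, c1, c2, c3,
    mul_assoc, mul_left_extend c1, mul_left_extend c0, mul_left_extend c2,
    mul_left_extend (zG_zG (n := n) (i + j + 1) i).eq, mul_left_extend c3,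
    (zG_zG (n := n) (i + j + 1) i).eq,
    mul_self_cancel_left (zG_sq i)]

/-- Passing through the `CZ` gate, each controlled `X` acquires a controlled `Z` on the other
target. Reordering and cancelling these gives the new exponents; the power of `zG n i` comes from
the noncommuting `farX` and `farG` on the same target. -/
theorem ctlSite_mul_kG {i j : ℕ} (h : i + j + 2 < n) (a b : Bool × Bool) :
    ctlSite n i j a * ctlSite n i (j + 1) b * kG n (i + j + 1) =
      kG n (i + j + 1) * (bpow (zG n i) (a.1 && b.1) *
        (ctlSite n i j (a.1, xor a.2 b.1) * ctlSite n i (j + 1) (b.1, xor b.2 a.1))) := by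
  have k1 : kG n (i + j + 1) * farG n i j = farG n i j * kG n (i + j + 1) :=
    (farG_kG (by omega) (by omega)).symm.eq
  have k2 : kG n (i + j + 1) * farG n i (j + 1) = farG n i (j + 1) * kG n (i + j + 1) :=
    (farG_kG (by omega) (by omega)).symm.eq
  have k3 := kG_mul_farX h
  have k4 := kG_mul_farX_succ h
  have hff : Commute (farG n i (j + 1)) (farG n i j) := farG_farG (by omega) (by omega)
  have z1 : Commute (zG n i) (farG n i j) := (farG_zG (by omega) i).symm
  have z2 : Commute (zG n i) (farG n i (j + 1)) := (farG_zG (by omega) i).symm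
  have z3 : Commute (zG n i) (farX n i j) :=
    ((zG_hG (by omega)).mul_right z1).mul_right (zG_hG (by omega))
  have z4 : Commute (zG n i) (farX n i (j + 1)) :=
    ((zG_hG (by omega)).mul_right z2).mul_right (zG_hG (by omega))
  have z5 : Commute (zG n i) (kG n (i + j + 1)) := (kG_zG _ _).symm
  have f1 : farG n i (j + 1) * farX n i j = farX n i j * farG n i (j + 1) := by
    refine ((Commute.mul_right ?_ hff).mul_right ?_).eq <;>
      exact farG_hG (by omega) (by omega) (by omega)
  have f3 : farX n i (j + 1) * farG n i j = farG n i j * farX n i (j + 1) := by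
    refine ((Commute.mul_right ?_ hff.symm).mul_right ?_).eq.symm <;>
      exact farG_hG (by omega) (by omega) (by omega)
  have f2 : farX n i (j + 1) * farX n i j = farX n i j * farX n i (j + 1) := by
    refine Commute.mul_left (Commute.mul_left ?_ f1) ?_ <;>
      exact ((hG_hG (by omega)).mul_right (farG_hG (by omega) (by omega) (by omega)).symm).mul_right
        (hG_hG (by omega))
  have e1 := farX_mul_farG (n := n) (i := i) (j := j) (by omega)
  have e2 := farX_mul_farG (n := n) (i := i) (j := j + 1) (by omega)
  have s1 := farG_sq (n := n) (i := i) (j := j) (by omega)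
  have s2 := farG_sq (n := n) (i := i) (j := j + 1) (by omega)
  have sz := zG_sq (n := n) i
  obtain ⟨a, a'⟩ := a
  obtain ⟨b, b'⟩ := b
  simp only [ctlSite]
  generalize farG n i j = A at *
  generalize farG n i (j + 1) = B at *
  generalize farX n i j = A' at *
  generalize farX n i (j + 1) = B' at *
  generalize kG n (i + j + 1) = K at *
  generalize zG n i = z at *
  cases a <;> cases a' <;> cases b <;> cases b' <;>
    simp only [bpow_true, bpow_false, mul_one, one_mul, Bool.and_false, Bool.false_and,
      Bool.and_true, Bool.xor_false, Bool.false_xor, Bool.xor_true, Bool.not_true, Bool.not_false,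
      mul_assoc, k1, k2, k3, k4, mul_left_extend k1, mul_left_extend k2,
      mul_left_extend k3, mul_left_extend k4, z1.eq, z2.eq, z3.eq, z4.eq, z5.eq,
      mul_left_extend z1.eq, mul_left_extend z2.eq, mul_left_extend z3.eq, mul_left_extend z4.eq,
      mul_left_extend z5.eq, f1, f2, f3, mul_left_extend f1, mul_left_extend f2,
      mul_left_extend f3, hff.eq, mul_left_extend hff.eq, e1, e2, mul_left_extend e1,
      mul_left_extend e2, s1, s2, mul_self_cancel_left s1, mul_self_cancel_left s2, sz,
      mul_self_cancel_left sz]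

/-- Circuits on the wires below wire `0` act on controlled Pauli strings by conjugation. -/
theorem ctlG_mul_gate (g : Gate n) (p : PauliString) :
    ctlG (n + 1) n p * cls (FreeMonoid.of (g.place 1 (by omega))) =
      cls (FreeMonoid.of (g.place 1 (by omega))) * ctlG (n + 1) n (g.act p) := by
  have hz : ∀ b, ∀ j < n, ∀ a, Commute (ctlSite (n + 1) 0 j a) (bpow (zG (n + 1) 0) b) :=
    fun b j hj a => (bpow_commute (ctlSite_zG (by omega) (by omega) a).symm b).symm
  cases g with
  | neg => exact (nG_commute _).symm.eq
  | H i =>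
    simp only [Gate.place, cls_of_H, Gate.act, ctlG]
    rw [mul_assoc, siteProd_mul_of_one i.isLt (hz ((p.2 i).1 && (p.2 i).2))
      (a' := ((p.2 i).2, (p.2 i).1))
      (fun j hj hji a => ctlSite_hG (by omega) (by omega) (by omega) a)
      (by simpa only [zero_add, add_comm 1] using
        ctlSite_mul_hG (n := n + 1) (i := 0) (j := i) (by omega) _),
      ← mul_assoc, (bpow_commute (zG_hG (by omega)) _).eq, mul_assoc, ← mul_assoc (bpow _ _),
      bpow_mul_bpow (zG_sq _)]
  | Z i =>
    simp only [Gate.place, cls_of_Z, Gate.act, ctlG]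
    rw [mul_assoc, siteProd_mul_of_one i.isLt (hz ((p.2 i).1)) (a' := p.2 i)
      (fun j hj hji a => ctlSite_zG (by omega) (by omega) a)
      (by simpa only [zero_add, add_comm 1] using
        ctlSite_mul_zG (n := n + 1) (i := 0) (j := i) (by omega) _),
      Function.update_eq_self,
      ← mul_assoc, (bpow_commute (zG_zG _ _) _).eq, mul_assoc, ← mul_assoc (bpow _ _),
      bpow_mul_bpow (zG_sq _)]
  | CZ i hi =>
    simp only [Gate.place, cls_of_CZ, Gate.act, ctlG]
    rw [mul_assoc, siteProd_mul_of_two hi (hz ((p.2 i).1 && (p.2 (i + 1)).1))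
      (a' := ((p.2 i).1, xor (p.2 i).2 (p.2 (i + 1)).1))
      (b' := ((p.2 (i + 1)).1, xor (p.2 (i + 1)).2 (p.2 i).1))
      (fun j hj hji hji' a => ctlSite_kG (by omega) (by omega) (by omega) (by omega) a)
      (by simpa only [zero_add, add_comm 1] using
        ctlSite_mul_kG (n := n + 1) (i := 0) (j := i) (by omega) _ _),
      ← mul_assoc, (bpow_commute (kG_zG _ _).symm _).eq, mul_assoc, ← mul_assoc (bpow _ _),
      bpow_mul_bpow (zG_sq _)]

theorem ctlG_mul_place (C : Circuit n) (p : PauliString) :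
    ctlG (n + 1) n p * cls (C.place 1 (by omega)) =
      cls (C.place 1 (by omega)) * ctlG (n + 1) n (C.act p) := by
  induction C using FreeMonoid.inductionOn' generalizing p with
  | one => rw [map_one, cls_one, act_one, mul_one, one_mul]
  | of_mul g C ih =>
    rw [map_mul, cls_mul, act_mul, act_of, ← mul_assoc]
    have := ctlG_mul_gate g p
    rw [show Circuit.place 1 (by omega) (FreeMonoid.of g) =
      FreeMonoid.of (g.place 1 (show 1 + n ≤ n + 1 by omega)) from rfl, this, mul_assoc, ih,
      mul_assoc]

end Controlled
/-! ### Tensor products -/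

section Tensor

variable {n : ℕ}

theorem tensor_apply (P : Fin n → Matrix (Fin 2) (Fin 2) ℝ) (x y : Fin n → Fin 2) :
    tensor P x y = ∏ i, P i (x i) (y i) := rfl

theorem tensor_mul (P Q : Fin n → Matrix (Fin 2) (Fin 2) ℝ) :
    tensor P * tensor Q = tensor fun i => P i * Q i := by
  ext x y
  simp only [Matrix.mul_apply, tensor_apply, Finset.prod_univ_sum, Finset.prod_mul_distrib,
    Fintype.piFinset_univ]

theorem tensor_one : tensor (fun _ : Fin n => 1) = 1 := by
  ext x y
  rw [tensor_apply, Matrix.one_apply]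
  split_ifs with h
  · exact Finset.prod_eq_one fun i _ => by rw [h, Matrix.one_apply_eq]
  · obtain ⟨i, hi⟩ := Function.ne_iff.1 h
    exact Finset.prod_eq_zero (Finset.mem_univ i) (Matrix.one_apply_ne hi)

theorem tensor_eq_smul {P Q : Fin n → Matrix (Fin 2) (Fin 2) ℝ} {i : Fin n} {c : ℝ}
    (h : ∀ l, l ≠ i → P l = Q l) (hi : P i = c • Q i) : tensor P = c • tensor Q := by
  ext x y
  rw [Matrix.smul_apply, tensor_apply, tensor_apply,
    ← Finset.mul_prod_erase _ _ (Finset.mem_univ i),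
    ← Finset.mul_prod_erase _ (fun i => Q i (x i) (y i)) (Finset.mem_univ i), hi,
    Matrix.smul_apply, smul_eq_mul, smul_eq_mul, mul_assoc]
  congr 2
  exact Finset.prod_congr rfl fun l hl => by rw [h l (Finset.ne_of_mem_erase hl)]

theorem onQubit_mul_onQubit (i : Fin n) (M N : Matrix (Fin 2) (Fin 2) ℝ) :
    onQubit i M * onQubit i N = onQubit i (M * N) := by
  rw [onQubit, onQubit, tensor_mul, onQubit]
  congr 1
  funext l
  by_cases h : l = i
  · subst h; simp
  · simp [h]

theorem onQubit_one (i : Fin n) : onQubit i 1 = 1 := by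
  rw [onQubit, Function.update_eq_self_iff.2 rfl, tensor_one]

theorem onQubit_apply (i : Fin n) (M : Matrix (Fin 2) (Fin 2) ℝ) (x y : Fin n → Fin 2) :
    onQubit i M x y = if ∀ l, l ≠ i → x l = y l then M (x i) (y i) else 0 := by
  rw [onQubit, tensor_apply]
  split_ifs with h
  · rw [← Finset.mul_prod_erase _ _ (Finset.mem_univ i), Function.update_self]
    rw [Finset.prod_eq_one, mul_one]
    intro l hl
    have := Finset.ne_of_mem_erase hl
    rw [Function.update_of_ne this, h l this, Matrix.one_apply_eq]
  · push Not at h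
    obtain ⟨l, hl, hxy⟩ := h
    refine Finset.prod_eq_zero (Finset.mem_univ l) ?_
    rw [Function.update_of_ne hl, Matrix.one_apply_ne hxy]

theorem tensor_transpose (P : Fin n → Matrix (Fin 2) (Fin 2) ℝ) :
    (tensor P).transpose = tensor fun i => (P i).transpose := rfl

theorem onQubit_transpose (i : Fin n) (M : Matrix (Fin 2) (Fin 2) ℝ) :
    (onQubit i M).transpose = onQubit i M.transpose := by
  rw [onQubit, tensor_transpose, onQubit]
  congr 1
  funext l
  by_cases h : l = i
  · subst h; simp
  · simp [h]

end Tensor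

theorem hadamard_mul_self : hadamard * hadamard = 1 := by
  have h : (√2)⁻¹ * (√2)⁻¹ = (1 / 2 : ℝ) := by
    rw [← mul_inv, Real.mul_self_sqrt (by norm_num)]; norm_num
  ext i j
  fin_cases i <;> fin_cases j <;> simp [hadamard, Matrix.mul_apply, Fin.sum_univ_two, h] <;>
    norm_num

theorem pauliZ_mul_self : pauliZ * pauliZ = 1 := by
  ext i j
  fin_cases i <;> fin_cases j <;> simp [pauliZ, Matrix.mul_apply, Fin.sum_univ_two]

theorem pauliX_mul_self : pauliX * pauliX = 1 := by
  ext i j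
  fin_cases i <;> fin_cases j <;> simp [pauliX, Matrix.mul_apply, Fin.sum_univ_two]

theorem hadamard_transpose : hadamard.transpose = hadamard := by
  ext i j
  fin_cases i <;> fin_cases j <;> simp [hadamard]

theorem pauliZ_transpose : pauliZ.transpose = pauliZ := by
  ext i j
  fin_cases i <;> fin_cases j <;> simp [pauliZ]

/-! ### Operators of circuits -/

section Operators

variable {n : ℕ}

theorem operator_one : (1 : Circuit n).operator = 1 := by
  simp [Circuit.operator]

theorem operator_mul (C D : Circuit n) : (C * D).operator = D.operator * C.operator := by
  simp [Circuit.operator]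

theorem operator_of (g : Gate n) : Circuit.operator (FreeMonoid.of g) = g.operator := by
  simp [Circuit.operator]

theorem gate_operator_mul_self (g : Gate n) : g.operator * g.operator = 1 := by
  cases g with
  | neg => simp [Gate.operator]
  | H i => rw [Gate.operator, onQubit_mul_onQubit, hadamard_mul_self, onQubit_one]
  | Z i => rw [Gate.operator, onQubit_mul_onQubit, pauliZ_mul_self, onQubit_one]
  | CZ i h =>
    rw [Gate.operator, Matrix.diagonal_mul_diagonal, ← Matrix.diagonal_one]
    congr 1
    funext x
    split_ifs <;> norm_num

theorem gate_operator_transpose (g : Gate n) : g.operator.transpose = g.operator := by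
  cases g with
  | neg => simp [Gate.operator]
  | H i => rw [Gate.operator, onQubit_transpose, hadamard_transpose]
  | Z i => rw [Gate.operator, onQubit_transpose, pauliZ_transpose]
  | CZ i h => rw [Gate.operator, Matrix.diagonal_transpose]

theorem operator_mul_transpose (C : Circuit n) : C.operator * C.operator.transpose = 1 := by
  induction C using FreeMonoid.inductionOn' with
  | one => simp [operator_one]
  | of_mul g C ih =>
    rw [operator_mul, operator_of, Matrix.transpose_mul, gate_operator_transpose, mul_assoc,
      ← mul_assoc g.operator, gate_operator_mul_self, one_mul, ih]

theorem transpose_mul_operator (C : Circuit n) : C.operator.transpose * C.operator = 1 :=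
  mul_eq_one_comm.1 (operator_mul_transpose C)

/-! ### Pauli operators -/

/-- The integer entries of `X ^ x * Z ^ z`. -/
def pauliEntry (a : Bool × Bool) (u v : Fin 2) : ℤ :=
  if u = v + (bif a.1 then 1 else 0) then (if a.2 ∧ v = 1 then -1 else 1) else 0

/-- The matrix `X ^ x * Z ^ z`. -/
def pauliMat (a : Bool × Bool) : Matrix (Fin 2) (Fin 2) ℝ :=
  Matrix.of fun u v => (pauliEntry a u v : ℝ)

/-- The sign denoted by a Boolean. -/
def sgn (b : Bool) : ℤ := bif b then -1 else 1

theorem sgn_mul_sgn (a b : Bool) : sgn a * sgn b = sgn (xor a b) := by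
  revert a b; decide

/-- The operator of a signed Pauli string. -/
def pauliOp (n : ℕ) (p : PauliString) : Operator n :=
  (sgn p.1 : ℝ) • tensor fun i : Fin n => pauliMat (p.2 i)

theorem pauliMat_one : pauliMat (false, false) = 1 := by
  ext i j
  fin_cases i <;> fin_cases j <;> simp [pauliMat, pauliEntry]

theorem pauliMat_X : pauliMat (true, false) = pauliX := by
  ext i j
  fin_cases i <;> fin_cases j <;> simp [pauliMat, pauliEntry, pauliX]

theorem pauliMat_Z : pauliMat (false, true) = pauliZ := by
  ext i j
  fin_cases i <;> fin_cases j <;> simp [pauliMat, pauliEntry, pauliZ]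

theorem pauliMat_Y : pauliMat (true, true) = pauliX * pauliZ := by
  ext i j
  fin_cases i <;> fin_cases j <;>
    simp [pauliMat, pauliEntry, pauliX, pauliZ, Matrix.mul_apply, Fin.sum_univ_two]

theorem hadamard_mul_pauliMat (a : Bool × Bool) :
    hadamard * pauliMat a = (sgn (a.1 && a.2) : ℝ) • (pauliMat (a.2, a.1) * hadamard) := by
  obtain ⟨a, b⟩ := a
  ext i j
  cases a <;> cases b <;> fin_cases i <;> fin_cases j <;>
    simp [hadamard, pauliMat, pauliEntry, Matrix.mul_apply, Fin.sum_univ_two, sgn]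

theorem pauliZ_mul_pauliMat (a : Bool × Bool) :
    pauliZ * pauliMat a = (sgn a.1 : ℝ) • (pauliMat a * pauliZ) := by
  obtain ⟨a, b⟩ := a
  ext i j
  cases a <;> cases b <;> fin_cases i <;> fin_cases j <;>
    simp [pauliZ, pauliMat, pauliEntry, Matrix.mul_apply, Fin.sum_univ_two, sgn]

/-- Because the entries are integers, conjugation by `CZ` is a finite check on two letters and their
row and column bits. -/
theorem cz_pauliEntry (a b : Bool × Bool) (u v u' v' : Fin 2) :
    (if u = 1 ∧ v = 1 then -1 else 1) * (pauliEntry a u u' * pauliEntry b v v') =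
      sgn (a.1 && b.1) * (pauliEntry (a.1, xor a.2 b.1) u u' *
        pauliEntry (b.1, xor b.2 a.1) v v') * (if u' = 1 ∧ v' = 1 then -1 else 1) := by
  revert a b u v u' v'
  decide

theorem onQubit_mul_pauliOp {i : Fin n} {M : Matrix (Fin 2) (Fin 2) ℝ} {p : PauliString}
    {s : Bool} {a : Bool × Bool} (h : M * pauliMat (p.2 i) = (sgn s : ℝ) • (pauliMat a * M)) :
    onQubit i M * pauliOp n p =
      pauliOp n (xor p.1 s, Function.update p.2 i a) * onQubit i M := by
  rw [pauliOp, pauliOp, onQubit, Matrix.mul_smul, Matrix.smul_mul, tensor_mul, tensor_mul,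
    ← sgn_mul_sgn, Int.cast_mul, mul_smul]
  congr 1
  refine tensor_eq_smul (i := i) (fun l hl => ?_) ?_
  · have hl' : (l : ℕ) ≠ i := by simpa [Fin.ext_iff] using hl
    simp [hl, hl']
  · simpa using h

theorem cz_mul_pauliOp {i : ℕ} (hi : i + 1 < n) (p : PauliString) :
    (Gate.CZ i hi).operator * pauliOp n p =
      pauliOp n ((Gate.CZ i hi).act p) * (Gate.CZ i hi).operator := by
  ext x y
  have hne : (⟨i, by omega⟩ : Fin n) ≠ ⟨i + 1, hi⟩ := by simp [Fin.ext_iff]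
  have hm : (⟨i + 1, hi⟩ : Fin n) ∈ Finset.univ.erase (⟨i, by omega⟩ : Fin n) := by
    simp [Fin.ext_iff]
  simp only [Gate.operator, Matrix.diagonal_mul, Matrix.mul_diagonal, pauliOp, Matrix.smul_apply,
    tensor_apply, smul_eq_mul]
  rw [← Finset.mul_prod_erase _ _ (Finset.mem_univ (⟨i, by omega⟩ : Fin n)),
    ← Finset.mul_prod_erase _ _ hm,
    ← Finset.mul_prod_erase _ (fun l : Fin n => pauliMat (((Gate.CZ i hi).act p).2 l) (x l) (y l))
      (Finset.mem_univ (⟨i, by omega⟩ : Fin n)),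
    ← Finset.mul_prod_erase _ (fun l : Fin n => pauliMat (((Gate.CZ i hi).act p).2 l) (x l) (y l))
      hm]
  have hr : ∏ l ∈ (Finset.univ.erase (⟨i, by omega⟩ : Fin n)).erase ⟨i + 1, hi⟩,
      pauliMat (((Gate.CZ i hi).act p).2 l) (x l) (y l) =
      ∏ l ∈ (Finset.univ.erase (⟨i, by omega⟩ : Fin n)).erase ⟨i + 1, hi⟩,
        pauliMat (p.2 l) (x l) (y l) := by
    refine Finset.prod_congr rfl fun l hl => ?_
    have h1 := Finset.ne_of_mem_erase hl
    have h2 := Finset.ne_of_mem_erase (Finset.mem_of_mem_erase hl)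
    have : ((Gate.CZ i hi).act p).2 l = p.2 l :=
      (Function.update_of_ne (by simpa [Fin.ext_iff] using h1) _ _).trans
        (Function.update_of_ne (by simpa [Fin.ext_iff] using h2) _ _)
    rw [this]
  rw [hr]
  have e := cz_pauliEntry (p.2 i) (p.2 (i + 1)) (x ⟨i, by omega⟩) (x ⟨i + 1, hi⟩)
    (y ⟨i, by omega⟩) (y ⟨i + 1, hi⟩)
  have e' := congrArg (Int.cast : ℤ → ℝ) e
  push_cast at e'
  have u1 : ((Gate.CZ i hi).act p).2 (i + 1) =
    ((p.2 (i + 1)).1, xor (p.2 (i + 1)).2 (p.2 i).1) := by simp [Gate.act]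
  have u0 : ((Gate.CZ i hi).act p).2 i =
    ((p.2 i).1, xor (p.2 i).2 (p.2 (i + 1)).1) := by simp [Gate.act]
  have us : (((sgn ((Gate.CZ i hi).act p).1 : ℤ)) : ℝ) =
      sgn p.1 * sgn ((p.2 i).1 && (p.2 (i + 1)).1) := by
    rw [← Int.cast_mul, sgn_mul_sgn]; rfl
  rw [u0, u1, us]
  simp only [pauliMat, Matrix.of_apply]
  linear_combination ((sgn p.1 : ℝ) *
    ∏ l ∈ (Finset.univ.erase (⟨i, by omega⟩ : Fin n)).erase ⟨i + 1, hi⟩,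
        (pauliEntry (p.2 l) (x l) (y l) : ℝ)) * e'

theorem gate_mul_pauliOp (g : Gate n) (p : PauliString) :
    g.operator * pauliOp n p = pauliOp n (g.act p) * g.operator := by
  cases g with
  | neg => simp [Gate.operator, Gate.act]
  | H i => exact onQubit_mul_pauliOp (hadamard_mul_pauliMat _)
  | Z i =>
    have := onQubit_mul_pauliOp (i := i) (p := p) (pauliZ_mul_pauliMat (p.2 i))
    rwa [Function.update_eq_self] at this
  | CZ i hi => exact cz_mul_pauliOp hi p

theorem operator_mul_pauliOp (C : Circuit n) (p : PauliString) :
    C.operator * pauliOp n p = pauliOp n (C.act p) * C.operator := by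
  induction C using FreeMonoid.inductionOn' generalizing p with
  | one => simp [operator_one, act_one]
  | of_mul g C ih =>
    rw [operator_mul, operator_of, act_mul, act_of, mul_assoc, gate_mul_pauliOp, ← mul_assoc, ih,
      mul_assoc]

theorem pauliOp_apply (p : PauliString) (x y : Fin n → Fin 2) :
    pauliOp n p x y = sgn p.1 * ∏ i : Fin n, (pauliEntry (p.2 i) (x i) (y i) : ℝ) := by
  simp [pauliOp, tensor_apply, pauliMat]

/-- The column of the zero state has one nonzero entry: its row shows the `X` exponents and its
value the sign. The column with a single `1` on wire `i` then shows the `Z` exponent there. -/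
theorem pauliOp_injective {p q : PauliString} (h : pauliOp n p = pauliOp n q) :
    p.1 = q.1 ∧ ∀ i < n, p.2 i = q.2 i := by
  have e1 : ∀ a : Bool × Bool, pauliEntry a (bif a.1 then 1 else 0) 0 = 1 := by decide
  have e2 : ∀ a b : Bool × Bool, pauliEntry b (bif a.1 then 1 else 0) 0 ≠ 0 → a.1 = b.1 := by
    decide
  have e3 : ∀ a b : Bool × Bool, a.1 = b.1 →
      pauliEntry a (1 + (bif a.1 then 1 else 0)) 1 = pauliEntry b (1 + (bif a.1 then 1 else 0)) 1 →
      a = b := by decide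
  have hs : ∀ b : Bool, (sgn b : ℝ) ≠ 0 := fun b => by cases b <;> simp [sgn]
  have hx : ∀ i < n, (p.2 i).1 = (q.2 i).1 := by
    intro i hi
    have := congrFun (congrFun h fun i => bif (p.2 i).1 then 1 else 0) fun _ => 0
    simp only [pauliOp_apply, e1] at this
    refine e2 _ _ fun h0 => ?_
    rw [Finset.prod_eq_zero (i := (⟨i, hi⟩ : Fin n)) (Finset.mem_univ _)
      (f := fun j : Fin n => (pauliEntry (q.2 j) (bif (p.2 j).1 then 1 else 0) 0 : ℝ))
      (by simpa using h0)] at this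
    simp at this
    exact hs _ (by exact_mod_cast this)
  have e4 : ∀ i : Fin n, pauliEntry (q.2 i) (bif (p.2 i).1 then 1 else 0) 0 = 1 := fun i => by
    rw [hx i i.isLt]; exact e1 _
  have hsgn : p.1 = q.1 := by
    have := congrFun (congrFun h fun i => bif (p.2 i).1 then 1 else 0) fun _ => 0
    simp only [pauliOp_apply, e1, e4] at this
    simp only [Int.cast_one, Finset.prod_const_one, mul_one, Int.cast_inj] at this
    revert this
    generalize p.1 = a
    generalize q.1 = b
    revert a b
    decide
  refine ⟨hsgn, fun i hi => e3 _ _ (hx i hi) ?_⟩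
  have := congrFun (congrFun h fun j => (if (j : ℕ) = i then 1 else 0) +
    (bif (p.2 j).1 then 1 else 0)) fun j => if (j : ℕ) = i then 1 else 0
  simp only [pauliOp_apply, hsgn] at this
  have := mul_left_cancel₀ (hs _) this
  rw [← Finset.mul_prod_erase _ _ (Finset.mem_univ (⟨i, hi⟩ : Fin n)),
    ← Finset.mul_prod_erase _ (fun j : Fin n => (pauliEntry (q.2 j) _ _ : ℝ))
      (Finset.mem_univ (⟨i, hi⟩ : Fin n)),
    Finset.prod_eq_one, Finset.prod_eq_one] at this
  · simpa using this
  · intro j hj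
    have hj : (j : ℕ) ≠ i := by simpa [Fin.ext_iff] using Finset.ne_of_mem_erase hj
    simp [hj, e4]
  · intro j hj
    have hj : (j : ℕ) ≠ i := by simpa [Fin.ext_iff] using Finset.ne_of_mem_erase hj
    simp [hj, e1]

end Operators
/-! ### Soundness of the reduced relations -/

section Integral

variable {n : ℕ}

theorem onQubit_mulVec (i : Fin n) (M : Matrix (Fin 2) (Fin 2) ℝ) (ψ : (Fin n → Fin 2) → ℝ)
    (x : Fin n → Fin 2) :
    (onQubit i M).mulVec ψ x = M (x i) 0 * ψ (Function.update x i 0) +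
      M (x i) 1 * ψ (Function.update x i 1) := by
  have inj : Function.Injective fun b : Fin 2 => Function.update x i b :=
    Function.update_injective x i
  rw [Matrix.mulVec, dotProduct, ← Finset.sum_subset (Finset.subset_univ
    (Finset.univ.image fun b : Fin 2 => Function.update x i b)), Finset.sum_image inj.injOn,
    Fin.sum_univ_two]
  · have h : ∀ b, ∀ l, l ≠ i → x l = Function.update x i b l :=
      fun b l hl => (Function.update_of_ne hl _ _).symm
    simp only [onQubit_apply, if_pos (h _), Function.update_self]
  · intro y _ hy
    rw [onQubit_apply, if_neg, zero_mul]
    intro h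
    refine hy (Finset.mem_image.2 ⟨y i, Finset.mem_univ _, ?_⟩)
    funext l
    by_cases hl : l = i
    · subst hl; simp
    · rw [Function.update_of_ne hl, h l hl]

/-- The gates as integral operators, with the Hadamard gate multiplied by `√2`. -/
def Gate.intAct : Gate n → ((Fin n → Fin 2) → ℤ) → (Fin n → Fin 2) → ℤ
  | .neg, ψ => fun x => -ψ x
  | .H i, ψ => fun x => ψ (Function.update x i 0) +
      (if x i = 1 then -1 else 1) * ψ (Function.update x i 1)
  | .Z i, ψ => fun x => (if x i = 1 then -1 else 1) * ψ x
  | .CZ i hi, ψ => fun x => (if x ⟨i, by omega⟩ = 1 ∧ x ⟨i + 1, hi⟩ = 1 then -1 else 1) * ψ x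

/-- The number of Hadamard gates. -/
def Gate.hCount : Gate n → ℕ
  | .H _ => 1
  | _ => 0

theorem gate_mulVec (g : Gate n) (ψ : (Fin n → Fin 2) → ℤ) :
    g.operator.mulVec (fun x => (ψ x : ℝ)) = fun x => (1 / √2) ^ g.hCount * (g.intAct ψ x : ℝ) := by
  funext x
  cases g with
  | neg => simp [Gate.operator, Gate.hCount, Gate.intAct, Matrix.neg_mulVec]
  | H i =>
    rw [Gate.operator, onQubit_mulVec]
    simp only [Gate.hCount, Gate.intAct, hadamard]
    have : x i = 0 ∨ x i = 1 := by omega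
    rcases this with h | h <;> simp [h] <;> ring
  | Z i =>
    rw [Gate.operator, onQubit_mulVec]
    simp only [Gate.hCount, Gate.intAct, pauliZ]
    have : x i = 0 ∨ x i = 1 := by omega
    rcases this with h | h
    · have e : Function.update x i 0 = x := by rw [← h, Function.update_eq_self]
      simp [h, e]
    · have e : Function.update x i 1 = x := by rw [← h, Function.update_eq_self]
      simp [h, e]
  | CZ i hi =>
    simp only [Gate.operator, Gate.hCount, Gate.intAct, Matrix.mulVec_diagonal, pow_zero, one_mul]
    push_cast
    rfl

/-- The integral operator of a circuit. -/
def intAct (l : List (Gate n)) (ψ : (Fin n → Fin 2) → ℤ) : (Fin n → Fin 2) → ℤ :=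
  l.foldl (fun ψ g => g.intAct ψ) ψ

theorem operator_mulVec (l : List (Gate n)) (ψ : (Fin n → Fin 2) → ℤ) :
    (circ l).operator.mulVec (fun x => (ψ x : ℝ)) =
      fun x => (1 / √2) ^ (l.map Gate.hCount).sum * (intAct l ψ x : ℝ) := by
  induction l generalizing ψ with
  | nil => simpa [intAct] using congrArg (fun A : Operator n => A.mulVec _) operator_one
  | cons g l ih =>
    have e : (circ (g :: l)).operator = (circ l).operator * g.operator := by
      rw [← operator_of, ← operator_mul]; rfl
    rw [e, ← Matrix.mulVec_mulVec, gate_mulVec]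
    rw [show (fun x => (1 / √2 : ℝ) ^ g.hCount * (g.intAct ψ x : ℝ)) =
      ((1 / √2 : ℝ) ^ g.hCount) • fun x => (g.intAct ψ x : ℝ) from rfl, Matrix.mulVec_smul, ih]
    funext x
    simp only [Pi.smul_apply, smul_eq_mul, List.map_cons, List.sum_cons, pow_add, mul_assoc]
    rfl

/-- `d` is half the excess of Hadamard gates on the left; the corresponding factors `1 / √2` amount
to `2⁻ᵈ`. This reduces an equality of real matrices to integers, column by column. -/
theorem operator_eq_of_intAct {l l' : List (Gate n)} (d : ℕ)
    (hd : (l.map Gate.hCount).sum = (l'.map Gate.hCount).sum + 2 * d)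
    (h : ∀ x y, intAct l (fun z => if z = y then 1 else 0) x =
      2 ^ d * intAct l' (fun z => if z = y then 1 else 0) x) :
    (circ l).operator = (circ l').operator := by
  ext x y
  have key : ∀ A : Operator n, A x y =
      A.mulVec (fun z => ((if z = y then 1 else 0 : ℤ) : ℝ)) x := by
    intro A
    simp [Matrix.mulVec, dotProduct]
  have h2 : (1 / √2 : ℝ) ^ (2 * d) * 2 ^ d = 1 := by
    rw [pow_mul, ← mul_pow, div_pow, Real.sq_sqrt (by norm_num)]
    norm_num
  rw [key (circ l).operator, key (circ l').operator, operator_mulVec, operator_mulVec]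
  dsimp only
  rw [h, hd, pow_add]
  push_cast
  linear_combination ((1 / √2 : ℝ) ^ (l'.map Gate.hCount).sum *
    (intAct l' (fun z => if z = y then 1 else 0) x : ℝ)) * h2

/-- The state of three qubits with the given amplitudes. -/
def vecThree (a b c d e f g h : ℤ) (x : Fin 3 → Fin 2) : ℤ :=
  if x 0 = 0 then
    if x 1 = 0 then if x 2 = 0 then a else b else if x 2 = 0 then c else d
  else if x 1 = 0 then if x 2 = 0 then e else f else if x 2 = 0 then g else h

theorem mul_vecThree (r a b c d e f g h : ℤ) (x : Fin 3 → Fin 2) :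
    r * vecThree a b c d e f g h x =
      vecThree (r * a) (r * b) (r * c) (r * d) (r * e) (r * f) (r * g) (r * h) x := by
  unfold vecThree
  split_ifs <;> rfl

theorem intAct_H₀ (a b c d e f g h : ℤ) :
    Gate.intAct (n := 3) (.H 0) (vecThree a b c d e f g h) =
      vecThree (a + e) (b + f) (c + g) (d + h) (a - e) (b - f) (c - g) (d - h) := by
  funext x
  have h0 : x 0 = 0 ∨ x 0 = 1 := by omega
  have h1 : x 1 = 0 ∨ x 1 = 1 := by omega
  have h2 : x 2 = 0 ∨ x 2 = 1 := by omega
  rcases h0 with h0 | h0 <;> rcases h1 with h1 | h1 <;> rcases h2 with h2 | h2 <;>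
    simp [Gate.intAct, vecThree, h0, h1, h2, Function.update, sub_eq_add_neg]

theorem intAct_H₁ (a b c d e f g h : ℤ) :
    Gate.intAct (n := 3) (.H 1) (vecThree a b c d e f g h) =
      vecThree (a + c) (b + d) (a - c) (b - d) (e + g) (f + h) (e - g) (f - h) := by
  funext x
  have h0 : x 0 = 0 ∨ x 0 = 1 := by omega
  have h1 : x 1 = 0 ∨ x 1 = 1 := by omega
  have h2 : x 2 = 0 ∨ x 2 = 1 := by omega
  rcases h0 with h0 | h0 <;> rcases h1 with h1 | h1 <;> rcases h2 with h2 | h2 <;>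
    simp [Gate.intAct, vecThree, h0, h1, h2, Function.update, sub_eq_add_neg]

theorem intAct_H₂ (a b c d e f g h : ℤ) :
    Gate.intAct (n := 3) (.H 2) (vecThree a b c d e f g h) =
      vecThree (a + b) (a - b) (c + d) (c - d) (e + f) (e - f) (g + h) (g - h) := by
  funext x
  have h0 : x 0 = 0 ∨ x 0 = 1 := by omega
  have h1 : x 1 = 0 ∨ x 1 = 1 := by omega
  have h2 : x 2 = 0 ∨ x 2 = 1 := by omega
  rcases h0 with h0 | h0 <;> rcases h1 with h1 | h1 <;> rcases h2 with h2 | h2 <;>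
    simp [Gate.intAct, vecThree, h0, h1, h2, Function.update, sub_eq_add_neg]

theorem intAct_CZ₀ (a b c d e f g h : ℤ) :
    Gate.intAct (n := 3) (.CZ 0) (vecThree a b c d e f g h) =
      vecThree a b c d e f (-g) (-h) := by
  funext x
  have h0 : x 0 = 0 ∨ x 0 = 1 := by omega
  have h1 : x 1 = 0 ∨ x 1 = 1 := by omega
  have h2 : x 2 = 0 ∨ x 2 = 1 := by omega
  rcases h0 with h0 | h0 <;> rcases h1 with h1 | h1 <;> rcases h2 with h2 | h2 <;>
    simp [Gate.intAct, vecThree, h0, h1, h2, Function.update, sub_eq_add_neg]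

theorem intAct_CZ₁ (a b c d e f g h : ℤ) :
    Gate.intAct (n := 3) (.CZ 1) (vecThree a b c d e f g h) =
      vecThree a b c (-d) e f g (-h) := by
  funext x
  have h0 : x 0 = 0 ∨ x 0 = 1 := by omega
  have h1 : x 1 = 0 ∨ x 1 = 1 := by omega
  have h2 : x 2 = 0 ∨ x 2 = 1 := by omega
  rcases h0 with h0 | h0 <;> rcases h1 with h1 | h1 <;> rcases h2 with h2 | h2 <;>
    simp [Gate.intAct, vecThree, h0, h1, h2, Function.update, sub_eq_add_neg]

theorem ite_eq_vecThree (y : Fin 3 → Fin 2) : ∃ a b c d e f g h : ℤ,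
    (fun z => if z = y then 1 else 0 : (Fin 3 → Fin 2) → ℤ) = vecThree a b c d e f g h := by
  refine ⟨if ![0, 0, 0] = y then 1 else 0, if ![0, 0, 1] = y then 1 else 0,
    if ![0, 1, 0] = y then 1 else 0, if ![0, 1, 1] = y then 1 else 0,
    if ![1, 0, 0] = y then 1 else 0, if ![1, 0, 1] = y then 1 else 0,
    if ![1, 1, 0] = y then 1 else 0, if ![1, 1, 1] = y then 1 else 0, ?_⟩
  funext x
  have h0 : x 0 = 0 ∨ x 0 = 1 := by omega
  have h1 : x 1 = 0 ∨ x 1 = 1 := by omega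
  have h2 : x 2 = 0 ∨ x 2 = 1 := by omega
  have e : x = ![x 0, x 1, x 2] := by funext i; fin_cases i <;> rfl
  rcases h0 with h0 | h0 <;> rcases h1 with h1 | h1 <;> rcases h2 with h2 | h2 <;>
    rw [h0, h1, h2] at e <;> simp only [vecThree, h0, h1, h2, e] <;> simp

/-- On three wires both words are run on a state with eight indeterminate amplitudes, which leaves
linear identities instead of a check of all basis states. -/
theorem operator_eq_of_vecThree {l l' : List (Gate 3)} (m : ℕ)
    (hm : (l.map Gate.hCount).sum = (l'.map Gate.hCount).sum + 2 * m)
    (h : ∀ a b c d e f g h x, intAct l (vecThree a b c d e f g h) x =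
      2 ^ m * intAct l' (vecThree a b c d e f g h) x) :
    (circ l).operator = (circ l').operator :=
  operator_eq_of_intAct m hm fun x y => by
    obtain ⟨a, b, c, d, e, f, g, k, h'⟩ := ite_eq_vecThree y
    rw [h', h]

theorem reducedRel_operator {m : ℕ} {u v : Circuit m} (h : ReducedRel m u v) :
    u.operator = v.operator := by
  cases h with
  | R1 => exact operator_eq_of_intAct 0 rfl (by decide)
  | R2 => exact operator_eq_of_intAct 0 rfl (by decide)
  | R3 => exact operator_eq_of_intAct 1 rfl (by decide)
  | R4 => exact operator_eq_of_intAct 2 rfl (by decide +kernel)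
  | R5 => exact operator_eq_of_intAct 0 rfl (by decide +kernel)
  | R6 => exact operator_eq_of_intAct 0 rfl (by decide +kernel)
  | R7 => exact operator_eq_of_intAct 0 rfl (by decide +kernel)
  | R8 => exact operator_eq_of_intAct 0 rfl (by decide +kernel)
  | R9 => exact operator_eq_of_intAct 0 rfl (by decide +kernel)
  | R10 => exact operator_eq_of_intAct 0 rfl (by decide +kernel)
  | R11 => exact operator_eq_of_intAct 0 rfl (by decide +kernel)
  | R12 => exact operator_eq_of_intAct 0 rfl (by decide +kernel)
  | R13 =>
    refine operator_eq_of_vecThree 0 rfl fun a b c d e f g h x => ?_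
    simp only [intAct, List.foldl, intAct_H₀, intAct_H₁, intAct_H₂, intAct_CZ₀, intAct_CZ₁,
      mul_vecThree]
    congr 1 <;> ring
  | R14 =>
    refine operator_eq_of_vecThree 0 rfl fun a b c d e f g h x => ?_
    simp only [intAct, List.foldl, intAct_H₀, intAct_H₁, intAct_H₂, intAct_CZ₀, intAct_CZ₁,
      mul_vecThree]
    congr 1 <;> ring
  | R15 =>
    refine operator_eq_of_vecThree 2 rfl fun a b c d e f g h x => ?_
    simp only [intAct, List.foldl, intAct_H₀, intAct_H₁, intAct_H₂, intAct_CZ₀, intAct_CZ₁,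
      mul_vecThree]
    congr 1 <;> ring
  | R16 =>
    refine operator_eq_of_vecThree 2 rfl fun a b c d e f g h x => ?_
    simp only [intAct, List.foldl, intAct_H₀, intAct_H₁, intAct_H₂, intAct_CZ₀, intAct_CZ₁,
      mul_vecThree]
    congr 1 <;> ring

end Integral
/-! ### Operators on a block of wires -/

section Embed

variable {m n : ℕ}

/-- Split a basis state into its part on the wires `k, …, k + m - 1` and the rest. -/
def splitState (k : ℕ) (h : k + m ≤ n) : (Fin n → Fin 2) ≃
    (Fin m → Fin 2) × ({i : Fin n // ¬ (k ≤ (i : ℕ) ∧ (i : ℕ) < k + m)} → Fin 2) where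
  toFun x := (fun i => x ⟨k + i, by omega⟩, fun j => x j)
  invFun u := fun i => if hi : k ≤ (i : ℕ) ∧ (i : ℕ) < k + m then u.1 ⟨i - k, by omega⟩
    else u.2 ⟨i, hi⟩
  left_inv x := by
    funext i
    dsimp only
    split_ifs with hi
    · congr 1
      ext
      simp only
      omega
    · rfl
  right_inv u := by
    refine Prod.ext (funext fun i => ?_) (funext fun j => ?_)
    · dsimp only
      rw [dif_pos ⟨by omega, by omega⟩]
      simp
    · dsimp only
      rw [dif_neg j.2]

/-- The operator `A` on the wires `k, …, k + m - 1`. -/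
def embed (k : ℕ) (h : k + m ≤ n) (A : Operator m) : Operator n :=
  (Matrix.kroneckerMap (· * ·) A 1).submatrix (splitState k h) (splitState k h)

theorem embed_apply (k : ℕ) (h : k + m ≤ n) (A : Operator m) (x y : Fin n → Fin 2) :
    embed k h A x y = if ∀ i : Fin n, ¬ (k ≤ (i : ℕ) ∧ (i : ℕ) < k + m) → x i = y i then
      A (fun i => x ⟨k + i, by omega⟩) (fun i => y ⟨k + i, by omega⟩) else 0 := by
  change A (splitState k h x).1 (splitState k h y).1 *
    (1 : Matrix _ _ ℝ) (splitState k h x).2 (splitState k h y).2 = _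
  rw [Matrix.one_apply]
  have : (splitState k h x).2 = (splitState k h y).2 ↔
      ∀ i : Fin n, ¬ (k ≤ (i : ℕ) ∧ (i : ℕ) < k + m) → x i = y i := by
    rw [funext_iff]
    exact ⟨fun H i hi => H ⟨i, hi⟩, fun H j => H j j.2⟩
  simp only [this, mul_ite, mul_one, mul_zero]
  rfl

theorem embed_mul (k : ℕ) (h : k + m ≤ n) (A B : Operator m) :
    embed k h (A * B) = embed k h A * embed k h B := by
  rw [embed, embed, embed, Matrix.submatrix_mul_equiv]
  congr 1
  rw [← Matrix.mul_kronecker_mul, one_mul]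

theorem embed_one (k : ℕ) (h : k + m ≤ n) : embed k h (1 : Operator m) = 1 := by
  rw [embed, Matrix.kroneckerMap_one_one _ (by simp) (by simp) (by simp),
    Matrix.submatrix_one_equiv]

theorem embed_injective (k : ℕ) (h : k + m ≤ n) :
    Function.Injective (embed k h : Operator m → Operator n) := by
  intro A B hAB
  ext u v
  have := congrFun (congrFun hAB ((splitState k h).symm (u, fun _ => 0)))
    ((splitState k h).symm (v, fun _ => 0))
  simpa [embed, Matrix.submatrix_apply, Matrix.kronecker_apply] using this

theorem embed_transpose (k : ℕ) (h : k + m ≤ n) (A : Operator m) :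
    (embed k h A).transpose = embed k h A.transpose := by
  ext x y
  simp only [Matrix.transpose_apply, embed_apply, eq_comm]

theorem embed_onQubit (k : ℕ) (h : k + m ≤ n) (i : Fin m) (M : Matrix (Fin 2) (Fin 2) ℝ) :
    embed k h (onQubit i M) = onQubit ⟨k + i, by omega⟩ M := by
  ext x y
  rw [embed_apply, onQubit_apply, onQubit_apply, ← ite_and]
  refine if_congr ⟨fun H l hl => ?_, fun H => ⟨fun l hl => H l ?_, fun l hl => H _ ?_⟩⟩ rfl rfl
  · by_cases hb : k ≤ (l : ℕ) ∧ (l : ℕ) < k + m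
    · have := H.2 ⟨l - k, by omega⟩ (by
        intro e
        apply hl
        rw [← e]
        ext
        simp only
        omega)
      have e : (⟨k + (l - k), by omega⟩ : Fin n) = l := by
        ext
        simp only
        omega
      simpa only [e] using this
    · exact H.1 l hb
  · rintro rfl
    exact hl ⟨by simp, by simp⟩
  · intro e
    apply hl
    ext
    simpa using congrArg Fin.val e

theorem gate_operator_place (k : ℕ) (h : k + m ≤ n) (g : Gate m) :
    (g.place k h).operator = embed k h g.operator := by
  cases g with
  | neg =>
    rw [Gate.place, Gate.operator, Gate.operator, ← embed_one k h]
    ext x y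
    simp only [Matrix.neg_apply, embed_apply]
    split_ifs <;> simp
  | H i => exact (embed_onQubit k h i _).symm
  | Z i => exact (embed_onQubit k h i _).symm
  | CZ i hi =>
    ext x y
    rw [embed_apply]
    simp only [Gate.place, Gate.operator, Matrix.diagonal_apply]
    by_cases hxy : x = y
    · subst hxy
      simp [add_assoc]
    · rw [if_neg hxy]
      split_ifs with h1 h2 h3
      · exact absurd ((splitState k h).injective (Prod.ext h2 (funext fun j => h1 j j.2))) hxy
      · exact absurd ((splitState k h).injective (Prod.ext h2 (funext fun j => h1 j j.2))) hxy
      · rfl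
      · rfl

theorem operator_place (k : ℕ) (h : k + m ≤ n) (C : Circuit m) :
    (C.place k h).operator = embed k h C.operator := by
  induction C using FreeMonoid.inductionOn' with
  | one => rw [map_one, operator_one, operator_one, embed_one]
  | of_mul g C ih =>
    rw [map_mul, operator_mul, operator_mul, embed_mul, ih, operator_of,
      ← gate_operator_place k h, ← operator_of]
    rfl

end Embed

/-! ### Soundness -/

section Soundness

variable {n : ℕ}

theorem slide_operator {g g' : Gate n} (h : Disjoint g.wires g'.wires) :
    g.operator * g'.operator = g'.operator * g.operator := by
  have qq : ∀ (i j : Fin n) (M N : Matrix (Fin 2) (Fin 2) ℝ), i ≠ j →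
      onQubit i M * onQubit j N = onQubit j N * onQubit i M := by
    intro i j M N hij
    rw [onQubit, onQubit, tensor_mul, tensor_mul]
    congr 1
    funext l
    by_cases h1 : l = i
    · subst h1; simp [hij]
    · simp [h1]
  have qk : ∀ (i : Fin n) (M : Matrix (Fin 2) (Fin 2) ℝ) (j : ℕ) (hj : j + 1 < n),
      (i : ℕ) ≠ j → (i : ℕ) ≠ j + 1 →
      onQubit i M * (Gate.CZ j hj).operator = (Gate.CZ j hj).operator * onQubit i M := by
    intro i M j hj h1 h2
    ext x y
    rw [Gate.operator, Matrix.diagonal_mul, Matrix.mul_diagonal, onQubit_apply]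
    split_ifs with h3 h4 h5 h5 <;> simp
    · rw [← h3 _ (by simp [Fin.ext_iff]; omega), ← h3 _ (by simp [Fin.ext_iff]; omega)] at h4
      exact absurd h4 h5
    · rw [h3 _ (by simp [Fin.ext_iff]; omega), h3 _ (by simp [Fin.ext_iff]; omega)] at h5
      exact absurd h5 h4
  cases g <;> cases g' <;> simp only [Gate.wires, Set.disjoint_singleton, Set.disjoint_insert_left,
    Set.disjoint_insert_right, Set.mem_insert_iff, Set.mem_singleton_iff, not_or] at h
  all_goals try simp only [Gate.operator, neg_mul, one_mul, mul_neg, mul_one]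
  · exact qq _ _ _ _ (by simpa [Fin.ext_iff] using h)
  · exact qq _ _ _ _ (by simpa [Fin.ext_iff] using h)
  · exact qk _ _ _ _ (by omega) (by omega)
  · exact qq _ _ _ _ (by simpa [Fin.ext_iff] using h)
  · exact qq _ _ _ _ (by simpa [Fin.ext_iff] using h)
  · exact qk _ _ _ _ (by omega) (by omega)
  · exact (qk _ _ _ _ (by omega) (by omega)).symm
  · exact (qk _ _ _ _ (by omega) (by omega)).symm
  · rw [Matrix.diagonal_mul_diagonal, Matrix.diagonal_mul_diagonal]
    simp only [mul_comm]

theorem circuitRel_operator {C D : Circuit n} (h : CircuitRel n C D) :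
    C.operator = D.operator := by
  cases h with
  | reduced huv k h => rw [operator_place, operator_place, reducedRel_operator huv]
  | slide g g' hd =>
    have : ∀ a b : Gate n, (circ [a, b]).operator = b.operator * a.operator := by
      intro a b
      rw [← operator_of, ← operator_of, ← operator_mul]
      rfl
    rw [this, this, slide_operator hd]

theorem operator_eq_of_cls_eq {C D : Circuit n} (h : cls C = cls D) :
    C.operator = D.operator := by
  have hle : conGen (CircuitRel n) ≤
      Con.ker (FreeMonoid.lift fun g : Gate n => MulOpposite.op g.operator) :=
    Con.conGen_le.2 fun C D h => MulOpposite.unop_injective (circuitRel_operator h)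
  have := hle (cls_eq_iff.1 h)
  exact congrArg MulOpposite.unop this

theorem gate_act_of_le (g : Gate n) (p : PauliString) {i : ℕ} (hi : n ≤ i) :
    (g.act p).2 i = p.2 i := by
  cases g with
  | neg => rfl
  | H j => exact Function.update_of_ne (by omega) _ _
  | Z j => rfl
  | CZ j hj =>
    exact (Function.update_of_ne (by omega) _ _).trans (Function.update_of_ne (by omega) _ _)

theorem act_of_le (C : Circuit n) (p : PauliString) {i : ℕ} (hi : n ≤ i) :
    (C.act p).2 i = p.2 i := by
  induction C using FreeMonoid.inductionOn' generalizing p with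
  | one => rfl
  | of_mul g C ih => rw [act_mul, ih, act_of, gate_act_of_le g p hi]

theorem mul_operator_injective (C : Circuit n) {A B : Operator n}
    (h : A * C.operator = B * C.operator) : A = B := by
  have := congrArg (· * C.operator.transpose) h
  simpa only [mul_assoc, operator_mul_transpose, mul_one] using this

/-- Both actions are conjugation by the same invertible matrix, and Pauli operators determine their
strings on the wires present; letters on later wires never move. -/
theorem act_eq_of_operator_eq {C D : Circuit n} (h : C.operator = D.operator)
    (p : PauliString) : C.act p = D.act p := by
  have e : pauliOp n (C.act p) = pauliOp n (D.act p) := by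
    refine mul_operator_injective C ?_
    rw [← operator_mul_pauliOp, h, operator_mul_pauliOp]
  obtain ⟨h1, h2⟩ := pauliOp_injective e
  refine Prod.ext h1 (funext fun i => ?_)
  by_cases hi : i < n
  · exact h2 i hi
  · rw [act_of_le C p (not_lt.1 hi), act_of_le D p (not_lt.1 hi)]

theorem act_eq_of_cls_eq {C D : Circuit n} (h : cls C = cls D) (p : PauliString) :
    C.act p = D.act p :=
  act_eq_of_operator_eq (operator_eq_of_cls_eq h) p

theorem gate_act_involutive (g : Gate n) (p : PauliString) : g.act (g.act p) = p := by
  have := act_eq_of_cls_eq (C := FreeMonoid.of g * FreeMonoid.of g) (D := 1)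
    (by rw [cls_mul, cls_of_sq, cls_one]) p
  rwa [act_mul, act_one, act_of, act_of] at this

theorem act_injective (C : Circuit n) : Function.Injective C.act := by
  induction C using FreeMonoid.inductionOn' with
  | one => exact fun p q h => h
  | of_mul g C ih =>
    intro p q h
    rw [act_mul, act_mul, act_of, act_of] at h
    have := congrArg g.act (ih h)
    rwa [gate_act_involutive, gate_act_involutive] at this

theorem act_surjective (C : Circuit n) : Function.Surjective C.act := by
  induction C using FreeMonoid.inductionOn' with
  | one => exact fun p => ⟨p, rfl⟩
  | of_mul g C ih =>
    intro p
    obtain ⟨q, rfl⟩ := ih p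
    exact ⟨g.act q, by rw [act_mul, act_of, gate_act_involutive]⟩

end Soundness
/-! ### The action of circuits on a block of wires -/

section Block

variable {m n : ℕ}

theorem act_place (k : ℕ) (h : k + m ≤ n) (C : Circuit m) (p : PauliString) :
    (C.place k h).act p =
      ((C.act (p.1, fun i => p.2 (k + i))).1,
        fun i => if i < k then p.2 i else (C.act (p.1, fun i => p.2 (k + i))).2 (i - k)) := by
  have gate : ∀ (g : Gate m) (p : PauliString), (g.place k h).act p =
      ((g.act (p.1, fun i => p.2 (k + i))).1,
        fun i => if i < k then p.2 i else (g.act (p.1, fun i => p.2 (k + i))).2 (i - k)) := by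
    intro g p
    have key : ∀ (f : ℕ → Bool × Bool) (j : ℕ) (a : Bool × Bool), Function.update f (k + j) a =
        fun i => if i < k then f i else Function.update (fun i => f (k + i)) j a (i - k) := by
      intro f j a
      funext i
      simp only [Function.update_apply]
      split_ifs with h1 h2 h3 <;> first | omega | rfl | (congr 1; omega)
    have key0 : ∀ (f : ℕ → Bool × Bool), f = fun i => if i < k then f i else f (k + (i - k)) := by
      intro f
      funext i
      split_ifs <;> first | rfl | (congr 1; omega)
    cases g with
    | neg => exact Prod.ext rfl (key0 _)
    | H i => exact Prod.ext rfl (key _ _ _)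
    | Z i => exact Prod.ext rfl (key0 _)
    | CZ i hi =>
      refine Prod.ext rfl ?_
      simp only [Gate.place, Gate.act]
      rw [show k + i + 1 = k + (i + 1) by ring]
      funext j
      simp only [Function.update_apply]
      split_ifs <;> first | omega | rfl | exact congrArg p.2 (by omega)
  induction C using FreeMonoid.inductionOn' generalizing p with
  | one =>
    refine Prod.ext rfl (funext fun i => ?_)
    simp only [map_one, act_one]
    split_ifs <;> first | rfl | exact congrArg p.2 (by omega)
  | of_mul g C ih =>
    rw [map_mul, act_mul, act_mul, act_of, ih]
    have e : (Circuit.place k h (FreeMonoid.of g)).act p = (g.place k h).act p := rfl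
    rw [e, gate]
    dsimp only
    simp only [show ∀ i, ¬ (k + i < k) from fun i => by omega, if_false, Nat.add_sub_cancel_left]
    refine Prod.ext rfl (funext fun i => ?_)
    dsimp only
    split_ifs <;> rfl

/-- The action of a gate on one wire on the letter of that wire. -/
def Gate.actOne : Gate 1 → Bool × Bool × Bool → Bool × Bool × Bool
  | .H _, (s, x, z) => (xor s (x && z), z, x)
  | .Z _, (s, x, z) => (xor s x, x, z)
  | _, p => p

/-- The action of a circuit on one wire on the letter of that wire. -/
def Circuit.actOne (C : Circuit 1) (p : Bool × Bool × Bool) : Bool × Bool × Bool :=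
  C.toList.foldl (fun p g => g.actOne p) p

/-- The action of a gate on two wires on the letters of these wires. -/
def Gate.actTwo : Gate 2 → Bool × (Bool × Bool) × (Bool × Bool) →
    Bool × (Bool × Bool) × (Bool × Bool)
  | .neg, p => p
  | .H i, (s, a, b) => if i = 0 then (xor s (a.1 && a.2), (a.2, a.1), b)
      else (xor s (b.1 && b.2), a, (b.2, b.1))
  | .Z i, (s, a, b) => if i = 0 then (xor s a.1, a, b) else (xor s b.1, a, b)
  | .CZ _ _, (s, a, b) => (xor s (a.1 && b.1), (a.1, xor a.2 b.1), (b.1, xor b.2 a.1))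

/-- The action of a circuit on two wires on the letters of these wires. -/
def Circuit.actTwo (C : Circuit 2) (p : Bool × (Bool × Bool) × (Bool × Bool)) :
    Bool × (Bool × Bool) × (Bool × Bool) :=
  C.toList.foldl (fun p g => g.actTwo p) p

theorem act_place_one (k : ℕ) (h : k + 1 ≤ n) (C : Circuit 1) (p : PauliString) :
    (C.place k h).act p =
      ((C.actOne (p.1, p.2 k)).1, Function.update p.2 k (C.actOne (p.1, p.2 k)).2) := by
  have gate : ∀ (g : Gate 1) (p : PauliString), (g.place k h).act p =
      ((g.actOne (p.1, p.2 k)).1, Function.update p.2 k (g.actOne (p.1, p.2 k)).2) := by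
    intro g p
    cases g with
    | neg => exact Prod.ext rfl (Function.update_eq_self _ _).symm
    | H i =>
      obtain rfl : i = 0 := Subsingleton.elim _ _
      rfl
    | Z i =>
      obtain rfl : i = 0 := Subsingleton.elim _ _
      exact Prod.ext rfl (Function.update_eq_self _ _).symm
    | CZ i hi => omega
  induction C using FreeMonoid.inductionOn' generalizing p with
  | one => exact Prod.ext rfl (Function.update_eq_self _ _).symm
  | of_mul g C ih =>
    rw [map_mul, act_mul, ih]
    have e : (Circuit.place k h (FreeMonoid.of g)).act p = (g.place k h).act p := rfl
    rw [e, gate]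
    simp only [Function.update_self, Function.update_idem]
    rfl

theorem update_update_update_update {f : ℕ → Bool × Bool} {k : ℕ} {a b a' b' : Bool × Bool} :
    Function.update (Function.update (Function.update (Function.update f k a) (k + 1) b) k a')
      (k + 1) b' = Function.update (Function.update f k a') (k + 1) b' := by
  funext i
  simp only [Function.update_apply]
  split_ifs <;> rfl

theorem act_place_two (k : ℕ) (h : k + 2 ≤ n) (C : Circuit 2) (p : PauliString) :
    (C.place k h).act p = ((C.actTwo (p.1, p.2 k, p.2 (k + 1))).1,
      Function.update (Function.update p.2 k (C.actTwo (p.1, p.2 k, p.2 (k + 1))).2.1)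
        (k + 1) (C.actTwo (p.1, p.2 k, p.2 (k + 1))).2.2) := by
  have triv : ∀ f : ℕ → Bool × Bool,
      Function.update (Function.update f k (f k)) (k + 1) (f (k + 1)) = f := fun f => by
    rw [Function.update_eq_self, Function.update_eq_self]
  have gate : ∀ (g : Gate 2) (p : PauliString), (g.place k h).act p =
      ((g.actTwo (p.1, p.2 k, p.2 (k + 1))).1,
      Function.update (Function.update p.2 k (g.actTwo (p.1, p.2 k, p.2 (k + 1))).2.1)
        (k + 1) (g.actTwo (p.1, p.2 k, p.2 (k + 1))).2.2) := by
    intro g p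
    cases g with
    | neg => exact Prod.ext rfl (triv _).symm
    | H i =>
      refine Fin.cases ?_ (fun i => ?_) i
      · refine Prod.ext rfl ?_
        simp [Gate.place, Gate.act, Gate.actTwo]
      · obtain rfl : i = 0 := Subsingleton.elim _ _
        refine Prod.ext rfl ?_
        simp [Gate.place, Gate.act, Gate.actTwo]
    | Z i =>
      refine Fin.cases ?_ (fun i => ?_) i
      · exact Prod.ext rfl (triv _).symm
      · obtain rfl : i = 0 := Subsingleton.elim _ _
        exact Prod.ext rfl (triv _).symm
    | CZ i hi =>
      obtain rfl : i = 0 := by omega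
      rfl
  induction C using FreeMonoid.inductionOn' generalizing p with
  | one => exact Prod.ext rfl (triv _).symm
  | of_mul g C ih =>
    rw [map_mul, act_mul, ih]
    have e : (Circuit.place k h (FreeMonoid.of g)).act p = (g.place k h).act p := rfl
    rw [e, gate]
    simp only [Function.update_self, Function.update_of_ne (show k ≠ k + 1 by omega),
      update_update_update_update]
    rfl

end Block

/-! ### Reducing a Pauli string to one letter -/

/-- The letter on a wire of the given type: `Z` for single, `XZ` for double wires. -/
def WireType.letter : WireType → Bool × Bool
  | .single => (false, true)
  | .double => (true, true)

theorem exists_AGate {a : Bool × Bool} (h : a ≠ (false, false)) :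
    ∃ (t : WireType) (g : AGate t), ∀ s, g.circuit.actOne (s, a) = (s, t.letter) := by
  obtain ⟨x, z⟩ := a
  cases x <;> cases z
  · exact absurd rfl h
  · exact ⟨.single, .A1, by decide⟩
  · exact ⟨.single, .A2, by decide⟩
  · exact ⟨.double, .A3, by decide⟩

/-- The eight gates correspond to the two input types and the four letters on the wire above. The
type of the travelling letter changes exactly when the absorbed letter is `XZ`. -/
theorem exists_BGate (t : WireType) (a : Bool × Bool) :
    ∃ (t' : WireType) (b : BGate t t'), ∀ s,
      b.circuit.actTwo (s, a, t.letter) = (s, t'.letter, (false, false)) := by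
  obtain ⟨x, z⟩ := a
  cases t <;> cases x <;> cases z
  · exact ⟨_, .B1, by decide⟩
  · exact ⟨_, .B3, by decide⟩
  · exact ⟨_, .B2, by decide⟩
  · exact ⟨_, .B4, by decide⟩
  · exact ⟨_, .B5, by decide⟩
  · exact ⟨_, .B7, by decide⟩
  · exact ⟨_, .B6, by decide⟩
  · exact ⟨_, .B8, by decide⟩

/-- The conclusion keeps a bare circuit, since the travelling letter may arrive as `XZ`, whereas a
`BLadder` has to end with single type. The decomposition into double cosets needs the first form,
normal circuits the second. -/
theorem exists_ladder {n k : ℕ} (hk : k < n) (t : WireType) (p : PauliString)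
    (hp : p.2 k = t.letter) :
    ∃ (t' : WireType) (C : Circuit n),
      ((C.act p).1 = p.1 ∧ (C.act p).2 0 = t'.letter ∧
        (∀ i, 0 < i → i ≤ k → (C.act p).2 i = (false, false)) ∧
        ∀ i, k < i → (C.act p).2 i = p.2 i) ∧
      (t' = .single → ∃ r : BLadder k t, r.circuit hk = C) := by
  induction k generalizing t p with
  | zero =>
    refine ⟨t, 1, ⟨rfl, hp, fun i h h' => by omega, fun i _ => rfl⟩, ?_⟩
    rintro rfl
    exact ⟨.nil, rfl⟩
  | succ k ih =>
    obtain ⟨t₁, b, hb⟩ := exists_BGate t (p.2 k)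
    have e := act_place_two k (show k + 2 ≤ n from hk) b.circuit p
    rw [hp, hb] at e
    dsimp only at e
    obtain ⟨t', C, ⟨h1, h2, h3, h4⟩, h5⟩ := ih (by omega) t₁
      ((Circuit.place k (show k + 2 ≤ n from hk) b.circuit).act p) (by rw [e]; simp)
    refine ⟨t', Circuit.place k (show k + 2 ≤ n from hk) b.circuit * C, ?_, ?_⟩
    · rw [act_mul]
      refine ⟨h1.trans (by rw [e]), h2, fun i hi hik => ?_, fun i hi => ?_⟩
      · by_cases hik' : i ≤ k
        · exact h3 i hi hik'
        · obtain rfl : i = k + 1 := by omega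
          rw [h4 _ (by omega), e]
          simp
      · rw [h4 _ (by omega), e]
        dsimp only
        rw [Function.update_of_ne (by omega), Function.update_of_ne (by omega)]
    · intro ht
      obtain ⟨r, rfl⟩ := h5 ht
      exact ⟨.cons b r, rfl⟩

/-- Every nontrivial Pauli string is turned by a circuit into one letter on the top wire; if that
letter is `Z`, then the circuit is a `Z`-circuit. -/
theorem exists_reduction {n : ℕ} (p : PauliString) (hp : ∃ i < n, p.2 i ≠ (false, false)) :
    ∃ (t : WireType) (C : Circuit n),
      ((C.act p).1 = false ∧ (C.act p).2 0 = t.letter ∧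
        (∀ i, 0 < i → i < n → (C.act p).2 i = (false, false))) ∧
      (t = .single → ∃ L : ZCircuit n, L.circuit = C) := by
  classical
  -- The ladder starts at the lowest nontrivial letter, so nothing is left to remove below it.
  obtain ⟨k, hk, hk0, hmax⟩ : ∃ k < n, p.2 k ≠ (false, false) ∧
      ∀ i, k < i → i < n → p.2 i = (false, false) := by
    obtain ⟨i, hi, hi0⟩ := hp
    have hne : ((Finset.range n).filter fun i => p.2 i ≠ (false, false)).Nonempty :=
      ⟨i, by simp [hi, hi0]⟩
    obtain ⟨hk1, hk2⟩ := Finset.mem_filter.1 (Finset.max'_mem _ hne)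
    refine ⟨_, Finset.mem_range.1 hk1, hk2, fun i h1 h2 => ?_⟩
    by_contra h3
    have := Finset.le_max' ((Finset.range n).filter fun i => p.2 i ≠ (false, false)) i
      (Finset.mem_filter.2 ⟨Finset.mem_range.2 h2, h3⟩)
    omega
  obtain ⟨t, a, ha⟩ := exists_AGate hk0
  have eA := act_place_one k (show k + 1 ≤ n from hk) a.circuit p
  rw [ha] at eA
  dsimp only at eA
  obtain ⟨t', C, ⟨h1, h2, h3, h4⟩, h5⟩ := exists_ladder hk t
    ((Circuit.place k (show k + 1 ≤ n from hk) a.circuit).act p) (by rw [eA]; simp)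
  -- For either type the letter contains a factor `Z`, so conjugation by `X` changes the sign and
  -- nothing else.
  have hC : ∀ s t, ∃ c : CGate, c.circuit.actOne (s, WireType.letter t) = (false, t.letter) := by
    intro s t
    cases s
    · exact ⟨.C1, by cases t <;> decide⟩
    · exact ⟨.C2, by cases t <;> decide⟩
  obtain ⟨c, hc⟩ := hC p.1 t'
  have h0 : 0 + 1 ≤ n := by omega
  have e : (Circuit.place k (show k + 1 ≤ n from hk) a.circuit * C *
      Circuit.place 0 h0 c.circuit).act p = (false, Function.update
        (C.act ((Circuit.place k (show k + 1 ≤ n from hk) a.circuit).act p)).2 0 t'.letter) := by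
    rw [act_mul, act_mul, act_place_one, h1, h2, eA]
    dsimp only
    rw [hc]
  refine ⟨t', _, ⟨by rw [e], by rw [e]; simp, fun i hi hin => ?_⟩, ?_⟩
  · rw [e]
    dsimp only
    rw [Function.update_of_ne (by omega)]
    by_cases hik : i ≤ k
    · exact h3 i hi hik
    · rw [h4 i (by omega), eA]
      dsimp only
      rw [Function.update_of_ne (by omega), hmax i (by omega) hin]
  · intro ht
    obtain ⟨r, rfl⟩ := h5 ht
    exact ⟨⟨⟨k, hk⟩, t, a, r, c⟩, rfl⟩

/-! ### The action of the presented group on Pauli strings -/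

section Action

variable {n : ℕ}

/-- The action of the presented group on signed Pauli strings. -/
noncomputable def actG (x : CircuitGroup n) (p : PauliString) : PauliString :=
  Circuit.act (Function.surjInv PresentedMonoid.surjective_mk x) p

theorem actG_cls (C : Circuit n) (p : PauliString) : actG (cls C) p = C.act p :=
  act_eq_of_cls_eq (Function.surjInv_eq PresentedMonoid.surjective_mk (cls C)) p

theorem exists_cls (x : CircuitGroup n) : ∃ C : Circuit n, cls C = x :=
  PresentedMonoid.surjective_mk x

theorem actG_mul (x y : CircuitGroup n) (p : PauliString) : actG (x * y) p = actG y (actG x p) := by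
  obtain ⟨C, rfl⟩ := exists_cls x
  obtain ⟨D, rfl⟩ := exists_cls y
  rw [← cls_mul, actG_cls, actG_cls, actG_cls, act_mul]

theorem actG_one (p : PauliString) : actG (1 : CircuitGroup n) p = p := by
  rw [← cls_one, actG_cls, act_one]

theorem actG_injective (x : CircuitGroup n) : Function.Injective (actG x) := by
  obtain ⟨C, rfl⟩ := exists_cls x
  intro p q h
  rw [actG_cls, actG_cls] at h
  exact act_injective C h

theorem actG_zG {i : ℕ} (hi : i < n) (p : PauliString) :
    actG (zG n i) p = (xor p.1 (p.2 i).1, p.2) := by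
  rw [show zG n i = cls (FreeMonoid.of (.Z ⟨i, hi⟩)) from (cls_of_Z ⟨i, hi⟩).symm, actG_cls]
  rfl

theorem actG_hG {i : ℕ} (hi : i < n) (p : PauliString) :
    actG (hG n i) p = (xor p.1 ((p.2 i).1 && (p.2 i).2),
      Function.update p.2 i ((p.2 i).2, (p.2 i).1)) := by
  rw [show hG n i = cls (FreeMonoid.of (.H ⟨i, hi⟩)) from (cls_of_H ⟨i, hi⟩).symm, actG_cls]
  rfl

theorem actG_kG {i : ℕ} (hi : i + 1 < n) (p : PauliString) :
    actG (kG n i) p = (xor p.1 ((p.2 i).1 && (p.2 (i + 1)).1),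
        Function.update (Function.update p.2 i ((p.2 i).1, xor (p.2 i).2 (p.2 (i + 1)).1))
          (i + 1) ((p.2 (i + 1)).1, xor (p.2 (i + 1)).2 (p.2 i).1)) := by
  rw [← cls_of_CZ hi, actG_cls]
  rfl

open Gate in
theorem actG_swG {i : ℕ} (hi : i + 1 < n) (p : PauliString) :
    actG (swG n i) p =
      (p.1, Function.update (Function.update p.2 i (p.2 (i + 1))) (i + 1) (p.2 i)) := by
  have e : swG n i = cls (Circuit.place i (show i + 2 ≤ n from hi)
      (circ [CZ 0, H 0, H 1, CZ 0, H 0, H 1, CZ 0, H 0, H 1])) := by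
    rw [cls_place_circ]
    simp [Gate.place, cls_of_H, cls_of_CZ, swG, swapWord, mul_assoc]
  have key : ∀ s a b, Circuit.actTwo (circ [CZ 0, H 0, H 1, CZ 0, H 0, H 1, CZ 0, H 0, H 1])
      (s, a, b) = (s, b, a) := by decide
  rw [e, actG_cls, act_place_two, key]

theorem actG_farG {i j : ℕ} (h : i + j + 1 < n) (p : PauliString) :
    (actG (farG n i j) p).2 =
      Function.update (Function.update p.2 i ((p.2 i).1, xor (p.2 i).2 (p.2 (i + j + 1)).1))
        (i + j + 1) ((p.2 (i + j + 1)).1, xor (p.2 (i + j + 1)).2 (p.2 i).1) := by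
  induction j generalizing i p with
  | zero => rw [farG, actG_kG h]
  | succ j ih =>
    rw [farG, actG_mul, actG_mul, actG_swG (by omega), ih (by omega), actG_swG (by omega)]
    funext l
    have e : i + (j + 1) + 1 = i + 1 + j + 1 := by ring
    simp only [Function.update_apply, e, if_true, if_false, show i ≠ i + 1 by omega,
      show i ≠ i + 1 + j + 1 by omega, show i + 1 + j + 1 ≠ i by omega,
      show i + 1 ≠ i + 1 + j + 1 by omega, show i + 1 + j + 1 ≠ i + 1 by omega]
    split_ifs <;> first | rfl | omega | simp_all

theorem actG_bpow_farG {j : ℕ} (h : j + 1 < n) (b : Bool) (p : PauliString)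
    (hp : (p.2 0).1 = true) :
    ((actG (bpow (farG n 0 j) b) p).2 0).1 = true ∧
      (actG (bpow (farG n 0 j) b) p).2 (j + 1) = ((p.2 (j + 1)).1, xor (p.2 (j + 1)).2 b) ∧
      ∀ l, l ≠ 0 → l ≠ j + 1 → (actG (bpow (farG n 0 j) b) p).2 l = p.2 l := by
  cases b
  · simp [actG_one, hp]
  · rw [bpow_true, actG_farG (by omega)]
    simp only [zero_add]
    refine ⟨?_, ?_, fun l h0 hl => ?_⟩
    · rw [Function.update_of_ne (by omega), Function.update_self, hp]
    · rw [Function.update_self, hp]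
    · rw [Function.update_of_ne hl, Function.update_of_ne h0]

theorem actG_bpow_farX {j : ℕ} (h : j + 1 < n) (b : Bool) (p : PauliString)
    (hp : (p.2 0).1 = true) :
    ((actG (bpow (farX n 0 j) b) p).2 0).1 = true ∧
      (actG (bpow (farX n 0 j) b) p).2 (j + 1) = (xor (p.2 (j + 1)).1 b, (p.2 (j + 1)).2) ∧
      ∀ l, l ≠ 0 → l ≠ j + 1 → (actG (bpow (farX n 0 j) b) p).2 l = p.2 l := by
  cases b
  · simp [actG_one, hp]
  · rw [bpow_true, farX, actG_mul, actG_mul]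
    simp only [zero_add]
    obtain ⟨h1, h2, h3⟩ := actG_bpow_farG h true (actG (hG n (j + 1)) p) (by
      rw [actG_hG h]; dsimp only; rw [Function.update_of_ne (by omega), hp])
    rw [bpow_true] at h1 h2 h3
    rw [actG_hG h]
    dsimp only
    refine ⟨?_, ?_, fun l h0 hl => ?_⟩
    · rw [Function.update_of_ne (by omega), h1]
    · rw [Function.update_self, h2, actG_hG h]
      simp
    · rw [Function.update_of_ne hl, h3 l h0 hl, actG_hG h]
      exact Function.update_of_ne hl _ _

theorem actG_ctlSite {j : ℕ} (h : j + 1 < n) (a : Bool × Bool) (p : PauliString)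
    (hp : (p.2 0).1 = true) :
    ((actG (ctlSite n 0 j a) p).2 0).1 = true ∧
      (actG (ctlSite n 0 j a) p).2 (j + 1) = (xor (p.2 (j + 1)).1 a.1, xor (p.2 (j + 1)).2 a.2) ∧
      ∀ l, l ≠ 0 → l ≠ j + 1 → (actG (ctlSite n 0 j a) p).2 l = p.2 l := by
  obtain ⟨h1, h2, h3⟩ := actG_bpow_farG h a.2 p hp
  obtain ⟨g1, g2, g3⟩ := actG_bpow_farX h a.1 _ h1
  rw [ctlSite, actG_mul]
  exact ⟨g1, by rw [g2, h2], fun l h0 hl => by rw [g3 l h0 hl, h3 l h0 hl]⟩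

/-- Conjugation by a controlled string multiplies a Pauli with an `X` part on the control by that
string. The sign and the `Z` part on the control are not followed, as only the letters are needed to
recognise the string. -/
theorem actG_siteProd {m : ℕ} (h : m < n) (f : ℕ → Bool × Bool) (p : PauliString)
    (hp : (p.2 0).1 = true) :
    ((actG (siteProd (ctlSite n 0) m f) p).2 0).1 = true ∧
      (∀ j < m, (actG (siteProd (ctlSite n 0) m f) p).2 (j + 1) =
        (xor (p.2 (j + 1)).1 (f j).1, xor (p.2 (j + 1)).2 (f j).2)) ∧
      ∀ l, m < l → (actG (siteProd (ctlSite n 0) m f) p).2 l = p.2 l := by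
  induction m with
  | zero =>
    rw [siteProd, actG_one]
    exact ⟨hp, fun j hj => by omega, fun l _ => rfl⟩
  | succ m ih =>
    obtain ⟨h1, h2, h3⟩ := ih (by omega)
    obtain ⟨g1, g2, g3⟩ := actG_ctlSite h (f m) _ h1
    rw [siteProd, actG_mul]
    refine ⟨g1, fun j hj => ?_, fun l hl => ?_⟩
    · by_cases e : j = m
      · subst e
        rw [g2, h3 _ (by omega)]
      · rw [g3 _ (by omega) (by omega), h2 j (by omega)]
    · rw [g3 l (by omega) (by omega), h3 l (by omega)]

/-- The Pauli string with the letter `a` on wire `i`. -/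
def letterAt (i : ℕ) (a : Bool × Bool) : PauliString :=
  (false, Function.update (fun _ => (false, false)) i a)

theorem act_trivial (C : Circuit n) :
    C.act (false, fun _ => (false, false)) = (false, fun _ => (false, false)) := by
  induction C using FreeMonoid.inductionOn' with
  | one => rfl
  | of_mul g C ih =>
    rw [act_mul, act_of]
    have : g.act (false, fun _ => (false, false)) = (false, fun _ => (false, false)) := by
      cases g <;> simp [Gate.act, Function.update_eq_self_iff]
    rw [this, ih]

theorem act_place_letterAt (C : Circuit n) (a : Bool × Bool) :
    (C.place 1 (show 1 + n ≤ n + 1 by omega)).act (letterAt 0 a) = letterAt 0 a := by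
  have e : (fun i => (letterAt 0 a).2 (1 + i)) = fun _ => (false, false) := by
    funext i
    simp [letterAt]
  rw [act_place, e, show (letterAt 0 a).1 = false from rfl, act_trivial]
  refine Prod.ext rfl (funext fun i => ?_)
  by_cases hi : i = 0
  · subst hi; simp
  · simp [letterAt, hi]

end Action
/-! ### Double cosets of the stabilizer of `Z` on the top wire -/

section Cells

variable {n : ℕ}

/-- The class of a circuit placed below the top wire. -/
abbrev below (C : Circuit n) : CircuitGroup (n + 1) :=
  cls (C.place 1 (show 1 + n ≤ n + 1 by omega))

theorem below_mul (C D : Circuit n) : below (C * D) = below C * below D := by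
  rw [below, map_mul, cls_mul]

theorem below_one : below (1 : Circuit n) = 1 := by
  rw [below, map_one, cls_one]

/-- The submonoid generated by the gates that fix `Z` on the top wire. -/
def topStab (n : ℕ) : Submonoid (CircuitGroup (n + 1)) :=
  Submonoid.closure ({zG (n + 1) 0, kG (n + 1) 0} ∪ Set.range (below (n := n)))

theorem zG_zero_mem : zG (n + 1) 0 ∈ topStab n := Submonoid.subset_closure (by simp)

theorem kG_zero_mem : kG (n + 1) 0 ∈ topStab n := Submonoid.subset_closure (by simp)

theorem below_mem (C : Circuit n) : below C ∈ topStab n :=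
  Submonoid.subset_closure (.inr ⟨C, rfl⟩)

theorem hG_succ_eq_below {i : ℕ} (hi : i < n) :
    hG (n + 1) (i + 1) = below (FreeMonoid.of (.H ⟨i, hi⟩)) := by
  rw [show below (FreeMonoid.of (.H ⟨i, hi⟩)) =
    cls (FreeMonoid.of (Gate.place 1 (show 1 + n ≤ n + 1 by omega) (.H ⟨i, hi⟩))) from rfl,
    Gate.place, cls_of_H]
  exact congrArg _ (add_comm _ _)

theorem zG_succ_eq_below {i : ℕ} (hi : i < n) :
    zG (n + 1) (i + 1) = below (FreeMonoid.of (.Z ⟨i, hi⟩)) := by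
  rw [show below (FreeMonoid.of (.Z ⟨i, hi⟩)) =
    cls (FreeMonoid.of (Gate.place 1 (show 1 + n ≤ n + 1 by omega) (.Z ⟨i, hi⟩))) from rfl,
    Gate.place, cls_of_Z]
  exact congrArg _ (add_comm _ _)

theorem kG_succ_eq_below {i : ℕ} (hi : i + 1 < n) :
    kG (n + 1) (i + 1) = below (FreeMonoid.of (.CZ i hi)) := by
  rw [show below (FreeMonoid.of (.CZ i hi)) =
    cls (FreeMonoid.of (Gate.place 1 (show 1 + n ≤ n + 1 by omega) (.CZ i hi))) from rfl,
    Gate.place, cls_of_CZ]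
  exact congrArg _ (add_comm _ _)

theorem nG_eq_below : nG (n + 1) = below (FreeMonoid.of .neg) := rfl

theorem hG_succ_mem (i : ℕ) : hG (n + 1) (i + 1) ∈ topStab n := by
  by_cases hi : i < n
  · rw [hG_succ_eq_below hi]
    exact below_mem _
  · rw [hG, dif_neg (by omega)]
    exact one_mem _

theorem zG_mem (i : ℕ) : zG (n + 1) i ∈ topStab n := by
  match i with
  | 0 => exact zG_zero_mem
  | i + 1 =>
    by_cases hi : i < n
    · rw [zG_succ_eq_below hi]
      exact below_mem _
    · rw [zG, dif_neg (by omega)]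
      exact one_mem _

theorem kG_mem (i : ℕ) : kG (n + 1) i ∈ topStab n := by
  match i with
  | 0 => exact kG_zero_mem
  | i + 1 =>
    by_cases hi : i + 1 < n
    · rw [kG_succ_eq_below hi]
      exact below_mem _
    · rw [kG, dif_neg (by omega)]
      exact one_mem _

theorem swG_succ_mem (i : ℕ) : swG (n + 1) (i + 1) ∈ topStab n := by
  have h := hG_succ_mem (n := n) i
  have h' := hG_succ_mem (n := n) (i + 1)
  have k := kG_mem (n := n) (i + 1)
  unfold swG swapWord
  exact mul_mem (mul_mem (mul_mem (mul_mem (mul_mem (mul_mem (mul_mem (mul_mem k h) h') k) h) h') k)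
    h) h'

theorem farG_succ_mem (i j : ℕ) : farG (n + 1) (i + 1) j ∈ topStab n := by
  induction j generalizing i with
  | zero => exact kG_mem _
  | succ j ih => exact mul_mem (mul_mem (swG_succ_mem _) (ih _)) (swG_succ_mem _)

theorem bpow_mem {x : CircuitGroup (n + 1)} (h : x ∈ topStab n) (b : Bool) :
    bpow x b ∈ topStab n := by
  cases b
  · exact one_mem _
  · exact h

theorem ctlSite_one_mem (j : ℕ) (a : Bool × Bool) : ctlSite (n + 1) 1 j a ∈ topStab n := by
  have e : 1 + j + 1 = (j + 1) + 1 := by ring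
  refine mul_mem (bpow_mem (farG_succ_mem 0 j) _) (bpow_mem ?_ _)
  rw [farX, e]
  exact mul_mem (mul_mem (hG_succ_mem _) (farG_succ_mem 0 j)) (hG_succ_mem _)

theorem siteProd_trivial {m : ℕ} {f : ℕ → Bool × Bool} (h : ∀ j < m, f j = (false, false)) :
    siteProd (ctlSite n 0) m f = 1 := by
  induction m with
  | zero => rfl
  | succ m ih =>
    rw [siteProd, ih fun j hj => h j (by omega), h m (by omega)]
    simp [ctlSite]

theorem mul_siteProd_zero {G : Type*} [Group G] {blk : ℕ → Bool × Bool → G} {m : ℕ}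
    {f : ℕ → Bool × Bool} {g : G} {a : Bool × Bool} (h : g * blk 0 (f 0) = blk 0 a) :
    g * siteProd blk (m + 1) f = siteProd blk (m + 1) (Function.update f 0 a) := by
  induction m with
  | zero => simp [siteProd, h]
  | succ m ih =>
    rw [siteProd, ← mul_assoc, ih, siteProd.eq_def _ (m + 1 + 1)]
    dsimp only
    rw [Function.update_of_ne (by omega)]

theorem ctlG_mul_zG {m : ℕ} (hm : m ≤ n) (p : PauliString) :
    ctlG (n + 1) m p * zG (n + 1) 0 = ctlG (n + 1) m (!p.1, p.2) := by
  have c : Commute (siteProd (ctlSite (n + 1) 0) m p.2) (zG (n + 1) 0) :=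
    siteProd_commute fun j hj => ctlSite_zG (by omega) (by omega) _
  rw [ctlG, mul_assoc, c.eq, ← mul_assoc, ctlG]
  congr 1
  have := bpow_mul_bpow (zG_sq (n := n + 1) 0) p.1 true
  rwa [Bool.xor_true, bpow_true] at this

/-- The gate is a controlled `Z` on the first target, so it is absorbed into the letter there. On
its way it commutes with all other factors, and at its own wire it leaves at most a `Z` on the
control. -/
theorem exists_ctlG_mul_kG (p : PauliString) :
    ∃ q, ctlG (n + 1) n p * kG (n + 1) 0 = ctlG (n + 1) n q := by
  match n with
  -- On a single wire there is no `CZ` gate and `kG` has its default value `1`.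
  | 0 => exact ⟨p, by rw [kG, dif_neg (by omega), mul_one]⟩
  | n + 1 =>
    have hz : ∀ b, ∀ j < n + 1, ∀ a,
        Commute (ctlSite (n + 1 + 1) 0 j a) (bpow (zG (n + 1 + 1) 0) b) :=
      fun b j hj a => (bpow_commute (ctlSite_zG (by omega) (by omega) a).symm b).symm
    have hx := (twoWire (n := n + 1 + 1) (i := 0) (by omega)).cx_mul_k
    have hzx := (twoWire (n := n + 1 + 1) (i := 0) (by omega)).z₀_cx
    have hzk := (twoWire (n := n + 1 + 1) (i := 0) (by omega)).z₀k
    have h0 : ∀ a : Bool × Bool, ctlSite (n + 1 + 1) 0 0 a * kG (n + 1 + 1) 0 =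
        kG (n + 1 + 1) 0 * (bpow (zG (n + 1 + 1) 0) a.1 * ctlSite (n + 1 + 1) 0 0 a) := by
      rintro ⟨a, b⟩
      simp only [ctlSite, farX, farG]
      simp only [zero_add] at hx hzx hzk ⊢
      generalize hG (n + 1 + 1) 1 * kG (n + 1 + 1) 0 * hG (n + 1 + 1) 1 = c at *
      cases a <;> cases b <;> simp only [bpow_true, bpow_false, mul_one, one_mul, hx, hzx, hzk,
        mul_assoc, mul_left_extend hzx, mul_left_extend hzk]
    have h1 := siteProd_mul_of_one (blk := ctlSite (n + 1 + 1) 0) (m := n + 1) (i := 0)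
      (f := p.2) (a' := p.2 0) (by omega) (hz (p.2 0).1)
      (fun j hj hj0 a => ctlSite_commute (farG_farG (j := j) (l := 0) (by omega) (by omega))
        (kG_hG (by omega) (by omega)).symm a) (h0 _)
    rw [Function.update_eq_self, farG] at h1
    have h2 : kG (n + 1 + 1) 0 * ctlSite (n + 1 + 1) 0 0 (p.2 0) =
        ctlSite (n + 1 + 1) 0 0 ((p.2 0).1, !(p.2 0).2) := by
      rw [ctlSite, ← mul_assoc, ctlSite]
      congr 1
      have := bpow_mul_bpow (kG_sq (n := n + 1 + 1) 0) true (p.2 0).2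
      rwa [Bool.true_xor, bpow_true] at this
    have ck := (bpow_commute (kG_zG (n := n + 1 + 1) 0 0).symm (p.2 0).1).eq
    refine ⟨(xor p.1 (p.2 0).1, Function.update p.2 0 ((p.2 0).1, !(p.2 0).2)), ?_⟩
    rw [ctlG, mul_assoc, h1, ← mul_assoc (kG _ _), ← ck, mul_assoc, mul_siteProd_zero h2,
      ← mul_assoc, bpow_mul_bpow (zG_sq _), ctlG]

/-- Every element of the stabilizer is a circuit below the top wire followed by a controlled Pauli
string. -/
theorem exists_below_mul_ctlG {x : CircuitGroup (n + 1)} (hx : x ∈ topStab n) :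
    ∃ C p, x = below C * ctlG (n + 1) n p := by
  induction hx using Submonoid.closure_induction_right with
  | one =>
    refine ⟨1, (false, fun _ => (false, false)), ?_⟩
    rw [below_one, ctlG, siteProd_trivial fun _ _ => rfl]
    simp
  | mul_right x hx y hy ih =>
    obtain ⟨C, p, rfl⟩ := ih
    rcases hy with (rfl | rfl) | ⟨D, rfl⟩
    · exact ⟨C, _, by rw [mul_assoc, ctlG_mul_zG le_rfl]⟩
    · obtain ⟨q, hq⟩ := exists_ctlG_mul_kG p
      exact ⟨C, q, by rw [mul_assoc, hq]⟩
    · exact ⟨C * D, _, by rw [mul_assoc, ctlG_mul_place, ← mul_assoc, ← below_mul]⟩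

theorem exists_ctlG_mul_below {x : CircuitGroup (n + 1)} (hx : x ∈ topStab n) :
    ∃ C p, x = ctlG (n + 1) n p * below C := by
  obtain ⟨C, p, rfl⟩ := exists_below_mul_ctlG hx
  obtain ⟨q, rfl⟩ := act_surjective C p
  exact ⟨C, q, (ctlG_mul_place C q).symm⟩

theorem exists_below_inv (C : Circuit n) : ∃ D : Circuit n, below C * below D = 1 := by
  induction C using FreeMonoid.inductionOn' with
  | one => exact ⟨1, by rw [below_one, mul_one]⟩
  | of_mul g C ih =>
    obtain ⟨D, hD⟩ := ih
    refine ⟨D * FreeMonoid.of g, ?_⟩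
    rw [below_mul, below_mul, mul_assoc, ← mul_assoc (below C), hD, one_mul]
    exact cls_of_sq _

theorem hG_zero_below (C : Circuit n) : Commute (hG (n + 1) 0) (below C) := by
  induction C using FreeMonoid.inductionOn' with
  | one => rw [below_one]; exact Commute.one_right _
  | of_mul g C ih =>
    rw [below_mul]
    refine Commute.mul_right ?_ ih
    cases g with
    | neg => exact (nG_commute _).symm
    | H i => rw [← hG_succ_eq_below i.isLt]; exact hG_hG (by omega)
    | Z i => rw [← zG_succ_eq_below i.isLt]; exact (zG_hG (by omega)).symm
    | CZ i hi => rw [← kG_succ_eq_below hi]; exact (kG_hG (by omega) (by omega)).symm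

theorem zG_zero_below (C : Circuit n) : Commute (zG (n + 1) 0) (below C) := by
  induction C using FreeMonoid.inductionOn' with
  | one => rw [below_one]; exact Commute.one_right _
  | of_mul g C ih =>
    rw [below_mul]
    refine Commute.mul_right ?_ ih
    cases g with
    | neg => exact (nG_commute _).symm
    | H i => rw [← hG_succ_eq_below i.isLt]; exact zG_hG (by omega)
    | Z i => rw [← zG_succ_eq_below i.isLt]; exact zG_zG _ _
    | CZ i hi => rw [← kG_succ_eq_below hi]; exact (kG_zG _ _).symm

/-- Representatives of the double cosets. -/
inductive IsCellRep (n : ℕ) : CircuitGroup (n + 1) → Prop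
  | one : IsCellRep n 1
  | x : IsCellRep n (hG (n + 1) 0 * zG (n + 1) 0 * hG (n + 1) 0)
  | h : IsCellRep n (hG (n + 1) 0)
  | swap (hn : 0 < n) : IsCellRep n (swG (n + 1) 0)

/-- Membership in one of the four double cosets. -/
def InCells (x : CircuitGroup (n + 1)) : Prop :=
  ∃ t, IsCellRep n t ∧ ∃ q ∈ topStab n, ∃ q' ∈ topStab n, x = q * t * q'

theorem InCells.mul_left {x q : CircuitGroup (n + 1)} (hx : InCells x) (hq : q ∈ topStab n) :
    InCells (q * x) := by
  obtain ⟨t, ht, q₁, h₁, q₂, h₂, rfl⟩ := hx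
  exact ⟨t, ht, _, mul_mem hq h₁, q₂, h₂, by simp only [mul_assoc]⟩

theorem InCells.mul_right {x q : CircuitGroup (n + 1)} (hx : InCells x) (hq : q ∈ topStab n) :
    InCells (x * q) := by
  obtain ⟨t, ht, q₁, h₁, q₂, h₂, rfl⟩ := hx
  exact ⟨t, ht, q₁, h₁, _, mul_mem h₂ hq, by simp only [mul_assoc]⟩

theorem IsCellRep.inCells {t : CircuitGroup (n + 1)} (ht : IsCellRep n t) : InCells t :=
  ⟨t, ht, 1, one_mem _, 1, one_mem _, by simp⟩

theorem inCells_of_mem {q : CircuitGroup (n + 1)} (hq : q ∈ topStab n) : InCells q := by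
  simpa using IsCellRep.one.inCells.mul_left hq

theorem farX_zero_mem : farX (n + 1) 0 0 ∈ topStab n := by
  rw [farX]
  exact mul_mem (mul_mem (hG_succ_mem _) kG_zero_mem) (hG_succ_mem _)

/-- With `H` on the left, a controlled `Z` is the swap between two controlled `X` gates, so it lands
in the double coset of the swap. The other three cases contain a single Hadamard gate on the top
wire and land in that of `H`. -/
theorem inCells_conj_single {p : PauliString} (hn : 0 < n) (h0 : p.1 = false)
    (h1 : ∀ i, 0 < i → i < n → p.2 i = (false, false)) {t : WireType} (h2 : p.2 0 = t.letter) :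
    InCells (hG (n + 1) 0 * ctlG (n + 1) n p * hG (n + 1) 0) ∧
      InCells (hG (n + 1) 0 * zG (n + 1) 0 * hG (n + 1) 0 * ctlG (n + 1) n p * hG (n + 1) 0) := by
  obtain ⟨n, rfl⟩ : ∃ k, n = k + 1 := ⟨n - 1, by omega⟩
  have T := twoWire (n := n + 1 + 1) (i := 0) (by omega)
  have e : ctlG (n + 1 + 1) (n + 1) p = ctlSite (n + 1 + 1) 0 0 t.letter := by
    have := mul_siteProd_zero (blk := ctlSite (n + 1 + 1) 0) (m := n)
      (f := fun _ => (false, false)) (g := ctlSite (n + 1 + 1) 0 0 t.letter) (a := t.letter)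
      (by simp [ctlSite])
    rw [siteProd_trivial fun _ _ => rfl, mul_one] at this
    rw [ctlG, h0, bpow_false, one_mul, this]
    refine siteProd_congr fun j hj => ?_
    by_cases hj0 : j = 0
    · subst hj0; rw [Function.update_self, h2]
    · rw [Function.update_of_ne hj0, h1 j (by omega) hj]
  have k0 := kG_zero_mem (n := n + 1)
  have a0 := farX_zero_mem (n := n + 1)
  have x0 := hG_succ_mem (n := n + 1) 0
  have z0 := zG_mem (n := n + 1) 0
  have z1 := zG_mem (n := n + 1) 1
  have hC := IsCellRep.h (n := n + 1).inCells
  have sC := IsCellRep.swap (n := n + 1) (by omega) |>.inCells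
  have aa := farX_sq (n := n + 1 + 1) (i := 0) (j := 0) (by omega)
  have s1 := T.swap_eq₁
  have s2 := T.h_cy_h
  have s3 := T.x₀k
  have s4 := T.x_cy_h
  simp only [zero_add] at s1 s2 s3 s4
  change swG (n + 1 + 1) 0 = _ at s1
  rw [e]
  cases t
  · simp only [ctlSite, WireType.letter, bpow_true, bpow_false, mul_one, farG]
    refine ⟨?_, ?_⟩
    · have : hG (n + 1 + 1) 0 * kG (n + 1 + 1) 0 * hG (n + 1 + 1) 0 =
          farX (n + 1 + 1) 0 0 * swG (n + 1 + 1) 0 * farX (n + 1 + 1) 0 0 := by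
        change swG (n + 1 + 1) 0 = farX (n + 1 + 1) 0 0 * _ * farX (n + 1 + 1) 0 0 at s1
        rw [s1]
        simp only [mul_assoc, mul_self_cancel_left aa, aa, mul_one]
      rw [this]
      exact (sC.mul_left a0).mul_right a0
    · rw [s3, mul_assoc, T.h₀_sq, mul_one, mul_assoc]
      exact (hC.mul_left k0).mul_right (mul_mem z0 z1)
  · simp only [ctlSite, WireType.letter, bpow_true, bpow_false, mul_one, farG]
    refine ⟨?_, ?_⟩
    · change hG (n + 1 + 1) 0 * (kG (n + 1 + 1) 0 * farX (n + 1 + 1) 0 0) * hG (n + 1 + 1) 0 =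
        kG (n + 1 + 1) 0 * farX (n + 1 + 1) 0 0 * zG (n + 1 + 1) 0 * hG (n + 1 + 1) 0 *
          (hG (n + 1 + 1) 1 * kG (n + 1 + 1) 0 * (hG (n + 1 + 1) 1 * zG (n + 1 + 1) 1 *
            hG (n + 1 + 1) 1) * farX (n + 1 + 1) 0 0) at s2
      rw [s2]
      exact (hC.mul_left (mul_mem (mul_mem k0 a0) z0)).mul_right
        (mul_mem (mul_mem (mul_mem x0 k0) (mul_mem (mul_mem x0 z1) x0)) a0)
    · rw [farX]
      simp only [zero_add, farG]
      rw [s4]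
      exact (hC.mul_left (mul_mem (mul_mem (mul_mem k0 z1) x0) k0)).mul_right
        (mul_mem (mul_mem z0 z1) x0)

end Cells
-- The four double cosets cover the group.
section Closure

variable {n : ℕ}

/-- A nontrivial string is conjugated to a single letter by a circuit below the top wire, which
commutes with `t` and with `H` on the top wire. For a trivial string only a product of `H` and `Z`
on the top wire remains. -/
theorem inCells_rep_mul {t : CircuitGroup (n + 1)}
    (ht : t = hG (n + 1) 0 ∨ t = hG (n + 1) 0 * zG (n + 1) 0 * hG (n + 1) 0) (p : PauliString) :
    InCells (t * ctlG (n + 1) n p * hG (n + 1) 0) := by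
  have comm : ∀ C : Circuit n, Commute t (below C) := by
    intro C
    rcases ht with rfl | rfl
    · exact hG_zero_below C
    · exact ((hG_zero_below C).mul_left (zG_zero_below C)).mul_left (hG_zero_below C)
  by_cases hp : ∃ i < n, p.2 i ≠ (false, false)
  · obtain ⟨a, D, ⟨h1, h2, h3⟩, -⟩ := exists_reduction p hp
    obtain ⟨D', hD'⟩ := exists_below_inv D
    have e : ctlG (n + 1) n p = below D * ctlG (n + 1) n (D.act p) * below D' := by
      rw [← ctlG_mul_place D p, mul_assoc, hD', mul_one]
    have hn : 0 < n := by obtain ⟨i, hi, -⟩ := hp; omega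
    obtain ⟨c1, c2⟩ := inCells_conj_single hn h1 h3 h2
    have e' : t * ctlG (n + 1) n p * hG (n + 1) 0 =
        below D * (t * ctlG (n + 1) n (D.act p) * hG (n + 1) 0) * below D' := by
      rw [e, mul_assoc _ _ (hG (n + 1) 0), mul_assoc _ _ (hG (n + 1) 0),
        ← (hG_zero_below D').eq]
      simp only [mul_assoc, mul_left_extend (comm D).eq]
    rw [e']
    refine InCells.mul_right (InCells.mul_left ?_ (below_mem _)) (below_mem _)
    rcases ht with rfl | rfl
    · exact c1
    · exact c2
  · push Not at hp
    rw [ctlG, siteProd_trivial hp, mul_one]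
    have hx := IsCellRep.x (n := n).inCells
    have hh := IsCellRep.h (n := n).inCells
    rcases ht with rfl | rfl <;> cases p.1
    · rw [bpow_false, mul_one, hG_sq]
      exact inCells_of_mem (one_mem _)
    · exact hx
    · rw [bpow_false, mul_one, mul_assoc, hG_sq, mul_one]
      exact hh.mul_right zG_zero_mem
    · have e : hG (n + 1) 0 * zG (n + 1) 0 * hG (n + 1) 0 * zG (n + 1) 0 * hG (n + 1) 0 =
          nG (n + 1) * zG (n + 1) 0 * hG (n + 1) 0 * zG (n + 1) 0 := by
        have h4 := hz_pow_four (n := n + 1) (i := 0) (by omega)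
        have := congrArg (fun x => nG (n + 1) * x * hG (n + 1) 0) h4
        simp only [mul_assoc, mul_self_cancel_left (nG_sq (n := n + 1)), hG_sq, mul_one] at this ⊢
        exact this.symm
      rw [bpow_true, e]
      exact (hh.mul_left (mul_mem (nG_eq_below (n := n) ▸ below_mem _) zG_zero_mem)).mul_right
        zG_zero_mem

theorem ctlSite_ctlSite {j l : ℕ} (hj : j + 1 < n) (hl : l + 1 < n) (h : j ≠ l)
    (a b : Bool × Bool) : Commute (ctlSite n 0 j a) (ctlSite n 0 l b) := by
  have h1 : Commute (farG n 0 j) (ctlSite n 0 l b) :=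
    (ctlSite_commute (farG_farG (by omega) (by omega))
      (farG_hG (by omega) (by omega) (by omega)).symm b).symm
  exact ctlSite_commute h1 (ctlSite_hG (by omega) (by omega) (by omega) b).symm a

theorem swG_mul_ctlSite {j : ℕ} (hj : j + 2 < n) (a : Bool × Bool) :
    swG n 0 * ctlSite n 0 (j + 1) a = ctlSite n 1 j a * swG n 0 := by
  have e : MulAut.conj (swG n 0) (ctlSite n 1 j a) = ctlSite n 0 (j + 1) a := by
    have e1 := conj_swG_farG (n := n) (i := 0) (by omega) j
    have e2 := conj_swG_farX (n := n) (i := 0) (j := j) (by omega)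
    obtain ⟨a, b⟩ := a
    rw [zero_add] at e1 e2
    cases a <;> cases b <;> simp [ctlSite, e1, e2, -MulAut.conj_apply]
  rw [← e, MulAut.conj_apply, swG_inv (by omega), ← mul_assoc, ← mul_assoc, swG_sq (by omega),
    one_mul]

/-- The swap changes the control from wire `0` to wire `1`, which moves every factor with a target
below wire `1` into `topStab`. The factor with target wire `1` meets both swapped wires and is split
off at the right end. -/
theorem exists_swG_mul_siteProd {m : ℕ} (hm : m < n) (f : ℕ → Bool × Bool) :
    ∃ r r', r' ∈ topStab n ∧ siteProd (ctlSite (n + 1) 0) (m + 1) f =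
      r * ctlSite (n + 1) 0 0 (f 0) ∧ swG (n + 1) 0 * r = r' * swG (n + 1) 0 := by
  induction m with
  | zero => exact ⟨1, 1, one_mem _, by simp [siteProd], by simp⟩
  | succ m ih =>
    obtain ⟨r, r', h1, h2, h3⟩ := ih (by omega)
    refine ⟨r * ctlSite (n + 1) 0 (m + 1) (f (m + 1)), r' * ctlSite (n + 1) 1 m (f (m + 1)),
      mul_mem h1 (ctlSite_one_mem _ _), ?_, ?_⟩
    · rw [siteProd, h2, mul_assoc, mul_assoc,
        (ctlSite_ctlSite (by omega) (by omega) (by omega) _ _).eq]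
    · rw [← mul_assoc, h3, mul_assoc, swG_mul_ctlSite (by omega), mul_assoc]

/-- Only the letter on wire `1` needs attention. Its `Z` part commutes with the swap; for its `X`
part, writing the swap as three controlled gates cancels one of them and leaves one `H` on the top
wire between members of `topStab`. -/
theorem inCells_swG_mul (hn : 0 < n) (p : PauliString) :
    InCells (swG (n + 1) 0 * ctlG (n + 1) n p * hG (n + 1) 0) := by
  obtain ⟨m, rfl⟩ : ∃ m, n = m + 1 := ⟨n - 1, by omega⟩
  have T := twoWire (n := m + 1 + 1) (i := 0) (by omega)
  obtain ⟨r, r', h1, h2, h3⟩ := exists_swG_mul_siteProd (n := m + 1) (m := m) (by omega) p.2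
  have hs : ∀ b, swG (m + 1 + 1) 0 * bpow (zG (m + 1 + 1) 0) b =
      bpow (zG (m + 1 + 1) 1) b * swG (m + 1 + 1) 0 := by
    intro b
    cases b
    · simp
    · exact T.swap_mul_z₀
  have hk : ∀ b, swG (m + 1 + 1) 0 * bpow (kG (m + 1 + 1) 0) b =
      bpow (kG (m + 1 + 1) 0) b * swG (m + 1 + 1) 0 := by
    intro b
    cases b
    · simp
    · exact T.swap_mul_k
  have e : swG (m + 1 + 1) 0 * ctlG (m + 1 + 1) (m + 1) p * hG (m + 1 + 1) 0 =
      (bpow (zG (m + 1 + 1) 1) p.1 * r' * bpow (kG (m + 1 + 1) 0) (p.2 0).2) *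
        (swG (m + 1 + 1) 0 * bpow (farX (m + 1 + 1) 0 0) (p.2 0).1 * hG (m + 1 + 1) 0) := by
    rw [ctlG, h2, ctlSite, farG]
    simp only [mul_assoc, mul_left_extend (hs _), mul_left_extend h3, mul_left_extend (hk _)]
  rw [e]
  refine InCells.mul_left ?_ (mul_mem (mul_mem (bpow_mem (zG_mem 1) _) h1)
    (bpow_mem kG_zero_mem _))
  cases (p.2 0).1
  · rw [bpow_false, mul_one]
    have := T.swap_mul_h₀
    change swG (m + 1 + 1) 0 * hG (m + 1 + 1) 0 = hG (m + 1 + 1) (0 + 1) * swG (m + 1 + 1) 0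
      at this
    rw [this]
    exact (IsCellRep.swap hn).inCells.mul_left (hG_succ_mem _)
  · have : swG (m + 1 + 1) 0 * bpow (farX (m + 1 + 1) 0 0) true * hG (m + 1 + 1) 0 =
        farX (m + 1 + 1) 0 0 * hG (m + 1 + 1) 0 * kG (m + 1 + 1) 0 := by
      have h := T.swap_eq₁
      have aa := farX_sq (n := m + 1 + 1) (i := 0) (j := 0) (by omega)
      change swG (m + 1 + 1) 0 = farX (m + 1 + 1) 0 0 * _ * farX (m + 1 + 1) 0 0 at h
      rw [h, bpow_true]
      simp only [mul_assoc, mul_self_cancel_left aa, hG_sq, mul_one]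
    rw [this]
    exact (IsCellRep.h.inCells.mul_left farX_zero_mem).mul_right kG_zero_mem

/-- `H` on the top wire is the only generator outside the obvious members of `topStab`, so this
closure property suffices to cover the group. -/
theorem InCells.mul_hG {x : CircuitGroup (n + 1)} (hx : InCells x) :
    InCells (x * hG (n + 1) 0) := by
  obtain ⟨t, ht, q, hq, q', hq', rfl⟩ := hx
  rw [mul_assoc, mul_assoc]
  refine InCells.mul_left ?_ hq
  have hrep : ∀ t, t = hG (n + 1) 0 ∨ t = hG (n + 1) 0 * zG (n + 1) 0 * hG (n + 1) 0 →
      InCells (t * (q' * hG (n + 1) 0)) := by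
    intro t ht
    obtain ⟨C, p, rfl⟩ := exists_below_mul_ctlG hq'
    have comm : t * below C = below C * t := by
      rcases ht with rfl | rfl
      · exact hG_zero_below C
      · exact ((hG_zero_below C).mul_left (zG_zero_below C)).mul_left (hG_zero_below C)
    have := (inCells_rep_mul ht p).mul_left (below_mem C)
    simpa only [mul_assoc, mul_left_extend comm] using this
  cases ht with
  | one =>
    rw [one_mul]
    exact IsCellRep.h.inCells.mul_left hq'
  | x => exact hrep _ (.inr rfl)
  | h => exact hrep _ (.inl rfl)
  | swap hn =>
    obtain ⟨C, p, rfl⟩ := exists_ctlG_mul_below hq'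
    have := (inCells_swG_mul hn p).mul_right (below_mem C)
    rw [mul_assoc _ (below C), ← (hG_zero_below C).eq]
    simpa only [mul_assoc] using this

theorem inCells (x : CircuitGroup (n + 1)) : InCells x := by
  obtain ⟨C, rfl⟩ := exists_cls x
  suffices H : ∀ l : List (Gate (n + 1)), InCells (cls (circ l)) from H C.toList
  intro l
  induction l using List.reverseRecOn with
  | nil =>
    rw [show circ ([] : List (Gate (n + 1))) = 1 from rfl, cls_one]
    exact inCells_of_mem (one_mem _)
  | append_singleton l g ih =>
    rw [show circ (l ++ [g]) = circ l * FreeMonoid.of g from rfl, cls_mul]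
    cases g with
    | neg => exact ih.mul_right (below_mem (FreeMonoid.of .neg))
    | H i =>
      rw [cls_of_H]
      refine Fin.cases ?_ (fun i => ?_) i
      · exact ih.mul_hG
      · exact ih.mul_right (hG_succ_mem _)
    | Z i => rw [cls_of_Z]; exact ih.mul_right (zG_mem _)
    | CZ i hi => rw [cls_of_CZ]; exact ih.mul_right (kG_mem _)

end Closure

/-! ### Circuits that act trivially -/

section Faithful

variable {n : ℕ}

theorem gate_place_place {a b c : ℕ} (k l : ℕ) (h : k + a ≤ b) (h' : l + b ≤ c) (g : Gate a) :
    (g.place k h).place l h' = g.place (l + k) (by omega) := by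
  cases g <;> simp [Gate.place, add_assoc]

theorem place_place {a b c : ℕ} (k l : ℕ) (h : k + a ≤ b) (h' : l + b ≤ c) (C : Circuit a) :
    (C.place k h).place l h' = C.place (l + k) (by omega) := by
  induction C using FreeMonoid.inductionOn' with
  | one => simp
  | of_mul g C ih =>
    rw [map_mul, map_mul, map_mul, ih]
    congr 1
    exact congrArg FreeMonoid.of (gate_place_place k l h h' g)

theorem wires_place {m : ℕ} (k : ℕ) (h : k + m ≤ n) (g : Gate m) :
    (g.place k h).wires = (k + ·) '' g.wires := by
  cases g <;> simp [Gate.place, Gate.wires, Set.image_pair, add_assoc]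

theorem circuitRel_place {m : ℕ} (k : ℕ) (h : k + m ≤ n) {C D : Circuit m}
    (hCD : CircuitRel m C D) : CircuitRel n (C.place k h) (D.place k h) := by
  cases hCD with
  | reduced huv l hl =>
    rw [place_place, place_place]
    exact .reduced huv _ _
  | slide g g' hd =>
    refine .slide (g.place k h) (g'.place k h) ?_
    rw [wires_place, wires_place]
    exact (Set.disjoint_image_iff (add_right_injective k)).2 hd

theorem cls_place_eq {m : ℕ} (k : ℕ) (h : k + m ≤ n) {C D : Circuit m} (hCD : cls C = cls D) :
    cls (C.place k h) = cls (D.place k h) := by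
  have hle : conGen (CircuitRel m) ≤
      Con.ker ((PresentedMonoid.mk (CircuitRel n)).comp (Circuit.place k h)) :=
    Con.conGen_le.2 fun C D h' => cls_eq_of_rel (circuitRel_place k h h')
  exact hle (cls_eq_iff.1 hCD)

theorem actG_topStab {q : CircuitGroup (n + 1)} (hq : q ∈ topStab n) :
    actG q (letterAt 0 (false, true)) = letterAt 0 (false, true) := by
  induction hq using Submonoid.closure_induction with
  | one => exact actG_one _
  | mul x y _ _ hx hy => rw [actG_mul, hx, hy]
  | mem x hx =>
    rcases hx with (rfl | rfl) | ⟨C, rfl⟩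
    · rw [actG_zG (by omega)]
      rfl
    · by_cases h : 0 + 1 < n + 1
      · rw [actG_kG h]
        refine Prod.ext rfl (funext fun i => ?_)
        simp only [letterAt, Function.update_apply]
        split_ifs <;> simp_all
      · rw [kG, dif_neg h, actG_one]
    · rw [actG_cls, act_place_letterAt]

/-- The other three representatives send `Z` on the top wire to `-Z`, to `X`, and to `Z` on the next
wire. -/
theorem actG_cellRep {t : CircuitGroup (n + 1)} (ht : IsCellRep n t)
    (h : actG t (letterAt 0 (false, true)) = letterAt 0 (false, true)) : t = 1 := by
  cases ht with
  | one => rfl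
  | x =>
    rw [actG_mul, actG_mul, actG_hG (by omega), actG_zG (by omega), actG_hG (by omega)] at h
    have := congrArg Prod.fst h
    simp [letterAt] at this
  | h =>
    rw [actG_hG (by omega)] at h
    have := congrFun (congrArg Prod.snd h) 0
    simp [letterAt] at this
  | swap hn =>
    rw [actG_swG (by omega)] at h
    have := congrFun (congrArg Prod.snd h) 0
    simp [letterAt] at this

/-- The outer factors of the double coset fix `Z` on the top wire, so the representative between
them does too and must be `1`. -/
theorem mem_topStab_of_actG {x : CircuitGroup (n + 1)}
    (h : actG x (letterAt 0 (false, true)) = letterAt 0 (false, true)) : x ∈ topStab n := by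
  obtain ⟨t, ht, q, hq, q', hq', rfl⟩ := inCells x
  rw [actG_mul, actG_mul, actG_topStab hq] at h
  have := actG_injective q' (h.trans (actG_topStab hq').symm)
  rw [actG_cellRep ht this, mul_one]
  exact mul_mem hq hq'

/-- `X` on the control is multiplied by the controlled string, so being fixed forces all letters to
vanish; after that only the sign could still act. -/
theorem ctlG_eq_one {p : PauliString}
    (h : actG (ctlG (n + 1) n p) (letterAt 0 (true, false)) = letterAt 0 (true, false)) :
    ctlG (n + 1) n p = 1 := by
  have hb : (actG (bpow (zG (n + 1) 0) p.1) (letterAt 0 (true, false))) =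
      (p.1, (letterAt 0 (true, false)).2) := by
    cases p.1
    · exact actG_one _
    · rw [bpow_true, actG_zG (by omega)]
      simp [letterAt]
  rw [ctlG, actG_mul, hb] at h
  obtain ⟨-, h2, -⟩ := actG_siteProd (n := n + 1) (m := n) (by omega) p.2
    (p.1, (letterAt 0 (true, false)).2) (by simp [letterAt])
  rw [h] at h2
  have h3 : ∀ j < n, p.2 j = (false, false) := by
    intro j hj
    have := h2 j hj
    rw [show (letterAt 0 (true, false)).2 (j + 1) = (false, false) by simp [letterAt],
      Bool.false_xor, Bool.false_xor] at this
    exact this.symm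
  rw [siteProd_trivial h3, actG_one] at h
  have h4 : p.1 = false := congrArg Prod.fst h
  rw [ctlG, siteProd_trivial h3, h4, bpow_false, one_mul]

/-- Fixing `Z` on the top wire gives membership in `topStab`, fixing `X` there removes the
controlled string, and the remaining circuit has one wire less and again acts trivially. -/
theorem cls_eq_one_or_neg (C : Circuit n) (h : ∀ p, C.act p = p) :
    cls C = 1 ∨ cls C = nG n := by
  induction n with
  | zero =>
    clear h
    induction C using FreeMonoid.inductionOn' with
    | one => exact .inl cls_one
    | of_mul g C ih =>
      rw [cls_mul]
      cases g with
      | neg =>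
        rw [cls_of_neg]
        rcases ih with ih | ih <;> rw [ih]
        · exact .inr (mul_one _)
        · exact .inl nG_sq
      | H i => exact i.elim0
      | Z i => exact i.elim0
      | CZ i hi => omega
  | succ n ih =>
    have hx : cls C ∈ topStab n := mem_topStab_of_actG (by rw [actG_cls, h])
    obtain ⟨D, p, hD⟩ := exists_below_mul_ctlG hx
    have h1 : ctlG (n + 1) n p = 1 := by
      refine ctlG_eq_one ?_
      have := h (letterAt 0 (true, false))
      rwa [← actG_cls, hD, actG_mul, actG_cls, act_place_letterAt] at this
    rw [h1, mul_one] at hD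
    have hD' : ∀ q, D.act q = q := by
      intro q
      -- The string `q` is shifted down by one wire; truncated subtraction puts an arbitrary letter
      -- on wire `0`, where the shifted circuit does not act.
      have := act_eq_of_cls_eq hD (q.1, fun i => q.2 (i - 1))
      rw [h, act_place] at this
      simp only [Nat.add_sub_cancel_left] at this
      refine Prod.ext (congrArg Prod.fst this).symm (funext fun i => ?_)
      have := congrFun (congrArg Prod.snd this) (1 + i)
      simpa using this.symm
    rw [hD]
    rcases ih D hD' with e | e
    · left
      have := cls_place_eq 1 (show 1 + n ≤ n + 1 by omega) (C := D) (D := 1) (e.trans cls_one.symm)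
      rwa [map_one, cls_one] at this
    · right
      exact cls_place_eq 1 (show 1 + n ≤ n + 1 by omega) (C := D) (D := FreeMonoid.of .neg) 
        (e.trans cls_of_neg.symm)

/-- Two circuits with the same operator are equal in the presented group. -/
theorem cls_eq_of_operator_eq {C D : Circuit n} (h : C.operator = D.operator) :
    cls C = cls D := by
  obtain ⟨E, hE⟩ := exists_cls (cls D)⁻¹
  have hDE : cls (D * E) = 1 := by rw [cls_mul, hE, mul_inv_cancel]
  have op1 : (C * E).operator = 1 := by
    rw [operator_mul, h, ← operator_mul, operator_eq_of_cls_eq (hDE.trans cls_one.symm),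
      operator_one]
  have hact : ∀ p, (C * E).act p = p := by
    intro p
    rw [act_mul, act_eq_of_operator_eq h, ← act_mul, act_eq_of_cls_eq (hDE.trans cls_one.symm),
      act_one]
  rcases cls_eq_one_or_neg (C * E) hact with e | e
  · rw [cls_mul, hE] at e
    exact mul_inv_eq_one.1 e
  -- Conjugation cannot detect the scalar `-1`, but the operator does.
  · exfalso
    have := operator_eq_of_cls_eq (e.trans cls_of_neg.symm)
    rw [op1, operator_of] at this
    have := congrFun (congrFun this 0) 0
    simp [Gate.operator] at this
    norm_num at this

end Faithful
/-! ### The action of `X`-circuits -/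

section XCircuits

variable {n : ℕ}

theorem letterAt_shift (n : ℕ) (a : Bool × Bool) :
    ((letterAt (n + 1) a).1, fun i => (letterAt (n + 1) a).2 (1 + i)) = letterAt n a := by
  refine Prod.ext rfl (funext fun i => ?_)
  simp [letterAt, Function.update_apply, add_comm]

theorem XCircuit.circuit_succ (M : XCircuit (n + 1)) :
    M.circuit = Circuit.place 0 (show 0 + 2 ≤ n + 1 + 1 by omega) (M.d 0).circuit *
      Circuit.place 1 (show 1 + (n + 1) ≤ n + 1 + 1 by omega)
        (XCircuit.circuit ⟨fun i => M.d i.succ, M.e⟩) := by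
  rw [XCircuit.circuit, XCircuit.circuit, List.ofFn_succ, List.prod_cons, map_mul, map_list_prod,
    List.map_ofFn, mul_assoc]
  congr 1
  congr 1
  · congr 2
    funext i
    simp only [Function.comp_apply, place_place, Fin.val_succ]
    congr 2
    omega
  · rw [place_place]
    congr 2
    omega

theorem DGate.actTwo_Z (d : DGate) :
    d.circuit.actTwo (false, (false, true), (false, false)) =
      (false, (false, false), (false, true)) := by
  cases d <;> rfl

/-- The letter on the lower wire that determines a gate of kind `D`. -/
def DGate.label : DGate → Bool × Bool
  | .D1 => (false, false)
  | .D2 => (true, false)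
  | .D3 => (false, true)
  | .D4 => (true, true)

theorem DGate.label_injective : Function.Injective DGate.label := by
  intro d d' h
  cases d <;> cases d' <;> first | rfl | exact absurd h (by decide)

/-- The four gates correspond to the four letters on the lower wire. Each clears the upper wire and
passes the `X` part on downwards; the sign is untouched and left to the gate of kind `E`. -/
theorem exists_DGate (s : Bool) (a b : Bool × Bool) (ha : a.1 = true) :
    ∃ (d : DGate) (z : Bool), d.circuit.actTwo (s, a, b) = (s, (false, false), (true, z)) := by
  obtain ⟨x, z⟩ := a
  obtain rfl : x = true := ha
  obtain ⟨x, w⟩ := b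
  cases x <;> cases w
  · exact ⟨.D1, z, by revert s z; decide⟩
  · exact ⟨.D3, z, by revert s z; decide⟩
  · exact ⟨.D2, z, by revert s z; decide⟩
  · exact ⟨.D4, !z, by revert s z; decide⟩

theorem DGate.eq_label (d : DGate) (s : Bool) (a b : Bool × Bool)
    (h1 : (d.circuit.actTwo (s, a, b)).2.1 = (false, false))
    (h2 : (d.circuit.actTwo (s, a, b)).2.2.1 = true) : a.1 = true ∧ b = d.label := by
  revert s a b
  cases d <;> decide

theorem XCircuit.act_Z (M : XCircuit n) :
    M.circuit.act (letterAt 0 (false, true)) = letterAt n (false, true) := by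
  induction n with
  | zero =>
    obtain ⟨d, e⟩ := M
    simp only [XCircuit.circuit, List.ofFn_zero, List.prod_nil, one_mul, act_place_one]
    cases e <;> simp [letterAt, EGate.circuit, Circuit.actOne, Gate.actOne]
  | succ n ih =>
    rw [M.circuit_succ, act_mul, act_place_two]
    have e : ((letterAt 0 (false, true)).1, (letterAt 0 (false, true)).2 0,
        (letterAt 0 (false, true)).2 (0 + 1)) = (false, (false, true), (false, false)) := by
      simp [letterAt]
    rw [e, DGate.actTwo_Z]
    have e' : ((false, Function.update (Function.update (letterAt 0 (false, true)).2 0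
        (false, false)) (0 + 1) (false, true)) : PauliString) = letterAt 1 (false, true) := by
      refine Prod.ext rfl (funext fun i => ?_)
      simp only [letterAt, Function.update_apply]
      split_ifs <;> simp_all
    dsimp only
    rw [e', act_place, letterAt_shift, ih, ← letterAt_shift]
    refine Prod.ext rfl (funext fun i => ?_)
    dsimp only
    split_ifs with h
    · simp [letterAt, show i = 0 by omega]
    · exact congrArg _ (by omega)

theorem exists_XCircuit (q : PauliString) (hq : (q.2 0).1 = true)
    (hq' : ∀ i, n < i → q.2 i = (false, false)) :
    ∃ (M : XCircuit n) (z : Bool), M.circuit.act q = letterAt n (true, z) := by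
  induction n generalizing q with
  | zero =>
    -- A final `Z` flips the sign, because the letter that arrives has an `X` part.
    have hE : ∀ s, ∃ e : EGate, e.circuit.actOne (s, q.2 0) = (false, q.2 0) := by
      generalize q.2 0 = a at hq
      obtain ⟨x, z⟩ := a
      obtain rfl : x = true := hq
      intro s
      cases s
      · exact ⟨.E1, by cases z <;> rfl⟩
      · exact ⟨.E2, by cases z <;> rfl⟩
    obtain ⟨e, he⟩ := hE q.1
    refine ⟨⟨fun _ => .D1, e⟩, (q.2 0).2, ?_⟩
    simp only [XCircuit.circuit, List.ofFn_zero, List.prod_nil, one_mul, act_place_one, he]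
    refine Prod.ext rfl (funext fun i => ?_)
    by_cases hi : i = 0
    · subst hi
      simp [letterAt, ← hq]
    · simp [letterAt, hi, hq' i (by omega)]
  | succ n ih =>
    obtain ⟨d, z₁, hd⟩ := exists_DGate q.1 (q.2 0) (q.2 1) hq
    obtain ⟨M, z, hM⟩ := ih (q.1, fun i => Function.update (Function.update q.2 0 (false, false)) 1
      (true, z₁) (1 + i)) (by simp) (fun i hi => by
        dsimp only
        rw [Function.update_of_ne (by omega), Function.update_of_ne (by omega), hq' _ (by omega)])
    refine ⟨⟨Fin.cons d M.d, M.e⟩, z, ?_⟩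
    rw [XCircuit.circuit_succ, act_mul, act_place_two]
    simp only [Fin.cons_zero, Fin.cons_succ, zero_add, hd]
    rw [act_place]
    dsimp only
    rw [hM, ← letterAt_shift]
    refine Prod.ext rfl (funext fun i => ?_)
    dsimp only
    split_ifs with h
    · simp [letterAt, show i = 0 by omega]
    · exact congrArg _ (by omega)

theorem XCircuit.act_succ {M : XCircuit (n + 1)} {q : PauliString} {a : Bool × Bool}
    (h : M.circuit.act q = letterAt (n + 1) a) :
    ((M.d 0).circuit.actTwo (q.1, q.2 0, q.2 1)).2.1 = (false, false) ∧
      (XCircuit.circuit ⟨fun i => M.d i.succ, M.e⟩).act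
        (((M.d 0).circuit.actTwo (q.1, q.2 0, q.2 1)).1,
          fun i => if i = 0 then ((M.d 0).circuit.actTwo (q.1, q.2 0, q.2 1)).2.2
            else q.2 (1 + i)) = letterAt n a := by
  rw [XCircuit.circuit_succ, act_mul, act_place_two, act_place] at h
  simp only [zero_add] at h
  have e : (fun i => Function.update (Function.update q.2 0
      ((M.d 0).circuit.actTwo (q.1, q.2 0, q.2 1)).2.1) 1
        ((M.d 0).circuit.actTwo (q.1, q.2 0, q.2 1)).2.2 (1 + i)) =
      fun i => if i = 0 then ((M.d 0).circuit.actTwo (q.1, q.2 0, q.2 1)).2.2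
            else q.2 (1 + i) := by
    funext i
    simp only [Function.update_apply]
    split_ifs <;> first | rfl | omega
  rw [e] at h
  refine ⟨?_, ?_⟩
  · have := congrFun (congrArg Prod.snd h) 0
    simpa [letterAt] using this
  · rw [← letterAt_shift, ← h]
    refine Prod.ext rfl (funext fun i => ?_)
    dsimp only
    rw [if_neg (by omega), Nat.add_sub_cancel_left]

theorem XCircuit.fst_eq_true {M : XCircuit n} {q : PauliString} {z : Bool}
    (h : M.circuit.act q = letterAt n (true, z)) : (q.2 0).1 = true := by
  induction n generalizing q with
  | zero =>
    simp only [XCircuit.circuit, List.ofFn_zero, List.prod_nil, one_mul, act_place_one] at h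
    have := congrFun (congrArg Prod.snd h) 0
    simp only [letterAt, Function.update_self] at this
    clear h
    generalize q.2 0 = a at this
    generalize q.1 = s at this
    generalize M.e = e at this
    revert s a z
    cases e <;> decide
  | succ n ih =>
    obtain ⟨h1, h2⟩ := XCircuit.act_succ h
    exact ((M.d 0).eq_label _ _ _ h1 (by simpa using ih h2)).1

theorem XCircuit.eq_of_act {M M' : XCircuit n} {q : PauliString} {z : Bool}
    (h : M.circuit.act q = letterAt n (true, z)) (h' : M'.circuit.act q = letterAt n (true, z)) :
    M = M' := by
  induction n generalizing q with
  | zero =>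
    obtain ⟨d, e⟩ := M
    obtain ⟨d', e'⟩ := M'
    have hx := XCircuit.fst_eq_true h
    obtain rfl : d = d' := Subsingleton.elim _ _
    simp only [XCircuit.circuit, List.ofFn_zero, List.prod_nil, one_mul, act_place_one] at h h'
    have := congrArg Prod.fst (h.trans h'.symm)
    dsimp only at this
    generalize q.2 0 = a at this hx
    generalize q.1 = s at this
    have hne : ∀ s a, a.1 = true → (EGate.circuit .E1 |>.actOne (s, a)).1 ≠
      (EGate.circuit .E2 |>.actOne (s, a)).1 := by decide
    cases e <;> cases e' <;> first | rfl | exact absurd this (hne _ _ hx) |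
      exact absurd this.symm (hne _ _ hx)
  | succ n ih =>
    obtain ⟨h1, h2⟩ := XCircuit.act_succ h
    obtain ⟨h1', h2'⟩ := XCircuit.act_succ h'
    have hd : M.d 0 = M'.d 0 := DGate.label_injective
      (((M.d 0).eq_label _ _ _ h1 (by simpa using XCircuit.fst_eq_true h2)).2.symm.trans
        ((M'.d 0).eq_label _ _ _ h1' (by simpa using XCircuit.fst_eq_true h2')).2)
    rw [← hd] at h2'
    have := ih h2 h2'
    obtain ⟨d, e⟩ := M
    obtain ⟨d', e'⟩ := M'
    simp only [XCircuit.mk.injEq] at this ⊢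
    refine ⟨funext fun i => ?_, this.2⟩
    refine Fin.cases hd (fun i => congrFun this.1 i) i

end XCircuits

/-! ### The action of `Z`-circuits -/

section ZCircuits

variable {n : ℕ}

/-- The letter on the upper wire that determines a gate of kind `B` with given input type. -/
def BGate.label {s t : WireType} : BGate s t → Bool × Bool
  | .B1 | .B5 => (false, false)
  | .B2 | .B6 => (true, false)
  | .B3 | .B7 => (false, true)
  | .B4 | .B8 => (true, true)

/-- The backward reading of a gate: its action is injective on signed pairs of letters, so a cleared
lower wire together with the letter of the output type determines both input letters. -/
theorem BGate.eq_label {u t : WireType} (b : BGate u t) (s : Bool) (a c : Bool × Bool)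
    (h : (b.circuit.actTwo (s, a, c)).2 = (t.letter, (false, false))) :
    (b.circuit.actTwo (s, a, c)).1 = s ∧ a = b.label ∧ c = u.letter := by
  revert s a c
  cases b <;> decide

theorem AGate.eq_letter {t : WireType} (g : AGate t) (s : Bool) (a : Bool × Bool)
    (h : (g.circuit.actOne (s, a)).2 = t.letter) :
    (g.circuit.actOne (s, a)).1 = s ∧ a ≠ (false, false) := by
  revert s a
  cases g <;> decide

/-- The ladder is traced back from its output. The later gates do not touch wire `k + 1`, so its
vanishing letter was already produced by the first gate, to which `BGate.eq_label` applies. -/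
theorem BLadder.act_eq {k : ℕ} {t : WireType} (r : BLadder k t) (hk : k < n) {q : PauliString}
    (h0 : ((r.circuit hk).act q).2 0 = (false, true))
    (h1 : ∀ i, 0 < i → i ≤ k → ((r.circuit hk).act q).2 i = (false, false)) :
    q.2 k = t.letter ∧ ((r.circuit hk).act q).1 = q.1 ∧
      ∀ i, k < i → ((r.circuit hk).act q).2 i = q.2 i := by
  induction r generalizing q with
  | nil => exact ⟨h0, rfl, fun _ _ => rfl⟩
  | @cons k s t b r ih =>
    rw [BLadder.circuit, act_mul] at h0 h1 ⊢
    obtain ⟨e1, e2, e3⟩ := ih (by omega) h0 (fun i hi hik => h1 i hi (by omega))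
    have e4 := e3 (k + 1) (by omega)
    rw [h1 (k + 1) (by omega) le_rfl] at e4
    rw [act_place_two] at e1 e4
    simp only [Function.update_self, Function.update_of_ne (show k ≠ k + 1 by omega)] at e1 e4
    obtain ⟨l1, l2, l3⟩ := b.eq_label _ _ _ (Prod.ext e1 e4.symm)
    refine ⟨l3, ?_, fun i hi => ?_⟩
    · rw [e2, act_place_two, l1]
    · rw [e3 i (by omega), act_place_two]
      dsimp only
      rw [Function.update_of_ne (by omega), Function.update_of_ne (by omega)]

theorem BLadder.eq_of_act {k : ℕ} {t : WireType} (r r' : BLadder k t) (hk : k < n)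
    {q : PauliString}
    (h0 : ((r.circuit hk).act q).2 0 = (false, true))
    (h1 : ∀ i, 0 < i → i ≤ k → ((r.circuit hk).act q).2 i = (false, false))
    (h0' : ((r'.circuit hk).act q).2 0 = (false, true))
    (h1' : ∀ i, 0 < i → i ≤ k → ((r'.circuit hk).act q).2 i = (false, false)) : r = r' := by
  induction r generalizing q with
  | nil =>
    cases r'
    rfl
  | @cons k s t b r ih =>
    cases r' with
    | @cons _ _ t' b' r' =>
    have head : ∀ {u} (b : BGate s u) (r : BLadder k u)
        (_ : (((r.cons b).circuit hk).act q).2 0 = (false, true))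
        (_ : ∀ i, 0 < i → i ≤ k + 1 → (((r.cons b).circuit hk).act q).2 i = (false, false)),
        q.2 k = b.label := by
      intro u b r h0 h1
      rw [BLadder.circuit, act_mul] at h0 h1
      obtain ⟨e1, -, e3⟩ := r.act_eq (by omega) h0 (fun i hi hik => h1 i hi (by omega))
      have e4 := e3 (k + 1) (by omega)
      rw [h1 (k + 1) (by omega) le_rfl] at e4
      rw [act_place_two] at e1 e4
      simp only [Function.update_self, Function.update_of_ne (show k ≠ k + 1 by omega)] at e1 e4
      exact (b.eq_label _ _ _ (Prod.ext e1 e4.symm)).2.1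
    have hl : b.label = b'.label := (head b r h0 h1).symm.trans (head b' r' h0' h1')
    -- The label determines the gate together with its output type once the input type is fixed, so
    -- the types are identified before the gates can be compared.
    have hb : ∃ e : t' = t, e ▸ b' = b := by
      clear * - hl
      cases b <;> cases b' <;> first | exact ⟨rfl, rfl⟩ | exact absurd hl (by decide)
    obtain ⟨rfl, rfl⟩ := hb
    rw [BLadder.circuit, act_mul] at h0 h1 h0' h1'
    rw [ih r' (by omega) h0 (fun i hi hik => h1 i hi (by omega)) h0'
      (fun i hi hik => h1' i hi (by omega))]

theorem ZCircuit.act_eq {L : ZCircuit n} {p : PauliString}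
    (h : L.circuit.act p = letterAt 0 (false, true)) :
    let q := (Circuit.place (L.k : ℕ) (show (L.k : ℕ) + 1 ≤ n from L.k.isLt) L.a.circuit).act p
    (((L.b.circuit L.k.isLt).act q).2 0 = (false, true) ∧
      ∀ i, 0 < i → i ≤ (L.k : ℕ) → ((L.b.circuit L.k.isLt).act q).2 i = (false, false)) ∧
    (L.a.circuit.actOne (p.1, p.2 L.k)).2 = L.t.letter ∧
    (∀ i, (L.k : ℕ) < i → p.2 i = (false, false)) ∧
    L.c.circuit.actOne (p.1, (false, true)) = (false, (false, true)) := by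
  intro q
  have hC : ∀ (c : CGate) s a, c.circuit.actOne (s, a) = (false, (false, true)) →
      a = (false, true) := by
    intro c
    cases c <;> decide
  rw [ZCircuit.circuit, act_mul, act_mul] at h
  change (Circuit.place 0 _ L.c.circuit).act ((L.b.circuit L.k.isLt).act q) = _ at h
  rw [act_place_one] at h
  have c1 := congrArg Prod.fst h
  have c2 := congrArg Prod.snd h
  dsimp only at c1 c2
  have c3 := congrFun c2 0
  rw [Function.update_self] at c3
  have c4 := Prod.ext (x := L.c.circuit.actOne _) (y := (false, (false, true))) c1
    (by simpa [letterAt] using c3)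
  have h0 := hC _ _ _ c4
  have hi : ∀ i, 0 < i → ((L.b.circuit L.k.isLt).act q).2 i = (false, false) := by
    intro i hi
    have := congrFun c2 i
    simpa [letterAt, Function.update_of_ne hi.ne'] using this
  obtain ⟨e1, e2, e3⟩ := L.b.act_eq L.k.isLt h0 (fun i h _ => hi i h)
  have hq : q = _ := act_place_one (L.k : ℕ) (show (L.k : ℕ) + 1 ≤ n from L.k.isLt) L.a.circuit p
  have ea : (L.a.circuit.actOne (p.1, p.2 L.k)).2 = L.t.letter := by
    rw [hq] at e1
    simpa using e1
  refine ⟨⟨h0, fun i h _ => hi i h⟩, ea, fun i hik => ?_, ?_⟩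
  · have := e3 i hik
    rw [hi i (by omega), hq] at this
    dsimp only at this
    rw [Function.update_of_ne (by omega)] at this
    exact this.symm
  · rw [h0, e2, hq] at c4
    dsimp only at c4
    rwa [(L.a.eq_letter _ _ ea).1] at c4

/-- All data are visible in `p`: `k` is its lowest nontrivial wire, the gate of kind `A` reflects
the letter there, those of kind `B` the letters above, and that of kind `C` the sign. -/
theorem ZCircuit.eq_of_act {L L' : ZCircuit n} {p : PauliString}
    (h : L.circuit.act p = letterAt 0 (false, true))
    (h' : L'.circuit.act p = letterAt 0 (false, true)) : L = L' := by
  obtain ⟨⟨b1, b2⟩, a1, k1, c1⟩ := ZCircuit.act_eq h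
  obtain ⟨⟨b1', b2'⟩, a1', k1', c1'⟩ := ZCircuit.act_eq h'
  clear h h'
  obtain ⟨k, t, a, b, c⟩ := L
  obtain ⟨k', t', a', b', c'⟩ := L'
  dsimp only at *
  have hk : k = k' := by
    rcases lt_trichotomy k k' with h | h | h
    · exact absurd (k1 _ h) (a'.eq_letter _ _ a1').2
    · exact h
    · exact absurd (k1' _ h) (a.eq_letter _ _ a1).2
  subst hk
  have hA : ∃ e : t' = t, e ▸ a' = a := by
    clear * - a1 a1'
    generalize p.2 k = x at a1 a1'
    generalize p.1 = s at a1 a1'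
    cases a <;> cases a' <;> first | exact ⟨rfl, rfl⟩ | (exfalso; revert s x; decide)
  obtain ⟨rfl, rfl⟩ := hA
  have hB := b.eq_of_act b' k.isLt b1 b2 b1' b2'
  subst hB
  have hC : c = c' := by
    clear * - c1 c1'
    generalize p.1 = s at c1 c1'
    cases c <;> cases c' <;> first | rfl | (exfalso; revert s; decide)
  rw [hC]

end ZCircuits
/-! ### Uniqueness of normal forms -/

section Uniqueness

variable {n : ℕ}

theorem act_place_top (C : Circuit n) (p : PauliString) :
    (C.place 0 (show 0 + n ≤ n + 1 by omega)).act p = C.act p := by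
  rw [act_place]
  simp

theorem act_letterAt_of_le (C : Circuit n) (a : Bool × Bool) :
    C.act (letterAt n a) = letterAt n a := by
  have h : ∀ g : Gate n, g.act (letterAt n a) = letterAt n a := by
    intro g
    have e : ∀ i < n, (letterAt n a).2 i = (false, false) := fun i hi => by
      simp [letterAt, hi.ne]
    cases g with
    | neg => rfl
    | H i =>
      simp only [Gate.act, e i i.isLt]
      refine Prod.ext (by simp) ?_
      exact Function.update_eq_self_iff.2 (e i i.isLt).symm
    | Z i =>
      simp only [Gate.act, e i i.isLt]
      simp
    | CZ i hi =>
      simp only [Gate.act, e i (by omega), e (i + 1) hi]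
      refine Prod.ext (by simp) ?_
      dsimp only
      rw [show Function.update (letterAt n a).2 i (false, xor false false) = (letterAt n a).2 from
        Function.update_eq_self_iff.2 (e i (by omega)).symm]
      exact Function.update_eq_self_iff.2 (e (i + 1) hi).symm
  induction C using FreeMonoid.inductionOn' with
  | one => rfl
  | of_mul g C ih => rw [act_mul, act_of, h, ih]

theorem operator_mul_left_injective (C : Circuit n) {A B : Operator n}
    (h : C.operator * A = C.operator * B) : A = B := by
  have := congrArg (C.operator.transpose * ·) h
  simpa only [← mul_assoc, transpose_mul_operator, one_mul] using this

theorem normalCircuit_act {L : ZCircuit (n + 1)} {M : XCircuit n} {N : NormalCircuit n}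
    {p : PauliString} {a : Bool × Bool}
    (h : (NormalCircuit.cons L M N).circuit.act p = letterAt n a) :
    M.circuit.act (L.circuit.act p) = letterAt n a := by
  rw [NormalCircuit.circuit, act_mul, act_mul, act_place_top] at h
  exact act_injective N.circuit (h.trans (act_letterAt_of_le _ _).symm)

/-- The inner normal circuit does not touch the bottom wire. Hence the preimage of `Z` there is sent
to `Z` on the top wire by the Z-circuit, which is thereby determined; the preimage of `X` then
determines the X-circuit, and both cancel. -/
theorem normalCircuit_unique {N N' : NormalCircuit n}
    (h : N.circuit.operator = N'.circuit.operator) : N = N' := by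
  induction N with
  | scalar b =>
    cases N' with
    | scalar b' =>
      have h1 : (circ ([] : List (Gate 0))).operator = 1 := operator_one
      have h2 : (circ [(Gate.neg : Gate 0)]).operator = -1 := operator_of _
      have h3 : (1 : Operator 0) ≠ -1 := by
        intro h
        have := congrFun (congrFun h 0) 0
        simp at this
        norm_num at this
      cases b <;> cases b' <;> simp only [NormalCircuit.circuit, h1, h2] at h ⊢
      · exact absurd h h3
      · exact absurd h.symm h3
  | @cons n L M N ih =>
    cases N' with
    | cons L' M' N' =>
    have hact := act_eq_of_operator_eq h
    obtain ⟨p, hp⟩ := act_surjective (NormalCircuit.cons L M N).circuit (letterAt n (false, true))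
    have hL := act_injective _ ((normalCircuit_act hp).trans M.act_Z.symm)
    have hL' := act_injective _
      ((normalCircuit_act ((hact p).symm.trans hp)).trans M'.act_Z.symm)
    have e := ZCircuit.eq_of_act hL hL'
    subst e
    obtain ⟨q, hq⟩ := act_surjective (NormalCircuit.cons L M N).circuit (letterAt n (true, false))
    have e := XCircuit.eq_of_act (normalCircuit_act hq) (normalCircuit_act ((hact q).symm.trans hq))
    subst e
    rw [NormalCircuit.circuit, NormalCircuit.circuit, operator_mul,
      operator_mul (L.circuit * M.circuit), operator_place, operator_place] at h
    rw [ih (embed_injective _ _ (mul_operator_injective _ h))]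

end Uniqueness

/-! ### Existence of normal forms -/

section Existence

variable {n : ℕ}

/-- Conjugation by `U` maps Pauli operators to Pauli operators. -/
def NormalizesPaulis (U : Operator n) : Prop :=
  ∀ p, ∃ q, U * pauliOp n p = pauliOp n q * U

theorem NormalizesPaulis.mul {U V : Operator n} (hU : NormalizesPaulis U)
    (hV : NormalizesPaulis V) : NormalizesPaulis (U * V) := by
  intro p
  obtain ⟨q, hq⟩ := hV p
  obtain ⟨r, hr⟩ := hU q
  exact ⟨r, by rw [mul_assoc, hq, ← mul_assoc, hr, mul_assoc]⟩

theorem normalizesPaulis_operator (C : Circuit n) : NormalizesPaulis C.operator :=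
  fun p => ⟨C.act p, operator_mul_pauliOp C p⟩

theorem normalizesPaulis_transpose (C : Circuit n) : NormalizesPaulis C.operator.transpose := by
  intro p
  obtain ⟨q, rfl⟩ := act_surjective C p
  refine ⟨q, operator_mul_left_injective C (mul_operator_injective C ?_)⟩
  rw [mul_assoc, mul_assoc, mul_assoc, mul_assoc, transpose_mul_operator, mul_one,
    ← mul_assoc, operator_mul_transpose, one_mul, operator_mul_pauliOp]

/-- An orthogonal matrix that normalizes the Pauli operators. -/
structure IsClifford (U : Operator n) : Prop where
  mul_transpose : U * U.transpose = 1
  normalizes : NormalizesPaulis U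
  normalizes_transpose : NormalizesPaulis U.transpose

theorem isClifford_operator (C : Circuit n) : IsClifford C.operator :=
  ⟨operator_mul_transpose C, normalizesPaulis_operator C, normalizesPaulis_transpose C⟩

theorem IsClifford.mul {U V : Operator n} (hU : IsClifford U) (hV : IsClifford V) :
    IsClifford (U * V) := by
  refine ⟨?_, hU.normalizes.mul hV.normalizes, ?_⟩
  · rw [Matrix.transpose_mul, mul_assoc, ← mul_assoc V, hV.mul_transpose, one_mul,
      hU.mul_transpose]
  · rw [Matrix.transpose_mul]
    exact hV.normalizes_transpose.mul hU.normalizes_transpose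

theorem IsClifford.transpose {U : Operator n} (hU : IsClifford U) : IsClifford U.transpose :=
  ⟨by rw [Matrix.transpose_transpose]; exact mul_eq_one_comm.1 hU.mul_transpose,
    hU.normalizes_transpose, by rw [Matrix.transpose_transpose]; exact hU.normalizes⟩

theorem IsClifford.mul_right_injective {U A B : Operator n} (hU : IsClifford U)
    (h : A * U = B * U) : A = B := by
  have := congrArg (· * U.transpose) h
  simpa only [mul_assoc, hU.mul_transpose, mul_one] using this

theorem pauliOp_congr {p q : PauliString} (h1 : p.1 = q.1) (h2 : ∀ i < n, p.2 i = q.2 i) :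
    pauliOp n p = pauliOp n q := by
  rw [pauliOp, pauliOp, h1]
  congr 2
  funext i
  rw [h2 i i.isLt]

theorem pauliOp_letterAt (i : Fin n) (a : Bool × Bool) :
    pauliOp n (letterAt i a) = onQubit i (pauliMat a) := by
  rw [pauliOp, onQubit]
  simp only [letterAt, sgn, cond_false, Int.cast_one, one_smul]
  congr 1
  funext j
  simp only [Function.update_apply, Fin.val_inj]
  split_ifs
  · rfl
  · exact pauliMat_one

theorem pauliOp_trivial (s : Bool) :
    pauliOp n (s, fun _ => (false, false)) = (sgn s : ℝ) • 1 := by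
  rw [pauliOp]
  simp only [pauliMat_one, tensor_one]

/-- Every Pauli operator is the image of one under conjugation. -/
theorem IsClifford.exists_preimage {U : Operator n} (hU : IsClifford U) (p : PauliString) :
    ∃ q, (∀ i, n ≤ i → q.2 i = (false, false)) ∧ U * pauliOp n q = pauliOp n p * U := by
  obtain ⟨q, hq⟩ := hU.normalizes_transpose p
  -- Letters on absent wires are invisible to the operator but are part of the string on which
  -- circuits act, so they are made trivial.
  refine ⟨(q.1, fun i => if i < n then q.2 i else (false, false)), fun i hi => if_neg (by omega),
    ?_⟩
  rw [pauliOp_congr (p := (q.1, fun i => if i < n then q.2 i else (false, false))) (q := q) rfl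
    (fun i hi => if_pos hi)]
  have := congrArg (fun A => U * A * U) hq
  simp only [← mul_assoc, hU.mul_transpose, one_mul] at this
  rw [this, mul_assoc, mul_assoc, mul_eq_one_comm.1 hU.mul_transpose, mul_one]

theorem pauliX_mul_pauliMat (a : Bool × Bool) :
    pauliX * pauliMat a = (sgn a.2 : ℝ) • (pauliMat a * pauliX) := by
  obtain ⟨a, b⟩ := a
  ext i j
  cases a <;> cases b <;> fin_cases i <;> fin_cases j <;>
    simp [pauliMat, pauliEntry, pauliX, sgn, Matrix.mul_apply, Fin.sum_univ_two]

theorem onQubit_mul_pauliOp_self {i : Fin n} {M : Matrix (Fin 2) (Fin 2) ℝ} {p : PauliString}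
    {s : Bool} (h : M * pauliMat (p.2 i) = (sgn s : ℝ) • (pauliMat (p.2 i) * M)) :
    onQubit i M * pauliOp n p = pauliOp n (xor p.1 s, p.2) * onQubit i M := by
  rw [onQubit_mul_pauliOp h, Function.update_eq_self]

theorem eq_false_of_xor_eq_self {a b : Bool} (h : xor a b = a) : b = false := by
  revert a b
  decide

theorem fst_eq_false_of_commute {i : Fin n} {p : PauliString}
    (h : onQubit i pauliZ * pauliOp n p = pauliOp n p * onQubit i pauliZ) :
    (p.2 i).1 = false := by
  rw [onQubit_mul_pauliOp_self (pauliZ_mul_pauliMat _)] at h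
  have := congrArg (· * onQubit i pauliZ) h
  simp only [mul_assoc, onQubit_mul_onQubit, pauliZ_mul_self, onQubit_one, mul_one] at this
  exact eq_false_of_xor_eq_self (pauliOp_injective this).1

theorem snd_eq_false_of_commute {i : Fin n} {p : PauliString}
    (h : onQubit i pauliX * pauliOp n p = pauliOp n p * onQubit i pauliX) :
    (p.2 i).2 = false := by
  rw [onQubit_mul_pauliOp_self (pauliX_mul_pauliMat _)] at h
  have := congrArg (· * onQubit i pauliX) h
  simp only [mul_assoc, onQubit_mul_onQubit, pauliX_mul_self, onQubit_one, mul_one] at this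
  exact eq_false_of_xor_eq_self (pauliOp_injective this).1

theorem embed_pauliOp (p : PauliString) (hp : p.2 n = (false, false)) :
    embed 0 (show 0 + n ≤ n + 1 by omega) (pauliOp n p) = pauliOp (n + 1) p := by
  ext x y
  rw [embed_apply, pauliOp_apply, pauliOp_apply, Fin.prod_univ_castSucc]
  simp only [zero_add, Fin.val_castSucc, Fin.val_last, hp]
  have e : (pauliEntry (false, false) (x (Fin.last n)) (y (Fin.last n)) : ℝ) =
      if x (Fin.last n) = y (Fin.last n) then 1 else 0 := by
    simp [pauliEntry]
  rw [e]
  split_ifs with h1 h2 h2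
  · rw [mul_one]; rfl
  · exact absurd (h1 (Fin.last n) (by simp)) h2
  · refine absurd (fun i hi => ?_) h1
    obtain rfl : i = Fin.last n := Fin.ext (by simp; omega)
    exact h2
  · simp

theorem onQubit_pauliZ_mul_apply (i : Fin n) (A : Operator n) (x y : Fin n → Fin 2) :
    (onQubit i pauliZ * A) x y = (if x i = 1 then -1 else 1) * A x y := by
  rw [Matrix.mul_apply, Finset.sum_eq_single x]
  · rw [onQubit_apply, if_pos fun _ _ => rfl]
    generalize x i = u
    fin_cases u <;> simp [pauliZ]
  · intro z _ hz
    rw [onQubit_apply]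
    split_ifs with h
    · have : x i ≠ z i := fun h' => hz (funext fun l => by
        by_cases hl : l = i
        · subst hl; exact h'.symm
        · exact (h l hl).symm)
      generalize x i = u at this
      generalize z i = v at this
      fin_cases u <;> fin_cases v <;> simp_all [pauliZ]
    · simp
  · simp

theorem onQubit_pauliX_mul_apply (i : Fin n) (A : Operator n) (x y : Fin n → Fin 2) :
    (onQubit i pauliX * A) x y = A (Function.update x i (x i + 1)) y := by
  rw [Matrix.mul_apply, Finset.sum_eq_single (Function.update x i (x i + 1))]
  · rw [onQubit_apply, if_pos fun l hl => (Function.update_of_ne hl _ _).symm,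
      Function.update_self]
    generalize x i = u
    fin_cases u <;> simp [pauliX]
  · intro z _ hz
    rw [onQubit_apply]
    split_ifs with h
    · have : z i ≠ x i + 1 := fun h' => hz (funext fun l => by
        by_cases hl : l = i
        · subst hl; simpa using h'
        · rw [Function.update_of_ne hl]; exact (h l hl).symm)
      generalize x i = u at this
      generalize z i = v at this
      fin_cases u <;> fin_cases v <;> simp_all [pauliX]
    · simp
  · simp

theorem pauliX_transpose : pauliX.transpose = pauliX := by
  ext i j
  fin_cases i <;> fin_cases j <;> simp [pauliX]

/-- An operator that commutes with `Z` and `X` on the bottom wire acts on the other wires only. -/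
theorem exists_embed {W : Operator (n + 1)}
    (hZ : onQubit (Fin.last n) pauliZ * W = W * onQubit (Fin.last n) pauliZ)
    (hX : onQubit (Fin.last n) pauliX * W = W * onQubit (Fin.last n) pauliX) :
    ∃ V : Operator n, W = embed 0 (show 0 + n ≤ n + 1 by omega) V := by
  have tr : ∀ M : Matrix (Fin 2) (Fin 2) ℝ, M.transpose = M → ∀ x y,
      (W * onQubit (Fin.last n) M) x y = (onQubit (Fin.last n) M * W.transpose) y x := by
    intro M hM x y
    rw [← Matrix.transpose_apply (W * _), Matrix.transpose_mul, onQubit_transpose, hM]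
  -- Commuting with `Z` makes `W` block diagonal with respect to the last bit; commuting with `X`,
  -- in `h2`, makes the two blocks equal.
  have h1 : ∀ x y, x (Fin.last n) ≠ y (Fin.last n) → W x y = 0 := by
    intro x y hxy
    have := congrFun (congrFun hZ x) y
    rw [tr _ pauliZ_transpose, onQubit_pauliZ_mul_apply, onQubit_pauliZ_mul_apply,
      Matrix.transpose_apply] at this
    generalize x (Fin.last n) = u at hxy this
    generalize y (Fin.last n) = v at hxy this
    generalize W x y = w at this
    have h01 : ∀ u : Fin 2, u = 0 ∨ u = 1 := by decide
    rcases h01 u with rfl | rfl <;> rcases h01 v with rfl | rfl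
    · exact absurd rfl hxy
    · norm_num at this; linarith
    · norm_num at this; linarith
    · exact absurd rfl hxy
  have h2 : ∀ x y, W (Function.update x (Fin.last n) (x (Fin.last n) + 1))
      (Function.update y (Fin.last n) (y (Fin.last n) + 1)) = W x y := by
    intro x y
    have := congrFun (congrFun hX x) (Function.update y (Fin.last n) (y (Fin.last n) + 1))
    rw [tr _ pauliX_transpose, onQubit_pauliX_mul_apply, onQubit_pauliX_mul_apply,
      Matrix.transpose_apply] at this
    rw [this]
    congr 1
    have h11 : ∀ u : Fin 2, u + 1 + 1 = u := by decide
    simp [h11]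
  refine ⟨Matrix.of fun u v => W (Fin.snoc u 0) (Fin.snoc v 0), ?_⟩
  have snoc_init : ∀ x : Fin (n + 1) → Fin 2, Fin.snoc (fun i : Fin n => x ⟨0 + i, by omega⟩) 0 =
      (Function.update x (Fin.last n) 0 : Fin (n + 1) → Fin 2) := by
    intro x
    funext i
    refine Fin.lastCases ?_ (fun i => ?_) i
    · simp
    · rw [Fin.snoc_castSucc, Function.update_of_ne (Fin.castSucc_lt_last i).ne]
      exact congrArg x (Fin.ext (by simp))
  ext x y
  rw [embed_apply, Matrix.of_apply, snoc_init, snoc_init]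
  split_ifs with h
  · have hl := h (Fin.last n) (by simp)
    have h01 : ∀ u : Fin 2, u = 0 ∨ u + 1 = 0 := by decide
    rcases h01 (x (Fin.last n)) with h0 | h0
    · rw [show Function.update x (Fin.last n) 0 = x from Function.update_eq_self_iff.2 h0.symm,
        show Function.update y (Fin.last n) 0 = y from
          Function.update_eq_self_iff.2 (h0.symm.trans hl)]
    · rw [← h2 x y, h0, ← hl, h0]
  · refine h1 x y fun h' => h fun i hi => ?_
    obtain rfl : i = Fin.last n := Fin.ext (by simp; omega)
    exact h'

theorem IsClifford.commute_iff {U P P' R R' : Operator n} (hU : IsClifford U)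
    (hP : U * P = P' * U) (hR : U * R = R' * U) : P * R = R * P ↔ P' * R' = R' * P' := by
  have e1 : U * (P * R) = P' * R' * U := by rw [← mul_assoc, hP, mul_assoc, hR, mul_assoc]
  have e2 : U * (R * P) = R' * P' * U := by rw [← mul_assoc, hR, mul_assoc, hP, mul_assoc]
  refine ⟨fun h => hU.mul_right_injective ?_, fun h => ?_⟩
  · rw [← e1, h, e2]
  · have := congrArg (U.transpose * ·) (e1.trans (h ▸ e2.symm))
    simpa only [← mul_assoc, mul_eq_one_comm.1 hU.mul_transpose, one_mul] using this

theorem IsClifford.sq_iff {U P P' : Operator n} (hU : IsClifford U)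
    (hP : U * P = P' * U) : P * P = 1 ↔ P' * P' = 1 := by
  have e1 : U * (P * P) = P' * P' * U := by rw [← mul_assoc, hP, mul_assoc, hP, mul_assoc]
  refine ⟨fun h => hU.mul_right_injective ?_, fun h => ?_⟩
  · rw [← e1, h, mul_one, one_mul]
  · rw [h, one_mul] at e1
    have := congrArg (U.transpose * ·) e1
    simpa only [← mul_assoc, mul_eq_one_comm.1 hU.mul_transpose, one_mul] using this

theorem letter_ne_Y {i : Fin n} {a : Bool × Bool}
    (h : pauliOp n (letterAt i a) * pauliOp n (letterAt i a) = 1) : a ≠ (true, true) := by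
  rintro rfl
  rw [pauliOp_letterAt, onQubit_mul_onQubit] at h
  have := congrFun (congrFun h 0) 0
  rw [onQubit_apply, if_pos fun _ _ => rfl, Matrix.one_apply_eq] at this
  simp [pauliMat, pauliEntry, Matrix.mul_apply, Fin.sum_univ_two] at this
  norm_num at this

theorem letterAt_sq {i : Fin n} {a : Bool × Bool} (ha : a ≠ (true, true)) :
    pauliOp n (letterAt i a) * pauliOp n (letterAt i a) = 1 := by
  have h : pauliMat a * pauliMat a = 1 := by
    obtain ⟨x, z⟩ := a
    cases x <;> cases z
    · rw [pauliMat_one, mul_one]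
    · rw [pauliMat_Z, pauliZ_mul_self]
    · rw [pauliMat_X, pauliX_mul_self]
    · exact absurd rfl ha
  rw [pauliOp_letterAt, onQubit_mul_onQubit, h, onQubit_one]

/-- The image of a Pauli on the upper wires commutes with `Z` and `X` on the bottom wire, so its
bottom letter is trivial and it comes from a Pauli on the upper wires. -/
theorem normalizesPaulis_of_embed {V : Operator n}
    (hW : IsClifford (embed 0 (show 0 + n ≤ n + 1 by omega) V))
    (hZ : onQubit (Fin.last n) pauliZ * embed 0 (show 0 + n ≤ n + 1 by omega) V =
      embed 0 (show 0 + n ≤ n + 1 by omega) V * onQubit (Fin.last n) pauliZ)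
    (hX : onQubit (Fin.last n) pauliX * embed 0 (show 0 + n ≤ n + 1 by omega) V =
      embed 0 (show 0 + n ≤ n + 1 by omega) V * onQubit (Fin.last n) pauliX) :
    NormalizesPaulis V := by
  intro p
  obtain ⟨q, hq⟩ := hW.normalizes (p.1, Function.update p.2 n (false, false))
  have q1 : (q.2 n).1 = false := fst_eq_false_of_commute (i := Fin.last n) (p := q)
    ((hW.commute_iff hZ.symm hq).1 (by
      rw [onQubit_mul_pauliOp_self (pauliZ_mul_pauliMat _)]
      simp))
  have q2 : (q.2 n).2 = false := snd_eq_false_of_commute (i := Fin.last n) (p := q)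
    ((hW.commute_iff hX.symm hq).1 (by
      rw [onQubit_mul_pauliOp_self (pauliX_mul_pauliMat _)]
      simp))
  have hp : pauliOp n (p.1, Function.update p.2 n (false, false)) = pauliOp n p :=
    pauliOp_congr rfl fun i hi => Function.update_of_ne (by omega) _ _
  rw [← embed_pauliOp _ (Function.update_self _ _ _), hp,
    ← embed_pauliOp q (Prod.ext q1 q2), ← embed_mul, ← embed_mul] at hq
  exact ⟨q, embed_injective _ _ hq⟩

theorem isClifford_of_embed {V : Operator n}
    (hW : IsClifford (embed 0 (show 0 + n ≤ n + 1 by omega) V))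
    (hZ : onQubit (Fin.last n) pauliZ * embed 0 (show 0 + n ≤ n + 1 by omega) V =
      embed 0 (show 0 + n ≤ n + 1 by omega) V * onQubit (Fin.last n) pauliZ)
    (hX : onQubit (Fin.last n) pauliX * embed 0 (show 0 + n ≤ n + 1 by omega) V =
      embed 0 (show 0 + n ≤ n + 1 by omega) V * onQubit (Fin.last n) pauliX) :
    IsClifford V := by
  refine ⟨embed_injective 0 (show 0 + n ≤ n + 1 by omega) ?_, normalizesPaulis_of_embed hW hZ hX,
    normalizesPaulis_of_embed ?_ ?_ ?_⟩
  · rw [embed_mul, ← embed_transpose, hW.mul_transpose, embed_one]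
  · rw [← embed_transpose]
    exact hW.transpose
  · have := congrArg Matrix.transpose hZ
    rw [Matrix.transpose_mul, Matrix.transpose_mul, onQubit_transpose, pauliZ_transpose,
      embed_transpose] at this
    exact this.symm
  · have := congrArg Matrix.transpose hX
    rw [Matrix.transpose_mul, Matrix.transpose_mul, onQubit_transpose, pauliX_transpose,
      embed_transpose] at this
    exact this.symm

/-- A `Z`-circuit and an `X`-circuit bring the preimages of `Z` and `X` on the bottom wire to the
bottom wire. -/
theorem IsClifford.exists_ZCircuit_XCircuit {U : Operator (n + 1)} (hU : IsClifford U) :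
    ∃ (L : ZCircuit (n + 1)) (M : XCircuit n) (p r : PauliString),
      (U * pauliOp (n + 1) p = onQubit (Fin.last n) pauliZ * U ∧
        (L.circuit * M.circuit).act p = letterAt n (false, true)) ∧
      (U * pauliOp (n + 1) r = onQubit (Fin.last n) pauliX * U ∧
        (L.circuit * M.circuit).act r = letterAt n (true, false)) := by
  obtain ⟨p, hp0, hp⟩ := hU.exists_preimage (letterAt (Fin.last n : ℕ) (false, true))
  obtain ⟨r, hr0, hr⟩ := hU.exists_preimage (letterAt (Fin.last n : ℕ) (true, false))
  have hne : ∃ i < n + 1, p.2 i ≠ (false, false) := by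
    by_contra! h
    rw [pauliOp_congr (p := p) (q := (p.1, fun _ => (false, false))) rfl h] at hp
    have e : U * pauliOp (n + 1) (p.1, fun _ => (false, false)) =
        pauliOp (n + 1) (p.1, fun _ => (false, false)) * U := by
      rw [pauliOp_trivial]
      simp
    have := (pauliOp_injective (hU.mul_right_injective (e.symm.trans hp))).2 n (by omega)
    simp [letterAt] at this
  obtain ⟨t, C, ⟨h1, h2, h3⟩, h4⟩ := exists_reduction p hne
  have hC : C.act p = letterAt ((0 : Fin (n + 1)) : ℕ) t.letter := by
    refine Prod.ext h1 (funext fun i => ?_)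
    rcases Nat.eq_zero_or_pos i with rfl | hi
    · simpa [letterAt] using h2
    · rw [show (letterAt ((0 : Fin (n + 1)) : ℕ) t.letter).2 i = (false, false) by
        simp [letterAt, hi.ne']]
      by_cases hin : i < n + 1
      · exact h3 i hi hin
      · rw [act_of_le C p (by omega), hp0 i (by omega)]
  -- Conjugation preserves squares: `Z` squares to `1` and `XZ` to `-1`, which excludes the double
  -- type at the end of the ladder.
  have sq := (hU.sq_iff hp).2 (letterAt_sq (by decide))
  have hCp := operator_mul_pauliOp C p
  rw [hC] at hCp
  have ht := letter_ne_Y (((isClifford_operator C).sq_iff hCp).1 sq)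
  have hts : t = .single := by
    cases t
    · rfl
    · exact absurd rfl ht
  subst hts
  obtain ⟨L, rfl⟩ := h4 rfl
  have hCr := operator_mul_pauliOp L.circuit r
  -- Without an `X` part on the top wire the image of `r` would commute with `Z` there. Then `p` and
  -- `r` would commute, and so would `Z` and `X` on the bottom wire.
  have hx : ((L.circuit.act r).2 0).1 = true := by
    by_contra hx
    rw [Bool.not_eq_true] at hx
    have c1 := ((isClifford_operator L.circuit).commute_iff hCp hCr).2 (by
      rw [pauliOp_letterAt, show pauliMat (WireType.letter .single) = pauliZ from pauliMat_Z,
        onQubit_mul_pauliOp_self (pauliZ_mul_pauliMat _)]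
      simp [hx])
    have c2 := (hU.commute_iff hp hr).1 c1
    rw [pauliOp_letterAt _ (false, true), pauliMat_Z] at c2
    have := fst_eq_false_of_commute c2
    simp [letterAt] at this
  obtain ⟨M, z, hM⟩ := exists_XCircuit (n := n) (L.circuit.act r) hx (fun i hi => by
    rw [act_of_le _ _ (by omega), hr0 i (by omega)])
  have hMr := operator_mul_pauliOp M.circuit (L.circuit.act r)
  rw [hM] at hMr
  have sq' := ((isClifford_operator _).sq_iff hMr).1
    (((isClifford_operator _).sq_iff hCr).1 ((hU.sq_iff hr).2 (letterAt_sq (by decide))))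
  have hz := letter_ne_Y (i := Fin.last n) sq'
  have hz' : z = false := by
    cases z
    · rfl
    · exact absurd rfl hz
  subst hz'
  rw [pauliOp_letterAt] at hp hr
  rw [pauliMat_Z] at hp
  rw [pauliMat_X] at hr
  refine ⟨L, M, p, r, ⟨hp, ?_⟩, hr, ?_⟩
  · rw [act_mul, hC]
    exact M.act_Z
  · rw [act_mul, hM]

theorem IsClifford.exists_normalCircuit {U : Operator n} (hU : IsClifford U) :
    ∃ N : NormalCircuit n, N.circuit.operator = U := by
  induction n with
  | zero =>
    have h : U 0 0 * U 0 0 = 1 := by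
      have h := congrFun (congrFun hU.mul_transpose 0) 0
      rw [Matrix.mul_apply, Fintype.sum_subsingleton _ (0 : Fin 0 → Fin 2), Matrix.transpose_apply,
        Matrix.one_apply_eq] at h
      exact h
    rcases mul_self_eq_one_iff.1 h with h | h
    · refine ⟨.scalar false, ?_⟩
      rw [show (NormalCircuit.scalar false).circuit = 1 from rfl, operator_one]
      ext x y
      rw [Subsingleton.elim x 0, Subsingleton.elim y 0, h]
      simp
    · refine ⟨.scalar true, ?_⟩
      rw [show (NormalCircuit.scalar true).circuit = FreeMonoid.of .neg from rfl, operator_of]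
      ext x y
      rw [Subsingleton.elim x 0, Subsingleton.elim y 0, h]
      simp [Gate.operator]
  | succ n ih =>
    obtain ⟨L, M, p, r, ⟨hp, hKp⟩, hr, hKr⟩ := hU.exists_ZCircuit_XCircuit
    set K := L.circuit * M.circuit
    -- `K` and `U` send `p` and `r` to the same Paulis on the bottom wire, so this quotient commutes
    -- with `Z` and `X` there.
    have hW : IsClifford (U * K.operator.transpose) := hU.mul (isClifford_operator K).transpose
    have hWK : U * K.operator.transpose * K.operator = U := by
      rw [mul_assoc, transpose_mul_operator, mul_one]
    have comm : ∀ {A : Operator (n + 1)} {q}, U * pauliOp (n + 1) q = A * U →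
        pauliOp (n + 1) (K.act q) = A →
        A * (U * K.operator.transpose) = U * K.operator.transpose * A := by
      intro A q h1 h2
      refine mul_operator_injective K ?_
      rw [mul_assoc, hWK, ← h1, mul_assoc _ A, ← h2, ← operator_mul_pauliOp, ← mul_assoc, hWK]
    have hZ := comm hp (by rw [hKp, ← pauliMat_Z]; exact pauliOp_letterAt (Fin.last n) _)
    have hX := comm hr (by rw [hKr, ← pauliMat_X]; exact pauliOp_letterAt (Fin.last n) _)
    obtain ⟨V, hV⟩ := exists_embed hZ hX
    rw [hV] at hW hZ hX hWK
    obtain ⟨N, hN⟩ := ih (isClifford_of_embed hW hZ hX)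
    refine ⟨.cons L M N, ?_⟩
    rw [NormalCircuit.circuit, operator_mul, operator_place, hN]
    exact hWK

end Existence
/-! ### The real Clifford group -/

section CliffordGroup

variable {n : ℕ}

theorem pauliOp_mul_transpose (p : PauliString) :
    pauliOp n p * (pauliOp n p).transpose = 1 := by
  have h : ∀ a, pauliMat a * (pauliMat a).transpose = 1 := by
    rintro ⟨x, z⟩
    ext i j
    cases x <;> cases z <;> fin_cases i <;> fin_cases j <;>
      simp [pauliMat, pauliEntry, Matrix.mul_apply, Fin.sum_univ_two]
  have h2 : (sgn p.1 : ℝ) * sgn p.1 = 1 := by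
    cases p.1 <;> simp [sgn]
  rw [pauliOp, Matrix.transpose_smul, tensor_transpose, Matrix.smul_mul, Matrix.mul_smul,
    tensor_mul, smul_smul, h2, one_smul]
  simp only [h, tensor_one]

theorem mem_pauliGroup_iff {U : Matrix.orthogonalGroup (Fin n → Fin 2) ℝ} :
    U ∈ pauliGroup n ↔ ∃ p, (U : Operator n) = pauliOp n p := by
  constructor
  · rintro ⟨P, hP, hU⟩
    have h : ∀ i, ∃ a, P i = pauliMat a := by
      intro i
      rcases hP i with h | h | h | h
      · exact ⟨_, h.trans pauliMat_one.symm⟩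
      · exact ⟨_, h.trans pauliMat_X.symm⟩
      · exact ⟨_, h.trans pauliMat_Z.symm⟩
      · exact ⟨_, h.trans pauliMat_Y.symm⟩
    choose a ha using h
    have e : ∀ s, pauliOp n (s, fun i => if h : i < n then a ⟨i, h⟩ else (false, false)) =
        (sgn s : ℝ) • tensor P := by
      intro s
      rw [pauliOp]
      congr 2
      funext i
      simp [ha]
    rcases hU with hU | hU
    · exact ⟨_, by rw [e false, hU]; simp [sgn]⟩
    · exact ⟨_, by rw [e true, hU]; simp [sgn]⟩
  · rintro ⟨p, hp⟩
    refine ⟨fun i => pauliMat (p.2 i), fun i => ?_, ?_⟩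
    · dsimp only
      generalize p.2 i = a
      obtain ⟨x, z⟩ := a
      cases x <;> cases z
      · exact .inl pauliMat_one
      · exact .inr (.inr (.inl pauliMat_Z))
      · exact .inr (.inl pauliMat_X)
      · exact .inr (.inr (.inr pauliMat_Y))
    · rw [hp, pauliOp]
      cases p.1
      · left; simp [sgn]
      · right; simp [sgn]

/-- Membership in a normalizer is an equivalence, whose two directions account for the conditions on
`U` and on its transpose. -/
theorem mem_cliffordGroup_iff {U : Matrix.orthogonalGroup (Fin n → Fin 2) ℝ} :
    U ∈ cliffordGroup n ↔ IsClifford (U : Operator n) := by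
  have h1 : (U : Operator n) * (U : Operator n).transpose = 1 :=
    (Matrix.mem_orthogonalGroup_iff _ _).1 U.2
  have h2 := mul_eq_one_comm.1 h1
  rw [cliffordGroup, Subgroup.mem_set_normalizer_iff]
  have conj : ∀ V : Matrix.orthogonalGroup (Fin n → Fin 2) ℝ,
      ((U * V * U⁻¹ : Matrix.orthogonalGroup (Fin n → Fin 2) ℝ) : Operator n) =
        U * V * (U : Operator n).transpose := fun V => rfl
  constructor
  · intro h
    refine ⟨h1, fun p => ?_, fun p => ?_⟩
    · obtain ⟨q, hq⟩ := mem_pauliGroup_iff.1 ((h ⟨pauliOp n p,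
        (Matrix.mem_orthogonalGroup_iff _ _).2 (pauliOp_mul_transpose p)⟩).1
          (mem_pauliGroup_iff.2 ⟨p, rfl⟩))
      refine ⟨q, ?_⟩
      rw [← hq, conj, mul_assoc _ _ (U : Operator n), h2, mul_one]
    · let P : Matrix.orthogonalGroup (Fin n → Fin 2) ℝ :=
        ⟨pauliOp n p, (Matrix.mem_orthogonalGroup_iff _ _).2 (pauliOp_mul_transpose p)⟩
      obtain ⟨q, hq⟩ := mem_pauliGroup_iff.1 ((h (U⁻¹ * P * U)).2
        (mem_pauliGroup_iff.2 ⟨p, by simp [mul_assoc, P]⟩))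
      refine ⟨q, ?_⟩
      rw [← hq]
      change _ = (U : Operator n).transpose * pauliOp n p * (U : Operator n) *
        (U : Operator n).transpose
      rw [mul_assoc _ (U : Operator n), h1, mul_one]
  · rintro ⟨-, hn, ht⟩ V
    rw [mem_pauliGroup_iff, mem_pauliGroup_iff, conj]
    constructor
    · rintro ⟨p, hp⟩
      obtain ⟨q, hq⟩ := hn p
      exact ⟨q, by rw [hp, hq, mul_assoc, h1, mul_one]⟩
    · rintro ⟨p, hp⟩
      obtain ⟨q, hq⟩ := ht p
      refine ⟨q, ?_⟩
      rw [← hp, mul_assoc, ← mul_assoc (U : Operator n).transpose, h2, one_mul] at hq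
      have := congrArg (· * (U : Operator n)) hq
      simpa only [mul_assoc, h2, mul_one] using this

/-- The operator of a gate as an element of the real Clifford group. -/
noncomputable def Gate.clifford (g : Gate n) : cliffordGroup n :=
  have h : IsClifford g.operator := operator_of g ▸ isClifford_operator (FreeMonoid.of g)
  ⟨⟨g.operator, (Matrix.mem_orthogonalGroup_iff _ _).2 h.mul_transpose⟩,
    mem_cliffordGroup_iff.2 h⟩

theorem lift_clifford (C : Circuit n) :
    (((FreeMonoid.lift (fun g : Gate n => MulOpposite.op g.clifford) C).unop :
      Matrix.orthogonalGroup (Fin n → Fin 2) ℝ) : Operator n) = C.operator := by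
  induction C using FreeMonoid.inductionOn' with
  | one => rw [map_one, operator_one]; rfl
  | of_mul g C ih =>
    rw [map_mul, operator_mul, ← ih, operator_of]
    rfl

/-- The homomorphism from the presented monoid to the real Clifford group. -/
noncomputable def toClifford (n : ℕ) : PresentedMonoid (CircuitRel n) →* (cliffordGroup n)ᵐᵒᵖ :=
  PresentedMonoid.lift (fun g => MulOpposite.op g.clifford) fun C D h =>
    MulOpposite.unop_injective <| Subtype.ext <| Subtype.ext <| by
      rw [lift_clifford, lift_clifford, circuitRel_operator h]

theorem toClifford_mk (C : Circuit n) :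
    (((toClifford n (PresentedMonoid.mk (CircuitRel n) C)).unop :
      Matrix.orthogonalGroup (Fin n → Fin 2) ℝ) : Operator n) = C.operator :=
  lift_clifford C

theorem toClifford_bijective (n : ℕ) : Function.Bijective (toClifford n) := by
  constructor
  · intro x y h
    obtain ⟨C, rfl⟩ := exists_cls x
    obtain ⟨D, rfl⟩ := exists_cls y
    refine cls_eq_of_operator_eq ?_
    rw [← toClifford_mk, ← toClifford_mk, h]
  · intro U
    obtain ⟨N, hN⟩ := (mem_cliffordGroup_iff.1 U.unop.2).exists_normalCircuit
    refine ⟨cls N.circuit, MulOpposite.unop_injective (Subtype.ext (Subtype.ext ?_))⟩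
    rw [toClifford_mk, hN]

end CliffordGroup

/-! ### Finiteness of the presentation -/

section Finiteness

variable {n : ℕ}

instance : Finite (Gate n) := by
  refine Finite.of_injective (β := Option (Fin n ⊕ Fin n ⊕ Fin n)) (fun g => match g with
    | .neg => none
    | .H i => some (.inl i)
    | .Z i => some (.inr (.inl i))
    | .CZ i hi => some (.inr (.inr ⟨i, by omega⟩))) ?_
  intro g g' h
  cases g <;> cases g' <;> simp_all

/-- `14` is the length of the longest word in the relations. The bound gives finiteness, since there
are finitely many words of bounded length in finitely many gates. -/
theorem length_le_of_circuitRel {C D : Circuit n} (h : CircuitRel n C D) :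
    C.toList.length ≤ 14 ∧ D.toList.length ≤ 14 := by
  cases h with
  | slide g g' hd => exact ⟨by simp, by simp⟩
  | reduced huv k h =>
    cases huv <;> simp [Circuit.place]

theorem circuitRel_finite (n : ℕ) :
    {r : Circuit n × Circuit n | CircuitRel n r.1 r.2}.Finite := by
  have h : {C : Circuit n | C.toList.length ≤ 14}.Finite := List.finite_length_le (Gate n) 14
  exact (h.prod h).subset fun r hr => length_le_of_circuitRel hr

end Finiteness
end RealStabilizer

theorem mainTheorem4 (n : ℕ) :
    (∀ C : RealStabilizer.Circuit n, ∃ N : RealStabilizer.NormalCircuit n,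
      N.circuit.operator = C.operator ∧
      (∀ N' : RealStabilizer.NormalCircuit n, N'.circuit.operator = C.operator → N' = N) ∧
      RealStabilizer.Rewrites C N.circuit) ∧
    Finite (RealStabilizer.Gate n) ∧
    {r : RealStabilizer.Circuit n × RealStabilizer.Circuit n |
      RealStabilizer.CircuitRel n r.1 r.2}.Finite ∧
    ∃ e : PresentedMonoid (RealStabilizer.CircuitRel n) ≃*
        (RealStabilizer.cliffordGroup n)ᵐᵒᵖ,
      ∀ C : RealStabilizer.Circuit n,
        (((e (PresentedMonoid.mk (RealStabilizer.CircuitRel n) C)).unop :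
          Matrix.orthogonalGroup (Fin n → Fin 2) ℝ) : RealStabilizer.Operator n) = C.operator := by
  refine ⟨fun C => ?_, inferInstance, RealStabilizer.circuitRel_finite n,
    MulEquiv.ofBijective _ (RealStabilizer.toClifford_bijective n), RealStabilizer.toClifford_mk⟩
  obtain ⟨N, hN⟩ := (RealStabilizer.isClifford_operator C).exists_normalCircuit
  exact ⟨N, hN, fun N' h => RealStabilizer.normalCircuit_unique (h.trans hN.symm),
    RealStabilizer.cls_eq_iff.1 (RealStabilizer.cls_eq_of_operator_eq hN.symm)⟩
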